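/- Let $\Gamma=(V,E,\iota,\tau)$ be a finite directed graph (loops and parallel edges allowed; $\iota(e)$, $\tau(e)$ are the initial and terminal vertices of $e$) such that every vertex has out-degree at least $1$ and, whenever $e$ is the only edge originating from $\iota(e)$, then $e$ is a loop. For every vertex $v$ fix a linear order $e_1<\dots<e_r$ of $\iota^{-1}(v)$. Let $Y$ be a multiset with underlying set $V$ (a map $V\to\mathbb N$). **The group $G(\Gamma|Y)$.** The edge shift $X(\Gamma|Y)$ is the set of all infinite paths on $\Gamma$ starting from an element of $Y$ (copies of the same vertex are distinguished), with the topology generated by the cylinders $C_w$ (the set of infinite paths with prefix $w$), where $w$ runs over the finite paths starting from an element of $Y$. The color of $w$ is the vertex at which it ends. If $p,q$ have the same color, the canonical homeomorphism $\Phi_{p,q}\colon C_p\to C_q$ is $p\alpha\mapsto q\alpha$. $G(\Gamma|Y)$ is the group of all homeomorphisms $\phi$ of $X(\Gamma|Y)$ for which there are finite partitions $\{C_{w_1},\dots,C_{w_n}\}$ and $\{C_{v_1},\dots,C_{v_n}\}$ of $X(\Gamma|Y)$ into cylinders with $\phi|_{C_{w_i}}=\Phi_{w_i,v_i}$ for all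 $i$. Products are composed from left to right. **Strand diagrams.** A $\Gamma$-strand diagram is a finite acyclic directed graph (with *points* and *strands*) whose points and strands are colored by $V$, with a linear order of its sources and of its sinks, and with, at every point, a linear (left-to-right) order of the incoming strands and one of the outgoing strands, such that every point $p$, of color $c$, is of one of the following kinds: * a univalent source or a univalent sink, whose strand has color $c$; * a split: at most one incoming strand, which if present has color $c$, and outgoing strands $s_1<\dots<s_r$, $r\ge 2$, where $\iota^{-1}(c)=\{e_1<\dots<e_r\}$ and $s_i$ has color $\tau(e_i)$; * a merge: at most one outgoing strand, which if present has color $c$, and incoming strands $s_1<\dots<s_r$, $r\ge 2$, where $\iota^{-1}(c)=\{e_1<\dots<e_r\}$ and $s_i$ has color $\tau(e_i)$; * a degenerate point: one incoming and one outgoing strand, both of color $c$, where $\iota^{-1}(c)$ consists of a single loop. Its domain and its range are the tuples of the colors of its sources and of its sinks, respectively. Diagrams are considered up to isomorphism, and two of them are equivalent if they are related by a finite sequence of the following reductions and their inverses. *Type 0:* remove a degenerate point and join its two strands into one. *Type 1:* if the outgoing strands of a split $v$ are, in the same order, the incoming strands of a merge $w$ of the same color $c$, replace these strands, together with the incoming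 strand of $v$ and the outgoing strand of $w$ if they exist, by a single strand of color $c$; $v$ is removed unless it is a source, in which case it becomes a univalent source, and $w$ is removed unless it is a sink, in which case it becomes a univalent sink. *Type 2:* if the outgoing strand of a merge $v$ is the incoming strand of a split $w$ of the same color, remove $v$, $w$ and this strand, and join the $i$-th incoming strand of $v$ with the $i$-th outgoing strand of $w$ into one strand, for each $i$. **The groupoid $\mathcal G(\Gamma)$.** If the range of $A$ equals the domain of $B$, the diagram $AB$ is obtained by gluing, for each $i$, the $i$-th sink of $A$ with the $i$-th source of $B$ along a strand: a univalent sink or source is absorbed, together with its strand, into this strand, while a sink of $A$ that is a merge (a source of $B$ that is a split) becomes an internal merge (split) at which this strand starts (ends). $\mathcal G(\Gamma)$ is the set of equivalence classes of $\Gamma$-strand diagrams with the partial operation $[A][B]=[AB]$. **Statement.** The operation $[A][B]=[AB]$ is well defined and makes $\mathcal G(\Gamma)$ a groupoid whose objects are the finite tuples of vertices. For every linear order $y_1<\dots<y_k$ of the elements of $Y$, the group $G(\Gamma|Y)$ is isomorphic to the subgroupoid of $\mathcal G(\Gamma)$ consisting of all the elements whose domain and range are both $(y_1,\dots,y_k)$.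 -/

import Mathlib

namespace EdgeShift

universe u v

/-! ### Graphs, multisets and edge shifts -/

/-- A directed graph with vertex set `V` and edge set `E`; loops and parallel edges are allowed. -/
structure DirectedGraph (V : Type u) (E : Type v) where
  init : E → V
  term : E → V

variable {V : Type u} {E : Type v}

/-- No vertex has out-degree `0`. -/
def DirectedGraph.NoDeadEnds (Γ : DirectedGraph V E) : Prop := ∀ a, ∃ e, Γ.init e = a

/-- If `e` is the only edge originating from its initial vertex, then `e` is a loop. -/
def DirectedGraph.NoRedundantEdges (Γ : DirectedGraph V E) : Prop :=
  ∀ e, (∀ e', Γ.init e' = Γ.init e → e' = e) → Γ.term e = Γ.init e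

/-- The elements of a multiset `Y : V → ℕ` with underlying set `V`: a vertex `a` is taken
`Y a` times. -/
@[ext]
structure Copy (Y : V → ℕ) where
  vertex : V
  index : Fin (Y vertex)

/-- `w` is a finite path of `Γ` that starts at the vertex `a`. -/
def DirectedGraph.IsPathFrom (Γ : DirectedGraph V E) : V → List E → Prop
  | _, [] => True
  | a, e :: w => Γ.init e = a ∧ Γ.IsPathFrom (Γ.term e) w

/-- The vertex at which the path `w` starting at `a` ends. -/
def DirectedGraph.pathEnd (Γ : DirectedGraph V E) : V → List E → V
  | a, [] => a
  | _, e :: w => Γ.pathEnd (Γ.term e) w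

/-- The edge shift: infinite paths on `Γ` starting from an element of `Y`. -/
@[ext]
structure Shift (Γ : DirectedGraph V E) (Y : V → ℕ) where
  start : Copy Y
  path : ℕ → E
  init_path : Γ.init (path 0) = start.vertex
  term_path : ∀ n, Γ.term (path n) = Γ.init (path (n + 1))

/-- The language: finite paths on `Γ` starting from an element of `Y`. -/
@[ext]
structure Lang (Γ : DirectedGraph V E) (Y : V → ℕ) where
  start : Copy Y
  word : List E
  isPath : Γ.IsPathFrom start.vertex word

section Groups

variable {Γ : DirectedGraph V E} {Y : V → ℕ}

/-- The color of a node `y e₁ … eₙ`: the terminal vertex of `eₙ`, or `y` if `n = 0`. -/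
def Lang.color (p : Lang Γ Y) : V := Γ.pathEnd p.start.vertex p.word

/-- The cylinder `C_p`: the points of the shift that have `p` as a prefix. -/
def Lang.cylinder (p : Lang Γ Y) : Set (Shift Γ Y) :=
  {x | x.start = p.start ∧ ∀ (i : ℕ) (h : i < p.word.length), x.path i = p.word[i]}

/-- The topology generated by the cylinders. -/
instance : TopologicalSpace (Shift Γ Y) :=
  TopologicalSpace.generateFrom (Set.range (Lang.cylinder (Γ := Γ) (Y := Y)))

/-- `x = pα`: the point `x` is the node `p` followed by the infinite sequence `α`. -/
def Lang.IsConcat (p : Lang Γ Y) (α : ℕ → E) (x : Shift Γ Y) : Prop :=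
  x ∈ p.cylinder ∧ ∀ n, x.path (p.word.length + n) = α n

/-- The nodes `p`, `q` have the same color and the restriction of `φ` to `C_p` is the canonical
homeomorphism `C_p → C_q`, `pα ↦ qα`. -/
def IsCanonicalOn (φ : Shift Γ Y → Shift Γ Y) (p q : Lang Γ Y) : Prop :=
  p.color = q.color ∧ ∀ α x, p.IsConcat α x → q.IsConcat α (φ x)

/-- The cylinders of the nodes `w i` form a partition of the shift. -/
def IsCylinderPartition {ι : Type*} (w : ι → Lang Γ Y) : Prop :=
  ∀ x, ∃! i, x ∈ (w i).cylinder

/-- Piecewise-canonical homeomorphisms of the shift. -/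
def IsPiecewiseCanonical (φ : Shift Γ Y ≃ₜ Shift Γ Y) : Prop :=
  ∃ (k : ℕ) (w r : Fin k → Lang Γ Y), IsCylinderPartition w ∧ IsCylinderPartition r ∧
    ∀ i, IsCanonicalOn φ (w i) (r i)

/-! The piecewise-canonical homeomorphisms are closed under composition and inverses. -/

theorem isPiecewiseCanonical_of_finite {ι : Type*} [Finite ι] {φ : Shift Γ Y ≃ₜ Shift Γ Y}
    (w r : ι → Lang Γ Y) (hw : IsCylinderPartition w) (hr : IsCylinderPartition r)
    (h : ∀ i, IsCanonicalOn φ (w i) (r i)) : IsPiecewiseCanonical φ := by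
  obtain ⟨k, ⟨e⟩⟩ := Finite.exists_equiv_fin ι
  refine ⟨k, w ∘ e.symm, r ∘ e.symm, ?_, ?_, fun i => h _⟩
  · intro x
    obtain ⟨i, hi, hu⟩ := hw x
    exact ⟨e i, by simpa using hi, fun j hj => by rw [← hu _ hj]; simp⟩
  · intro x
    obtain ⟨i, hi, hu⟩ := hr x
    exact ⟨e i, by simpa using hi, fun j hj => by rw [← hu _ hj]; simp⟩

theorem isCanonicalOn_iff {φ : Shift Γ Y → Shift Γ Y} {p q : Lang Γ Y} :
    IsCanonicalOn φ p q ↔ p.color = q.color ∧ ∀ x ∈ p.cylinder, φ x ∈ q.cylinder ∧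
      ∀ n, (φ x).path (q.word.length + n) = x.path (p.word.length + n) := by
  constructor
  · rintro ⟨h, h'⟩
    exact ⟨h, fun x hx => h' (fun n => x.path (p.word.length + n)) x ⟨hx, fun n => rfl⟩⟩
  · rintro ⟨h, h'⟩
    refine ⟨h, fun α x hx => ⟨(h' x hx.1).1, fun n => ?_⟩⟩
    rw [(h' x hx.1).2, hx.2]

theorem IsCanonicalOn.symm_mem {ι : Type*} {φ : Shift Γ Y ≃ₜ Shift Γ Y} {w r : ι → Lang Γ Y}
    (hw : IsCylinderPartition w) (hr : IsCylinderPartition r)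
    (h : ∀ i, IsCanonicalOn φ (w i) (r i)) {i : ι} {x : Shift Γ Y} (hx : x ∈ (r i).cylinder) :
    φ.symm x ∈ (w i).cylinder := by
  obtain ⟨j, hj, -⟩ := hw (φ.symm x)
  have h1 := ((isCanonicalOn_iff.1 (h j)).2 _ hj).1
  rw [φ.apply_symm_apply] at h1
  rwa [(hr x).unique hx h1]

theorem IsCanonicalOn.symm {ι : Type*} {φ : Shift Γ Y ≃ₜ Shift Γ Y} {w r : ι → Lang Γ Y}
    (hw : IsCylinderPartition w) (hr : IsCylinderPartition r)
    (h : ∀ i, IsCanonicalOn φ (w i) (r i)) (i : ι) : IsCanonicalOn φ.symm (r i) (w i) := by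
  refine isCanonicalOn_iff.2 ⟨(h i).1.symm, fun x hx => ?_⟩
  have h1 := IsCanonicalOn.symm_mem hw hr h hx
  refine ⟨h1, fun n => ?_⟩
  rw [← ((isCanonicalOn_iff.1 (h i)).2 _ h1).2 n, φ.apply_symm_apply]

/-- The empty path at an element of `Y`. -/
def Lang.root (y : Copy Y) : Lang Γ Y := ⟨y, [], trivial⟩

theorem isPiecewiseCanonical_refl [Finite V] :
    IsPiecewiseCanonical (Homeomorph.refl (Shift Γ Y)) := by
  have : Finite (Copy Y) := Finite.of_injective
    (fun y : Copy Y => (⟨y.vertex, y.index⟩ : Σ a, Fin (Y a)))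
    (by rintro ⟨a, i⟩ ⟨b, j⟩ hij; simpa using hij)
  have key : IsCylinderPartition (Lang.root (Γ := Γ) (Y := Y)) := fun x =>
    ⟨x.start, ⟨rfl, fun i hi => by simp [Lang.root] at hi⟩, fun y hy => hy.1.symm⟩
  exact isPiecewiseCanonical_of_finite _ _ key key fun i => ⟨rfl, fun α x hx => hx⟩

theorem Shift.isPathFrom_ofFn (x : Shift Γ Y) (k n : ℕ) :
    Γ.IsPathFrom (Γ.init (x.path k)) ((List.range' k n).map x.path) := by
  induction n generalizing k with
  | zero => exact trivial
  | succ n ih => exact ⟨rfl, by rw [x.term_path]; exact ih (k + 1)⟩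

theorem Shift.pathEnd_ofFn (x : Shift Γ Y) (k n : ℕ) :
    Γ.pathEnd (Γ.init (x.path k)) ((List.range' k n).map x.path) = Γ.init (x.path (k + n)) := by
  induction n generalizing k with
  | zero => rfl
  | succ n ih =>
    simp only [List.range'_succ, List.map_cons, DirectedGraph.pathEnd]
    rw [x.term_path, ih (k + 1)]
    congr 2
    omega

/-- The prefix of length `n` of a point of the shift. -/
def Shift.take (x : Shift Γ Y) (n : ℕ) : Lang Γ Y :=
  ⟨x.start, (List.range' 0 n).map x.path, by rw [← x.init_path]; exact x.isPathFrom_ofFn 0 n⟩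

theorem Shift.length_take (x : Shift Γ Y) (n : ℕ) : (x.take n).word.length = n := by
  simp [Shift.take]

theorem Shift.color_take (x : Shift Γ Y) (n : ℕ) :
    (x.take n).color = Γ.init (x.path n) := by
  have := x.pathEnd_ofFn 0 n
  rw [Nat.zero_add] at this
  rw [← this, x.init_path]
  rfl

theorem Shift.mem_cylinder_take {x z : Shift Γ Y} {n : ℕ} :
    z ∈ (x.take n).cylinder ↔ z.start = x.start ∧ ∀ i < n, z.path i = x.path i := by
  simp [Lang.cylinder, Shift.take]

theorem Lang.mem_cylinder_iff {p : Lang Γ Y} {x z : Shift Γ Y} (hx : x ∈ p.cylinder) :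
    z ∈ p.cylinder ↔ z.start = x.start ∧ ∀ i < p.word.length, z.path i = x.path i := by
  constructor
  · exact fun hz => ⟨hz.1.trans hx.1.symm, fun i hi => (hz.2 i hi).trans (hx.2 i hi).symm⟩
  · exact fun hz => ⟨hz.1.trans hx.1, fun i hi => (hz.2 i hi).trans (hx.2 i hi)⟩

/-- The preimage of a cylinder `C_q` under a canonical homeomorphism `C_w → C_r` is a cylinder. -/
theorem mem_cylinder_refine {φ : Shift Γ Y ≃ₜ Shift Γ Y} {w r q : Lang Γ Y}
    (h : IsCanonicalOn φ w r) {x : Shift Γ Y} (hx : x ∈ w.cylinder) (hq : φ x ∈ q.cylinder)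
    (z : Shift Γ Y) :
    z ∈ (x.take (w.word.length + (q.word.length - r.word.length))).cylinder ↔
      z ∈ w.cylinder ∧ φ z ∈ q.cylinder := by
  have h2 := (isCanonicalOn_iff.1 h).2
  rw [Shift.mem_cylinder_take]
  constructor
  · rintro ⟨hs, hp⟩
    have hz : z ∈ w.cylinder :=
      (Lang.mem_cylinder_iff hx).2 ⟨hs, fun i hi => hp i (by omega)⟩
    refine ⟨hz, (Lang.mem_cylinder_iff hq).2 ?_⟩
    have hr := (Lang.mem_cylinder_iff (h2 x hx).1).1 (h2 z hz).1
    refine ⟨hr.1, fun i hi => ?_⟩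
    by_cases hir : i < r.word.length
    · exact hr.2 i hir
    · obtain ⟨n, rfl⟩ := Nat.exists_eq_add_of_le (not_lt.1 hir)
      rw [(h2 x hx).2, (h2 z hz).2]
      exact hp _ (by omega)
  · rintro ⟨hz, hzq⟩
    have h3 := (Lang.mem_cylinder_iff hx).1 hz
    refine ⟨h3.1, fun i hi => ?_⟩
    by_cases hir : i < w.word.length
    · exact h3.2 i hir
    · obtain ⟨n, rfl⟩ := Nat.exists_eq_add_of_le (not_lt.1 hir)
      rw [← (h2 x hx).2, ← (h2 z hz).2]
      exact ((Lang.mem_cylinder_iff hq).1 hzq).2 _ (by omega)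

theorem IsPiecewiseCanonical.symm {φ : Shift Γ Y ≃ₜ Shift Γ Y} (h : IsPiecewiseCanonical φ) :
    IsPiecewiseCanonical φ.symm := by
  obtain ⟨k, w, r, hw, hr, h⟩ := h
  exact ⟨k, r, w, hr, hw, IsCanonicalOn.symm hw hr h⟩

theorem IsPiecewiseCanonical.trans {φ ψ : Shift Γ Y ≃ₜ Shift Γ Y} (hφ : IsPiecewiseCanonical φ)
    (hψ : IsPiecewiseCanonical ψ) : IsPiecewiseCanonical (φ.trans ψ) := by
  obtain ⟨k, w, r, hw, hr, h⟩ := hφ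
  obtain ⟨l, w', r', hw', hr', h'⟩ := hψ
  let ι := {t : Fin k × Fin l // ∃ x, x ∈ (w t.1).cylinder ∧ φ x ∈ (w' t.2).cylinder}
  choose x hx using fun t : ι => t.2
  have hs := IsCanonicalOn.symm hw hr h
  have hs' := IsCanonicalOn.symm hw' hr' h'
  let d : ι → Lang Γ Y := fun t => (x t).take
    ((w t.1.1).word.length + ((w' t.1.2).word.length - (r t.1.1).word.length))
  let e : ι → Lang Γ Y := fun t => (ψ (φ (x t))).take
    ((r' t.1.2).word.length + ((r t.1.1).word.length - (w' t.1.2).word.length))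
  have hd : ∀ t z, z ∈ (d t).cylinder ↔ z ∈ (w t.1.1).cylinder ∧ φ z ∈ (w' t.1.2).cylinder :=
    fun t z => mem_cylinder_refine (h _) (hx t).1 (hx t).2 z
  have he : ∀ t z, z ∈ (e t).cylinder ↔
      z ∈ (r' t.1.2).cylinder ∧ ψ.symm z ∈ (r t.1.1).cylinder := fun t z =>
    mem_cylinder_refine (hs' _) ((isCanonicalOn_iff.1 (h' _)).2 _ (hx t).2).1
      (by rw [ψ.symm_apply_apply]; exact ((isCanonicalOn_iff.1 (h _)).2 _ (hx t).1).1) z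
  refine isPiecewiseCanonical_of_finite d e ?_ ?_ ?_
  · intro z
    obtain ⟨i, hi, hi'⟩ := hw z
    obtain ⟨j, hj, hj'⟩ := hw' (φ z)
    refine ⟨⟨(i, j), z, hi, hj⟩, (hd _ _).2 ⟨hi, hj⟩, fun t ht => ?_⟩
    have := (hd _ _).1 ht
    exact Subtype.ext (Prod.ext (hi' _ this.1) (hj' _ this.2))
  · intro z
    obtain ⟨i, hi, hi'⟩ := hr (ψ.symm z)
    obtain ⟨j, hj, hj'⟩ := hr' z
    have h1 := ((isCanonicalOn_iff.1 (hs i)).2 _ hi).1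
    have h2 := ((isCanonicalOn_iff.1 (hs' j)).2 _ hj).1
    refine ⟨⟨(i, j), φ.symm (ψ.symm z), h1, by rwa [φ.apply_symm_apply]⟩,
      (he _ _).2 ⟨hj, hi⟩, fun t ht => ?_⟩
    have := (he _ _).1 ht
    exact Subtype.ext (Prod.ext (hi' _ this.2) (hj' _ this.1))
  · intro t
    have c1 := (isCanonicalOn_iff.1 (h t.1.1)).2
    have c2 := (isCanonicalOn_iff.1 (h' t.1.2)).2
    have key : ∀ z ∈ (d t).cylinder, ∀ n,
        (ψ (φ z)).path ((r' t.1.2).word.length +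
          ((r t.1.1).word.length - (w' t.1.2).word.length) + n) =
        z.path ((w t.1.1).word.length +
          ((w' t.1.2).word.length - (r t.1.1).word.length) + n) := by
      intro z hz n
      have := (hd _ _).1 hz
      rw [add_assoc, (c2 _ this.2).2, add_assoc, ← (c1 _ this.1).2]
      congr 1
      omega
    have hxd : x t ∈ (d t).cylinder := (hd _ _).2 (hx t)
    refine isCanonicalOn_iff.2 ⟨?_, fun z hz => ⟨(he _ _).2 ?_, fun n => ?_⟩⟩
    · simp only [d, e, Shift.color_take]
      exact congrArg Γ.init (by simpa using (key _ hxd 0).symm)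
    · have := (hd _ _).1 hz
      exact ⟨(c2 _ this.2).1, by
        rw [Homeomorph.trans_apply, ψ.symm_apply_apply]; exact (c1 _ this.1).1⟩
    · simp only [d, e, Shift.length_take]
      exact key z hz n

end Groups

/-- The group of piecewise-canonical homeomorphisms of the edge shift. -/
def PiecewiseCanonical (Γ : DirectedGraph V E) (Y : V → ℕ) : Type (max u v) :=
  {φ : Shift Γ Y ≃ₜ Shift Γ Y // IsPiecewiseCanonical φ}

/-- Homeomorphisms are composed on the right: `f * g` means `f` first and `g` second. -/
instance (Γ : DirectedGraph V E) (Y : V → ℕ) [Finite V] : Group (PiecewiseCanonical Γ Y) where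
  mul f g := ⟨f.1.trans g.1, f.2.trans g.2⟩
  one := ⟨Homeomorph.refl _, isPiecewiseCanonical_refl⟩
  inv f := ⟨f.1.symm, f.2.symm⟩
  mul_assoc _ _ _ := rfl
  one_mul _ := rfl
  mul_one _ := rfl
  inv_mul_cancel f := Subtype.ext (Homeomorph.ext f.1.apply_symm_apply)

/-! ### Strand diagrams -/

/-- A linear order of the set of edges originating from each vertex `a`, written as the list
`e₁ < … < eₖ` of these edges. -/
structure EdgeOrder (Γ : DirectedGraph V E) where
  out : V → List E
  out_nodup : ∀ a, (out a).Nodup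
  mem_out : ∀ a e, e ∈ out a ↔ Γ.init e = a

/-- A finite tuple of vertices. -/
structure Tuple (V : Type u) where
  length : ℕ
  get : Fin length → V

/-- A finite acyclic graph, vertex- and edge-colored by `V`, whose strands terminating at and
originating from each point are listed from left to right (`ins` and `outs`), as in a plane
drawing in which all the strands are directed downwards. -/
structure StrandGraph (V : Type u) where
  Point : Type
  Strand : Type
  finite_point : Finite Point
  finite_strand : Finite Strand
  init : Strand → Point
  term : Strand → Point
  pointCol : Point → V
  strandCol : Strand → V
  ins : Point → List Strand
  outs : Point → List Strand
  ins_nodup : ∀ p, (ins p).Nodup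
  outs_nodup : ∀ p, (outs p).Nodup
  mem_ins : ∀ p s, s ∈ ins p ↔ term s = p
  mem_outs : ∀ p s, s ∈ outs p ↔ init s = p
  acyclic : ∀ p, ¬ Relation.TransGen (fun a b => ∃ s, init s = a ∧ term s = b) p p

namespace StrandGraph

variable (A : StrandGraph V)

/-- A source: a point that is not the terminus of any strand. -/
def IsSource (p : A.Point) : Prop := A.ins p = []

/-- A sink: a point that is not the origin of any strand. -/
def IsSink (p : A.Point) : Prop := A.outs p = []

def IsUnivalentSource (p : A.Point) : Prop := A.IsSource p ∧ (A.outs p).length = 1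

def IsUnivalentSink (p : A.Point) : Prop := A.IsSink p ∧ (A.ins p).length = 1

/-- A split (internal split or split-source). -/
def IsSplit (p : A.Point) : Prop := (A.ins p).length ≤ 1 ∧ 2 ≤ (A.outs p).length

/-- A merge (internal merge or merge-sink). -/
def IsMerge (p : A.Point) : Prop := (A.outs p).length ≤ 1 ∧ 2 ≤ (A.ins p).length

def IsDegenerate (p : A.Point) : Prop := (A.ins p).length = 1 ∧ (A.outs p).length = 1

end StrandGraph

/-- A `Γ`-strand diagram with domain `x` and range `y`. -/
structure StrandDiagram {Γ : DirectedGraph V E} (o : EdgeOrder Γ) (x y : Tuple V) extends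
    StrandGraph V where
  /-- the linear order of the sources -/
  source : Fin x.length ≃ {p // toStrandGraph.IsSource p}
  /-- the linear order of the sinks -/
  sink : Fin y.length ≃ {p // toStrandGraph.IsSink p}
  source_col : ∀ i, pointCol (source i) = x.get i
  sink_col : ∀ i, pointCol (sink i) = y.get i
  kind : ∀ p, toStrandGraph.IsUnivalentSource p ∨ toStrandGraph.IsUnivalentSink p ∨
    toStrandGraph.IsSplit p ∨ toStrandGraph.IsMerge p ∨ toStrandGraph.IsDegenerate p
  univalentSource_col : ∀ p, toStrandGraph.IsUnivalentSource p →
    ∀ s ∈ outs p, strandCol s = pointCol p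
  univalentSink_col : ∀ p, toStrandGraph.IsUnivalentSink p →
    ∀ s ∈ ins p, strandCol s = pointCol p
  split_col : ∀ p, toStrandGraph.IsSplit p →
    (outs p).map strandCol = (o.out (pointCol p)).map Γ.term ∧
    ∀ s ∈ ins p, strandCol s = pointCol p
  merge_col : ∀ p, toStrandGraph.IsMerge p →
    (ins p).map strandCol = (o.out (pointCol p)).map Γ.term ∧
    ∀ s ∈ outs p, strandCol s = pointCol p
  degenerate_col : ∀ p, toStrandGraph.IsDegenerate p →
    (∀ s ∈ ins p, strandCol s = pointCol p) ∧ (∀ s ∈ outs p, strandCol s = pointCol p) ∧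
    ∃ e, o.out (pointCol p) = [e] ∧ Γ.term e = pointCol p

namespace StrandDiagram

variable {Γ : DirectedGraph V E} {o : EdgeOrder Γ} {x y z : Tuple V}

/-! ### Equivalence of strand diagrams -/

/-- Isomorphism of `Γ`-strand diagrams. -/
def Isomorphic (A B : StrandDiagram o x y) : Prop :=
  ∃ (P : A.Point ≃ B.Point) (S : A.Strand ≃ B.Strand),
    (∀ s, B.init (S s) = P (A.init s)) ∧ (∀ s, B.term (S s) = P (A.term s)) ∧
    (∀ p, B.pointCol (P p) = A.pointCol p) ∧ (∀ s, B.strandCol (S s) = A.strandCol s) ∧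
    (∀ p, B.ins (P p) = (A.ins p).map S) ∧ (∀ p, B.outs (P p) = (A.outs p).map S) ∧
    (∀ i, (B.source i : B.Point) = P (A.source i)) ∧ (∀ i, (B.sink i : B.Point) = P (A.sink i))

/-- `P` identifies the points of `B` with the points of `A` outside of `D`, with the same colors
and the same ordered sources and sinks. -/
structure DeletesPoints (A B : StrandDiagram o x y) (P : B.Point → A.Point)
    (D : Set A.Point) : Prop where
  injective : Function.Injective P
  range_eq : Set.range P = Dᶜ
  pointCol : ∀ q, B.pointCol q = A.pointCol (P q)
  source : ∀ i, P (B.source i) = A.source i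
  sink : ∀ i, P (B.sink i) = A.sink i

/-- `B` is obtained from `A` by a type 0 reduction: a degenerate point `v` is removed and the
strands `s₁`, `s₂` terminating at and originating from `v` are joined into a single one. Here `σ`
sends each strand of `A` to the strand of `B` that it becomes (or becomes a part of). -/
def Reduction0 (A B : StrandDiagram o x y) : Prop :=
  ∃ (v : A.Point) (s₁ s₂ : A.Strand) (P : B.Point → A.Point) (σ : A.Strand → B.Strand),
    A.ins v = [s₁] ∧ A.outs v = [s₂] ∧ DeletesPoints A B P {v} ∧
    Function.Surjective σ ∧
    (∀ s s', σ s = σ s' ↔ s = s' ∨ ((s = s₁ ∨ s = s₂) ∧ (s' = s₁ ∨ s' = s₂))) ∧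
    (∀ s, B.strandCol (σ s) = A.strandCol s) ∧
    (∀ q, B.ins q = (A.ins (P q)).map σ) ∧ (∀ q, B.outs q = (A.outs (P q)).map σ)

/-- `B` is obtained from `A` by a type 1 reduction: a split `v` and a merge `w` of the same color
are joined by the strands `s₁, …, sₖ` originating from `v` and terminating at `w`, in the same
order. These strands, the strand terminating at `v` (if any) and the strand originating from `w`
(if any) become one single strand. The point `v` is removed if it is internal, and it becomes
a univalent source if it is a split-source. The point `w` is removed if it is internal, and it
becomes a univalent sink if it is a merge-sink. Again, `σ` sends each strand of `A` to the strand
of `B` that it becomes (a part of). -/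
def Reduction1 (A B : StrandDiagram o x y) : Prop :=
  ∃ (v w : A.Point) (P : B.Point → A.Point) (σ : A.Strand → B.Strand),
    A.IsSplit v ∧ A.IsMerge w ∧ A.pointCol v = A.pointCol w ∧ A.outs v = A.ins w ∧
    DeletesPoints A B P {p | (p = v ∧ ¬ A.IsSource v) ∨ (p = w ∧ ¬ A.IsSink w)} ∧
    Function.Surjective σ ∧
    (∀ s s', σ s = σ s' ↔ s = s' ∨
      ((s ∈ A.ins v ∨ s ∈ A.outs v ∨ s ∈ A.outs w) ∧
        (s' ∈ A.ins v ∨ s' ∈ A.outs v ∨ s' ∈ A.outs w))) ∧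
    (∀ s, s ∉ A.outs v → B.strandCol (σ s) = A.strandCol s) ∧
    (∀ s ∈ A.outs v, B.strandCol (σ s) = A.pointCol v) ∧
    (∀ q, P q ≠ v → P q ≠ w →
      B.ins q = (A.ins (P q)).map σ ∧ B.outs q = (A.outs (P q)).map σ) ∧
    (∀ q, P q = v → B.ins q = [] ∧ ∀ s ∈ A.outs v, B.outs q = [σ s]) ∧
    (∀ q, P q = w → (∀ s ∈ A.outs v, B.ins q = [σ s]) ∧ B.outs q = [])

/-- `B` is obtained from `A` by a type 2 reduction: a merge `v` and a split `w` of the same color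
are joined by a strand `s`. Then `v`, `w` and `s` are removed and the `i`-th strand terminating at
`v` is joined with the `i`-th strand originating from `w` into a single one. Again, `σ` sends each
strand of `A` other than `s` to the strand of `B` that it becomes (a part of); its value at `s` is
irrelevant. -/
def Reduction2 (A B : StrandDiagram o x y) : Prop :=
  ∃ (v w : A.Point) (s : A.Strand) (P : B.Point → A.Point) (σ : A.Strand → B.Strand),
    A.IsMerge v ∧ A.IsSplit w ∧ A.pointCol v = A.pointCol w ∧ A.outs v = [s] ∧ A.ins w = [s] ∧
    DeletesPoints A B P {v, w} ∧
    (∀ t, ∃ r, r ≠ s ∧ σ r = t) ∧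
    (∀ r r', r ≠ s → r' ≠ s → (σ r = σ r' ↔ r = r' ∨
      (r, r') ∈ (A.ins v).zip (A.outs w) ∨ (r', r) ∈ (A.ins v).zip (A.outs w))) ∧
    (∀ r, r ≠ s → B.strandCol (σ r) = A.strandCol r) ∧
    (∀ q, B.ins q = (A.ins (P q)).map σ) ∧ (∀ q, B.outs q = (A.outs (P q)).map σ)

/-- Equivalence of `Γ`-strand diagrams: the equivalence relation generated by the three types of
reductions, where isomorphic diagrams are regarded as equal. -/
def setoid (o : EdgeOrder Γ) (x y : Tuple V) : Setoid (StrandDiagram o x y) :=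
  Relation.EqvGen.setoid fun A B =>
    Isomorphic A B ∨ Reduction0 A B ∨ Reduction1 A B ∨ Reduction2 A B

/-! ### Composition of strand diagrams

`A` is drawn above `B` and the `i`-th sink of `A` is glued with the `i`-th source of `B`.
A univalent sink of `A` and the strand terminating at it are absorbed into the `i`-th seam, and so
are a univalent source of `B` and the strand originating from it. A merge-sink of `A` becomes an
internal merge, from which the `i`-th seam originates, and a split-source of `B` becomes
an internal split, at which the `i`-th seam terminates. -/

section Glue

variable (A : StrandDiagram o x y) (B : StrandDiagram o y z)

/-- The points of `AB`. -/
abbrev GluePoint : Type :=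
  {p : A.Point // ¬ A.IsUnivalentSink p} ⊕ {q : B.Point // ¬ B.IsUnivalentSource q}

/-- The strands of `AB`; the last summand consists of the seams. -/
abbrev GlueStrand : Type :=
  {s : A.Strand // ¬ A.IsUnivalentSink (A.term s)} ⊕
    {s : B.Strand // ¬ B.IsUnivalentSource (B.init s)} ⊕ Fin y.length

variable {A B}

theorem not_isUnivalentSink_init (s : A.Strand) : ¬ A.IsUnivalentSink (A.init s) := fun h => by
  have := (A.mem_outs _ s).2 rfl
  rw [h.1] at this
  simp at this

theorem not_isUnivalentSource_term (s : B.Strand) : ¬ B.IsUnivalentSource (B.term s) := fun h => by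
  have := (B.mem_ins _ s).2 rfl
  rw [h.1] at this
  simp at this

open Classical in
/-- The strand of `AB` that contains a given strand of `A`. -/
noncomputable def glueLeft (s : A.Strand) : GlueStrand A B :=
  if h : A.IsUnivalentSink (A.term s) then .inr (.inr (A.sink.symm ⟨_, h.1⟩)) else .inl ⟨s, h⟩

open Classical in
/-- The strand of `AB` that contains a given strand of `B`. -/
noncomputable def glueRight (s : B.Strand) : GlueStrand A B :=
  if h : B.IsUnivalentSource (B.init s) then .inr (.inr (B.source.symm ⟨_, h.1⟩))
  else .inr (.inl ⟨s, h⟩)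

variable (A B)

open Classical in
/-- The point of `A` from which the `i`-th seam originates. -/
noncomputable def seamInit (i : Fin y.length) : {p : A.Point // ¬ A.IsUnivalentSink p} :=
  if h : A.IsUnivalentSink (A.sink i) then
    ⟨A.init ((A.ins (A.sink i)).head (fun h' => absurd h.2 (by simp [h']))),
      not_isUnivalentSink_init _⟩
  else ⟨A.sink i, h⟩

open Classical in
/-- The point of `B` at which the `i`-th seam terminates. -/
noncomputable def seamTerm (i : Fin y.length) : {q : B.Point // ¬ B.IsUnivalentSource q} :=
  if h : B.IsUnivalentSource (B.source i) then
    ⟨B.term ((B.outs (B.source i)).head (fun h' => absurd h.2 (by simp [h']))),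
      not_isUnivalentSource_term _⟩
  else ⟨B.source i, h⟩

noncomputable def glueInit : GlueStrand A B → GluePoint A B
  | .inl s => .inl ⟨A.init s, not_isUnivalentSink_init _⟩
  | .inr (.inl s) => .inr ⟨B.init s, s.2⟩
  | .inr (.inr i) => .inl (A.seamInit i)

noncomputable def glueTerm : GlueStrand A B → GluePoint A B
  | .inl s => .inl ⟨A.term s, s.2⟩
  | .inr (.inl s) => .inr ⟨B.term s, not_isUnivalentSource_term _⟩
  | .inr (.inr i) => .inr (B.seamTerm i)

open Classical in
noncomputable def glueIns : GluePoint A B → List (GlueStrand A B)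
  | .inl p => (A.ins p).map glueLeft
  | .inr q => if h : B.IsSource q then [.inr (.inr (B.source.symm ⟨q, h⟩))]
      else (B.ins q).map glueRight

open Classical in
noncomputable def glueOuts : GluePoint A B → List (GlueStrand A B)
  | .inl p => if h : A.IsSink p then [.inr (.inr (A.sink.symm ⟨p, h⟩))]
      else (A.outs p).map glueLeft
  | .inr q => (B.outs q).map glueRight

def gluePointCol : GluePoint A B → V
  | .inl p => A.pointCol p
  | .inr q => B.pointCol q

def glueStrandCol : GlueStrand A B → V
  | .inl s => A.strandCol s
  | .inr (.inl s) => B.strandCol s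
  | .inr (.inr i) => y.get i

variable {A B}

theorem eq_of_mem_univalent {T : Type*} {l : List T} (h : l.length = 1) {a b : T} (ha : a ∈ l)
    (hb : b ∈ l) : a = b := by
  obtain ⟨c, rfl⟩ := List.length_eq_one_iff.1 h
  simp at ha hb
  rw [ha, hb]

theorem glueLeft_injective : Function.Injective (glueLeft (A := A) (B := B)) := by
  intro s t hst
  unfold glueLeft at hst
  split_ifs at hst with h1 h2 h2
  · have h3 : A.term s = A.term t := by simpa using hst
    exact eq_of_mem_univalent h1.2 ((A.mem_ins _ _).2 rfl) ((A.mem_ins _ _).2 h3.symm)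
  · simpa using hst

theorem glueRight_injective : Function.Injective (glueRight (A := A) (B := B)) := by
  intro s t hst
  unfold glueRight at hst
  split_ifs at hst with h1 h2 h2
  · have h3 : B.init s = B.init t := by simpa using hst
    exact eq_of_mem_univalent h1.2 ((B.mem_outs _ _).2 rfl) ((B.mem_outs _ _).2 h3.symm)
  · simp at hst
  · simp at hst
  · simpa using hst

theorem seamInit_term {s : A.Strand} (h : A.IsUnivalentSink (A.term s)) :
    A.seamInit (A.sink.symm ⟨_, h.1⟩) = ⟨A.init s, not_isUnivalentSink_init _⟩ := by
  have h' : A.IsUnivalentSink (A.sink (A.sink.symm ⟨_, h.1⟩)) := by simpa using h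
  unfold seamInit
  rw [dif_pos h']
  refine Subtype.ext (congrArg A.init ?_)
  refine eq_of_mem_univalent h'.2 (List.head_mem _) ((A.mem_ins _ _).2 ?_)
  simp

theorem seamTerm_init {s : B.Strand} (h : B.IsUnivalentSource (B.init s)) :
    B.seamTerm (B.source.symm ⟨_, h.1⟩) = ⟨B.term s, not_isUnivalentSource_term _⟩ := by
  have h' : B.IsUnivalentSource (B.source (B.source.symm ⟨_, h.1⟩)) := by simpa using h
  unfold seamTerm
  rw [dif_pos h']
  refine Subtype.ext (congrArg B.term ?_)
  refine eq_of_mem_univalent h'.2 (List.head_mem _) ((B.mem_outs _ _).2 ?_)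
  simp

theorem glueInit_glueLeft (s : A.Strand) :
    glueInit A B (glueLeft s) = .inl ⟨A.init s, not_isUnivalentSink_init _⟩ := by
  unfold glueLeft
  split_ifs with h
  · exact congrArg Sum.inl (seamInit_term h)
  · rfl

theorem glueTerm_glueRight (s : B.Strand) :
    glueTerm A B (glueRight s) = .inr ⟨B.term s, not_isUnivalentSource_term _⟩ := by
  unfold glueRight
  split_ifs with h
  · exact congrArg Sum.inr (seamTerm_init h)
  · rfl

theorem glueLeft_of_not {s : A.Strand} (h : ¬ A.IsUnivalentSink (A.term s)) :
    glueLeft (B := B) s = .inl ⟨s, h⟩ := dif_neg h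

theorem glueRight_of_not {s : B.Strand} (h : ¬ B.IsUnivalentSource (B.init s)) :
    glueRight (A := A) s = .inr (.inl ⟨s, h⟩) := dif_neg h

/-- A seam is the image of a strand of `A`, or it originates from a merge-sink of `A`. -/
theorem seam_left (i : Fin y.length) :
    (∃ s : A.Strand, A.term s = A.sink i ∧ glueLeft (B := B) s = .inr (.inr i)) ∨
      (¬ A.IsUnivalentSink (A.sink i) ∧ (A.seamInit i : A.Point) = A.sink i) := by
  by_cases h : A.IsUnivalentSink (A.sink i)
  · left
    obtain ⟨s, hs⟩ := List.length_eq_one_iff.1 h.2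
    have hs' : A.term s = A.sink i := (A.mem_ins _ _).1 (by simp [hs])
    refine ⟨s, hs', ?_⟩
    unfold glueLeft
    rw [dif_pos (by rw [hs']; exact h)]
    congr 2
    rw [Equiv.symm_apply_eq]
    exact Subtype.ext hs'
  · exact .inr ⟨h, by unfold seamInit; rw [dif_neg h]⟩

theorem seam_right (i : Fin y.length) :
    (∃ s : B.Strand, B.init s = B.source i ∧ glueRight (A := A) s = .inr (.inr i)) ∨
      (¬ B.IsUnivalentSource (B.source i) ∧ (B.seamTerm i : B.Point) = B.source i) := by
  by_cases h : B.IsUnivalentSource (B.source i)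
  · left
    obtain ⟨s, hs⟩ := List.length_eq_one_iff.1 h.2
    have hs' : B.init s = B.source i := (B.mem_outs _ _).1 (by simp [hs])
    refine ⟨s, hs', ?_⟩
    unfold glueRight
    rw [dif_pos (by rw [hs']; exact h)]
    congr 2
    rw [Equiv.symm_apply_eq]
    exact Subtype.ext hs'
  · exact .inr ⟨h, by unfold seamTerm; rw [dif_neg h]⟩

theorem mem_glueIns (p : GluePoint A B) (s : GlueStrand A B) :
    s ∈ glueIns A B p ↔ glueTerm A B s = p := by
  rcases p with ⟨p, hp⟩ | ⟨q, hq⟩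
  · simp only [glueIns, List.mem_map, A.mem_ins]
    constructor
    · rintro ⟨t, rfl, rfl⟩
      rw [glueLeft_of_not hp]
      rfl
    · intro h
      rcases s with ⟨s, hs⟩ | s | i
      · have : A.term s = p := by simpa [glueTerm] using h
        exact ⟨s, this, glueLeft_of_not hs⟩
      · simp [glueTerm] at h
      · simp [glueTerm] at h
  · by_cases h : B.IsSource q
    · simp only [glueIns, h, dite_true, List.mem_singleton]
      constructor
      · rintro rfl
        refine congrArg Sum.inr (Subtype.ext ?_)
        unfold seamTerm
        rw [dif_neg (by simpa using hq)]
        simp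
      · intro hs
        have hno : ∀ t : B.Strand, B.term t ≠ q := fun t ht => by
          have := (B.mem_ins _ _).2 ht
          rw [h] at this
          simp at this
        rcases s with s | s | i
        · simp [glueTerm] at hs
        · exact absurd (by simpa [glueTerm] using hs) (hno s)
        · have hi : (B.seamTerm i : B.Point) = q := by
            simpa [glueTerm, Subtype.ext_iff] using hs
          rcases seam_right (A := A) i with ⟨t, -, ht⟩ | ⟨-, ht⟩
          · have := glueTerm_glueRight (A := A) t
            rw [ht] at this
            exact absurd (by simpa [glueTerm, Subtype.ext_iff, hi] using this.symm) (hno t)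
          · congr 2
            rw [Equiv.eq_symm_apply]
            exact Subtype.ext (ht.symm.trans hi)
    · simp only [glueIns, h, dite_false, List.mem_map, B.mem_ins]
      constructor
      · rintro ⟨t, rfl, rfl⟩
        exact glueTerm_glueRight t
      · intro hs
        rcases s with s | ⟨s, hs'⟩ | i
        · simp [glueTerm] at hs
        · exact ⟨s, by simpa [glueTerm] using hs, glueRight_of_not hs'⟩
        · have hi : (B.seamTerm i : B.Point) = q := by
            simpa [glueTerm, Subtype.ext_iff] using hs
          rcases seam_right (A := A) i with ⟨t, -, ht⟩ | ⟨-, ht⟩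
          · refine ⟨t, ?_, ht⟩
            have := glueTerm_glueRight (A := A) t
            rw [ht, hs] at this
            simpa [Subtype.ext_iff] using this.symm
          · exact absurd (by rw [← hi, ht]; exact (B.source i).2) h

theorem mem_glueOuts (p : GluePoint A B) (s : GlueStrand A B) :
    s ∈ glueOuts A B p ↔ glueInit A B s = p := by
  rcases p with ⟨p, hp⟩ | ⟨q, hq⟩
  · by_cases h : A.IsSink p
    · simp only [glueOuts, h, dite_true, List.mem_singleton]
      constructor
      · rintro rfl
        refine congrArg Sum.inl (Subtype.ext ?_)
        unfold seamInit
        rw [dif_neg (by simpa using hp)]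
        simp
      · intro hs
        have hno : ∀ t : A.Strand, A.init t ≠ p := fun t ht => by
          have := (A.mem_outs _ _).2 ht
          rw [h] at this
          simp at this
        rcases s with s | s | i
        · exact absurd (by simpa [glueInit] using hs) (hno s)
        · simp [glueInit] at hs
        · have hi : (A.seamInit i : A.Point) = p := by
            simpa [glueInit, Subtype.ext_iff] using hs
          rcases seam_left (B := B) i with ⟨t, -, ht⟩ | ⟨-, ht⟩
          · have := glueInit_glueLeft (B := B) t
            rw [ht] at this
            exact absurd (by simpa [glueInit, Subtype.ext_iff, hi] using this.symm) (hno t)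
          · congr 2
            rw [Equiv.eq_symm_apply]
            exact Subtype.ext (ht.symm.trans hi)
    · simp only [glueOuts, h, dite_false, List.mem_map, A.mem_outs]
      constructor
      · rintro ⟨t, rfl, rfl⟩
        exact glueInit_glueLeft t
      · intro hs
        rcases s with ⟨s, hs'⟩ | s | i
        · exact ⟨s, by simpa [glueInit] using hs, glueLeft_of_not hs'⟩
        · simp [glueInit] at hs
        · have hi : (A.seamInit i : A.Point) = p := by
            simpa [glueInit, Subtype.ext_iff] using hs
          rcases seam_left (B := B) i with ⟨t, -, ht⟩ | ⟨-, ht⟩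
          · refine ⟨t, ?_, ht⟩
            have := glueInit_glueLeft (B := B) t
            rw [ht, hs] at this
            simpa [Subtype.ext_iff] using this.symm
          · exact absurd (by rw [← hi, ht]; exact (A.sink i).2) h
  · simp only [glueOuts, List.mem_map, B.mem_outs]
    constructor
    · rintro ⟨t, rfl, rfl⟩
      rw [glueRight_of_not hq]
      rfl
    · intro h
      rcases s with s | ⟨s, hs⟩ | i
      · simp [glueInit] at h
      · have : B.init s = q := by simpa [glueInit] using h
        exact ⟨s, this, glueRight_of_not hs⟩
      · simp [glueInit] at h

theorem glue_acyclic (p : GluePoint A B) : ¬ Relation.TransGen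
    (fun a b => ∃ s, glueInit A B s = a ∧ glueTerm A B s = b) p p := by
  have key : ∀ a b, Relation.TransGen
      (fun a b => ∃ s, glueInit A B s = a ∧ glueTerm A B s = b) a b →
      (∀ p p', a = .inl p → b = .inl p' →
        Relation.TransGen (fun a b => ∃ s, A.init s = a ∧ A.term s = b) p.1 p'.1) ∧
      (∀ q, a = .inr q → ∃ q', b = .inr q' ∧
        Relation.TransGen (fun a b => ∃ s, B.init s = a ∧ B.term s = b) q.1 q'.1) := by
    intro a b hab
    induction hab with
    | single h =>
      obtain ⟨s, rfl, rfl⟩ := h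
      rcases s with s | s | i
      · refine ⟨fun p p' hp hp' => .single ⟨s, ?_, ?_⟩, fun q hq => by simp [glueInit] at hq⟩
        · simpa [glueInit, Subtype.ext_iff] using hp
        · simpa [glueTerm, Subtype.ext_iff] using hp'
      · refine ⟨fun p p' hp => by simp [glueInit] at hp,
          fun q hq => ⟨_, rfl, .single ⟨s, ?_, rfl⟩⟩⟩
        simpa [glueInit, Subtype.ext_iff] using hq
      · exact ⟨fun p p' _ hp' => by simp [glueTerm] at hp', fun q hq => by simp [glueInit] at hq⟩
    | tail _ h ih =>
      obtain ⟨s, rfl, rfl⟩ := h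
      rcases s with s | s | i
      · refine ⟨fun p p' hp hp' => ?_, fun q hq => ?_⟩
        · refine (ih.1 p _ hp rfl).tail ⟨s, rfl, ?_⟩
          simpa [glueTerm, Subtype.ext_iff] using hp'
        · obtain ⟨q', hq', -⟩ := ih.2 q hq
          simp [glueInit] at hq'
      · refine ⟨fun p p' hp hp' => by simp [glueTerm] at hp', fun q hq => ?_⟩
        obtain ⟨q', hq', h⟩ := ih.2 q hq
        refine ⟨_, rfl, h.tail ⟨s, ?_, rfl⟩⟩
        simpa [glueInit, Subtype.ext_iff] using hq'
      · refine ⟨fun p p' hp hp' => by simp [glueTerm] at hp', fun q hq => ?_⟩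
        obtain ⟨q', hq', -⟩ := ih.2 q hq
        simp [glueInit] at hq'
  intro h
  rcases p with p | q
  · exact A.acyclic _ ((key _ _ h).1 p p rfl rfl)
  · obtain ⟨q', hq', h'⟩ := (key _ _ h).2 q rfl
    obtain rfl := Sum.inr.inj hq'
    exact B.acyclic _ h'

variable (A B)

/-- The graph underlying `AB`. -/
noncomputable def glueGraph : StrandGraph V where
  Point := GluePoint A B
  Strand := GlueStrand A B
  finite_point := by
    have := A.finite_point
    have := B.finite_point
    infer_instance
  finite_strand := by
    have := A.finite_strand
    have := B.finite_strand
    infer_instance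
  init := glueInit A B
  term := glueTerm A B
  pointCol := gluePointCol A B
  strandCol := glueStrandCol A B
  ins := glueIns A B
  outs := glueOuts A B
  ins_nodup p := by
    rcases p with p | q
    · exact (A.ins_nodup _).map glueLeft_injective
    · by_cases h : B.IsSource q
      · simp [glueIns, h]
      · simpa only [glueIns, h, dite_false] using (B.ins_nodup _).map glueRight_injective
  outs_nodup p := by
    rcases p with p | q
    · by_cases h : A.IsSink p
      · simp [glueOuts, h]
      · simpa only [glueOuts, h, dite_false] using (A.outs_nodup _).map glueLeft_injective
    · exact (B.outs_nodup _).map glueRight_injective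
  mem_ins := mem_glueIns
  mem_outs := mem_glueOuts
  acyclic := glue_acyclic

variable {A B}

theorem glueStrandCol_glueLeft (s : A.Strand) :
    glueStrandCol A B (glueLeft s) = A.strandCol s := by
  unfold glueLeft
  split_ifs with h
  · have := A.sink_col (A.sink.symm ⟨_, h.1⟩)
    rw [Equiv.apply_symm_apply] at this
    exact this.symm.trans (A.univalentSink_col _ h s ((A.mem_ins _ _).2 rfl)).symm
  · rfl

theorem glueStrandCol_glueRight (s : B.Strand) :
    glueStrandCol A B (glueRight s) = B.strandCol s := by
  unfold glueRight
  split_ifs with h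
  · have := B.source_col (B.source.symm ⟨_, h.1⟩)
    rw [Equiv.apply_symm_apply] at this
    exact this.symm.trans (B.univalentSource_col _ h s ((B.mem_outs _ _).2 rfl)).symm
  · rfl

theorem not_isUnivalentSink_of_isSource {p : A.Point} (h : A.IsSource p) :
    ¬ A.IsUnivalentSink p := fun h' => absurd h'.2 (by rw [h]; simp)

theorem not_isUnivalentSource_of_isSink {q : B.Point} (h : B.IsSink q) :
    ¬ B.IsUnivalentSource q := fun h' => absurd h'.2 (by rw [h]; simp)

/-- A point is not both a source and a sink. -/
theorem not_isSource_and_isSink (p : A.Point) (h : A.IsSource p) (h' : A.IsSink p) : False := by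
  have h1 : (A.ins p).length = 0 := by rw [h]; rfl
  have h2 : (A.outs p).length = 0 := by rw [h']; rfl
  rcases A.kind p with k | k | k | k | k <;> have := k.1 <;> have := k.2 <;> omega

theorem isMerge_of_isSink {p : A.Point} (h : A.IsSink p) (h' : ¬ A.IsUnivalentSink p) :
    A.IsMerge p := by
  have h2 : (A.outs p).length = 0 := by rw [h]; rfl
  rcases A.kind p with k | k | k | k | k
  · have := k.2; omega
  · exact absurd k h'
  · have := k.2; omega
  · exact k
  · have := k.2; omega

theorem isSplit_of_isSource {p : B.Point} (h : B.IsSource p) (h' : ¬ B.IsUnivalentSource p) :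
    B.IsSplit p := by
  have h2 : (B.ins p).length = 0 := by rw [h]; rfl
  rcases B.kind p with k | k | k | k | k
  · exact absurd k h'
  · have := k.2; omega
  · exact k
  · have := k.2; omega
  · have := k.1; omega

variable (A B)

theorem glueIns_inr_ne_nil (q : {q : B.Point // ¬ B.IsUnivalentSource q}) :
    glueIns A B (.inr q) ≠ [] := by
  intro h
  by_cases hq : B.IsSource q
  · simp only [glueIns, hq, dite_true] at h
    exact absurd h (List.cons_ne_nil _ _)
  · simp only [glueIns, hq, dite_false] at h
    exact hq (List.map_eq_nil_iff.1 h)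

theorem glueOuts_inl_ne_nil (p : {p : A.Point // ¬ A.IsUnivalentSink p}) :
    glueOuts A B (.inl p) ≠ [] := by
  intro h
  by_cases hp : A.IsSink p
  · simp only [glueOuts, hp, dite_true] at h
    exact absurd h (List.cons_ne_nil _ _)
  · simp only [glueOuts, hp, dite_false] at h
    exact hp (List.map_eq_nil_iff.1 h)

/-- The sources of `AB` are those of `A`. -/
noncomputable def glueSource : Fin x.length ≃ {p // (glueGraph A B).IsSource p} :=
  A.source.trans (Equiv.ofBijective
    (fun p => ⟨.inl ⟨p.1, not_isUnivalentSink_of_isSource p.2⟩, List.map_eq_nil_iff.2 p.2⟩) (by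
    constructor
    · intro p p' h
      have h' : (Sum.inl _ : GluePoint A B) = Sum.inl _ := congrArg Subtype.val h
      exact Subtype.ext (Subtype.mk.inj (Sum.inl.inj h'))
    · rintro ⟨p | q, h⟩
      · exact ⟨⟨p.1, List.map_eq_nil_iff.1 h⟩, rfl⟩
      · exact absurd h (glueIns_inr_ne_nil A B q)))

/-- The sinks of `AB` are those of `B`. -/
noncomputable def glueSink : Fin z.length ≃ {p // (glueGraph A B).IsSink p} :=
  B.sink.trans (Equiv.ofBijective
    (fun p => ⟨.inr ⟨p.1, not_isUnivalentSource_of_isSink p.2⟩, List.map_eq_nil_iff.2 p.2⟩) (by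
    constructor
    · intro p p' h
      have h' : (Sum.inr _ : GluePoint A B) = Sum.inr _ := congrArg Subtype.val h
      exact Subtype.ext (Subtype.mk.inj (Sum.inr.inj h'))
    · rintro ⟨p | q, h⟩
      · exact absurd h (glueOuts_inl_ne_nil A B p)
      · exact ⟨⟨q.1, List.map_eq_nil_iff.1 h⟩, rfl⟩))

variable {A B}

/-- The coloring and valence conditions at one point of a strand diagram. -/
def LocalCondition (o : EdgeOrder Γ) (G : StrandGraph V) (p : G.Point) : Prop :=
  (G.IsUnivalentSource p ∧ ∀ s ∈ G.outs p, G.strandCol s = G.pointCol p) ∨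
  (G.IsUnivalentSink p ∧ ∀ s ∈ G.ins p, G.strandCol s = G.pointCol p) ∨
  (G.IsSplit p ∧ (G.outs p).map G.strandCol = (o.out (G.pointCol p)).map Γ.term ∧
    ∀ s ∈ G.ins p, G.strandCol s = G.pointCol p) ∨
  (G.IsMerge p ∧ (G.ins p).map G.strandCol = (o.out (G.pointCol p)).map Γ.term ∧
    ∀ s ∈ G.outs p, G.strandCol s = G.pointCol p) ∨
  (G.IsDegenerate p ∧ (∀ s ∈ G.ins p, G.strandCol s = G.pointCol p) ∧
    (∀ s ∈ G.outs p, G.strandCol s = G.pointCol p) ∧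
    ∃ e, o.out (G.pointCol p) = [e] ∧ Γ.term e = G.pointCol p)

theorem localCondition (A : StrandDiagram o x y) (p : A.Point) :
    LocalCondition o A.toStrandGraph p := by
  rcases A.kind p with k | k | k | k | k
  · exact .inl ⟨k, A.univalentSource_col p k⟩
  · exact .inr (.inl ⟨k, A.univalentSink_col p k⟩)
  · exact .inr (.inr (.inl ⟨k, A.split_col p k⟩))
  · exact .inr (.inr (.inr (.inl ⟨k, A.merge_col p k⟩)))
  · exact .inr (.inr (.inr (.inr ⟨k, A.degenerate_col p k⟩)))

/-- The five kinds of points are mutually exclusive. -/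
theorem LocalCondition.col {G : StrandGraph V} {p : G.Point} (h : LocalCondition o G p) :
    (G.IsUnivalentSource p → ∀ s ∈ G.outs p, G.strandCol s = G.pointCol p) ∧
    (G.IsUnivalentSink p → ∀ s ∈ G.ins p, G.strandCol s = G.pointCol p) ∧
    (G.IsSplit p → (G.outs p).map G.strandCol = (o.out (G.pointCol p)).map Γ.term ∧
      ∀ s ∈ G.ins p, G.strandCol s = G.pointCol p) ∧
    (G.IsMerge p → (G.ins p).map G.strandCol = (o.out (G.pointCol p)).map Γ.term ∧
      ∀ s ∈ G.outs p, G.strandCol s = G.pointCol p) ∧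
    (G.IsDegenerate p → (∀ s ∈ G.ins p, G.strandCol s = G.pointCol p) ∧
      (∀ s ∈ G.outs p, G.strandCol s = G.pointCol p) ∧
      ∃ e, o.out (G.pointCol p) = [e] ∧ Γ.term e = G.pointCol p) := by
  simp only [LocalCondition, StrandGraph.IsUnivalentSource, StrandGraph.IsUnivalentSink,
    StrandGraph.IsSplit, StrandGraph.IsMerge, StrandGraph.IsDegenerate, StrandGraph.IsSource,
    StrandGraph.IsSink, ← List.length_eq_zero_iff] at h ⊢
  rcases h with ⟨k, h⟩ | ⟨k, h⟩ | ⟨k, h⟩ | ⟨k, h⟩ | ⟨k, h⟩ <;>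
  refine ⟨fun k' => ?_, fun k' => ?_, fun k' => ?_, fun k' => ?_, fun k' => ?_⟩ <;>
  first
  | exact h
  | (exfalso; omega)

/-- Local conditions are transferred along color-preserving bijections of strands. -/
theorem LocalCondition.transfer {G H : StrandGraph V} {p : G.Point} {q : H.Point}
    (h : LocalCondition o G p) (f : G.Strand → H.Strand) (hp : H.pointCol q = G.pointCol p)
    (hf : ∀ s, H.strandCol (f s) = G.strandCol s) (hins : H.ins q = (G.ins p).map f)
    (houts : H.outs q = (G.outs p).map f) : LocalCondition o H q := by
  have hf' : H.strandCol ∘ f = G.strandCol := funext hf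
  simpa [LocalCondition, StrandGraph.IsUnivalentSource, StrandGraph.IsUnivalentSink,
    StrandGraph.IsSplit, StrandGraph.IsMerge, StrandGraph.IsDegenerate, StrandGraph.IsSource,
    StrandGraph.IsSink, hins, houts, hp, hf, hf'] using h

theorem LocalCondition.of_merge {G H : StrandGraph V} {p : G.Point} {q : H.Point}
    (h : G.IsMerge p) (hc : (G.ins p).map G.strandCol = (o.out (G.pointCol p)).map Γ.term)
    (f : G.Strand → H.Strand) (hp : H.pointCol q = G.pointCol p)
    (hf : ∀ s, H.strandCol (f s) = G.strandCol s) (hins : H.ins q = (G.ins p).map f)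
    {t : H.Strand} (houts : H.outs q = [t]) (ht : H.strandCol t = G.pointCol p) :
    LocalCondition o H q := by
  have hf' : H.strandCol ∘ f = G.strandCol := funext hf
  refine .inr (.inr (.inr (.inl ⟨⟨?_, ?_⟩, ?_, ?_⟩)))
  · simp [houts]
  · simpa [hins] using h.2
  · simpa [hins, hp, hf'] using hc
  · simpa [houts, hp] using ht

theorem LocalCondition.of_split {G H : StrandGraph V} {p : G.Point} {q : H.Point}
    (h : G.IsSplit p) (hc : (G.outs p).map G.strandCol = (o.out (G.pointCol p)).map Γ.term)
    (f : G.Strand → H.Strand) (hp : H.pointCol q = G.pointCol p)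
    (hf : ∀ s, H.strandCol (f s) = G.strandCol s) (houts : H.outs q = (G.outs p).map f)
    {t : H.Strand} (hins : H.ins q = [t]) (ht : H.strandCol t = G.pointCol p) :
    LocalCondition o H q := by
  have hf' : H.strandCol ∘ f = G.strandCol := funext hf
  refine .inr (.inr (.inl ⟨⟨?_, ?_⟩, ?_, ?_⟩))
  · simp [hins]
  · simpa [houts] using h.2
  · simpa [houts, hp, hf'] using hc
  · simpa [hins, hp] using ht

theorem glue_localCondition (p : (glueGraph A B).Point) : LocalCondition o (glueGraph A B) p := by
  rcases p with ⟨p, hp⟩ | ⟨q, hq⟩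
  · by_cases h : A.IsSink p
    · have hm := isMerge_of_isSink h hp
      have hs := A.sink_col (A.sink.symm ⟨p, h⟩)
      rw [Equiv.apply_symm_apply] at hs
      exact LocalCondition.of_merge hm (A.merge_col p hm).1 glueLeft rfl glueStrandCol_glueLeft rfl
        (t := .inr (.inr (A.sink.symm ⟨p, h⟩))) (dif_pos h) hs.symm
    · exact (A.localCondition p).transfer glueLeft rfl glueStrandCol_glueLeft rfl (dif_neg h)
  · by_cases h : B.IsSource q
    · have hm := isSplit_of_isSource h hq
      have hs := B.source_col (B.source.symm ⟨q, h⟩)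
      rw [Equiv.apply_symm_apply] at hs
      exact LocalCondition.of_split hm (B.split_col q hm).1 glueRight rfl glueStrandCol_glueRight
        rfl (t := .inr (.inr (B.source.symm ⟨q, h⟩))) (dif_pos h) hs.symm
    · exact (B.localCondition q).transfer glueRight rfl glueStrandCol_glueRight (dif_neg h) rfl

variable (A B)

/-- The composition `AB` of strand diagrams. -/
noncomputable def glue : StrandDiagram o x z where
  toStrandGraph := glueGraph A B
  source := glueSource A B
  sink := glueSink A B
  source_col := A.source_col
  sink_col := B.sink_col
  kind p := by
    rcases glue_localCondition p with k | k | k | k | k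
    exacts [.inl k.1, .inr (.inl k.1), .inr (.inr (.inl k.1)), .inr (.inr (.inr (.inl k.1))),
      .inr (.inr (.inr (.inr k.1)))]
  univalentSource_col p := (glue_localCondition p).col.1
  univalentSink_col p := (glue_localCondition p).col.2.1
  split_col p := (glue_localCondition p).col.2.2.1
  merge_col p := (glue_localCondition p).col.2.2.2.1
  degenerate_col p := (glue_localCondition p).col.2.2.2.2

end Glue

end StrandDiagram

/-! ### The groupoid of classes of strand diagrams -/

variable {Γ : DirectedGraph V E}

/-- The equivalence classes of `Γ`-strand diagrams with domain `x` and range `y`. -/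
def StrandClass (o : EdgeOrder Γ) (x y : Tuple V) : Type (max u 1) :=
  Quotient (StrandDiagram.setoid o x y)

/-- The class `[A]` of a strand diagram. -/
def StrandDiagram.toClass {o : EdgeOrder Γ} {x y : Tuple V} (A : StrandDiagram o x y) :
    StrandClass o x y := Quotient.mk _ A

/-- The groupoid structure on the set of all classes of `Γ`-strand diagrams, in which
`[A][B] = [AB]`. There is at most one such structure, see the instance below; that it exists
means that this composition of classes is well defined, is associative, and has identities and
inverses. -/
@[ext]
structure StrandGroupoid (o : EdgeOrder Γ) where
  id : ∀ x, StrandClass o x x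
  comp : ∀ {x y z}, StrandClass o x y → StrandClass o y z → StrandClass o x z
  inv : ∀ {x y}, StrandClass o x y → StrandClass o y x
  comp_toClass : ∀ {x y z} (A : StrandDiagram o x y) (B : StrandDiagram o y z),
    comp A.toClass B.toClass = (A.glue B).toClass
  id_comp : ∀ {x y} (a : StrandClass o x y), comp (id x) a = a
  comp_id : ∀ {x y} (a : StrandClass o x y), comp a (id y) = a
  assoc : ∀ {w x y z} (a : StrandClass o w x) (b : StrandClass o x y) (c : StrandClass o y z),
    comp (comp a b) c = comp a (comp b c)
  inv_comp : ∀ {x y} (a : StrandClass o x y), comp (inv a) a = id y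
  comp_inv : ∀ {x y} (a : StrandClass o x y), comp a (inv a) = id x

namespace StrandGroupoid

variable {o : EdgeOrder Γ}

instance : Subsingleton (StrandGroupoid o) where
  allEq 𝒢 ℋ := by
    have hc : ∀ {x y z} (a : StrandClass o x y) (b : StrandClass o y z),
        𝒢.comp a b = ℋ.comp a b := by
      intro x y z a b
      induction a using Quotient.ind with | _ A
      induction b using Quotient.ind with | _ B
      exact (𝒢.comp_toClass A B).trans (ℋ.comp_toClass A B).symm
    have hi : ∀ x, 𝒢.id x = ℋ.id x := fun x => by
      rw [← ℋ.id_comp (𝒢.id x), ← hc, 𝒢.comp_id]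
    have hv : ∀ {x y} (a : StrandClass o x y), 𝒢.inv a = ℋ.inv a := fun {x y} a => by
      rw [← 𝒢.comp_id (𝒢.inv a), hi, ← ℋ.comp_inv a, ← hc, ← 𝒢.assoc, 𝒢.inv_comp, 𝒢.id_comp]
    ext
    · exact hi _
    · exact hc _ _
    · exact hv _

/-- The objects of the groupoid: the finite tuples of vertices. -/
@[ext]
structure Obj (𝒢 : StrandGroupoid o) where
  tuple : Tuple V

/-- A tuple, as an object of the groupoid. -/
def obj (𝒢 : StrandGroupoid o) (x : Tuple V) : 𝒢.Obj := ⟨x⟩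

instance (𝒢 : StrandGroupoid o) : CategoryTheory.Groupoid 𝒢.Obj where
  Hom x y := StrandClass o x.tuple y.tuple
  id x := 𝒢.id x.tuple
  comp := 𝒢.comp
  id_comp := 𝒢.id_comp
  comp_id := 𝒢.comp_id
  assoc := 𝒢.assoc
  inv := 𝒢.inv
  inv_comp := 𝒢.inv_comp
  comp_inv := 𝒢.comp_inv

end StrandGroupoid

end EdgeShift

namespace EdgeShift

universe u v

variable {V : Type u} {E : Type v} {Γ : DirectedGraph V E}

/-! A strand diagram from `x` to `y` is a machine acting on infinite paths. A ray that enters at a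
source carries its letters downwards: a split reads the first letter and sends the rest along the
corresponding strand, a merge writes the letter of the strand by which the ray arrives, and a point
with one strand on each side changes nothing. Since the graph is finite and acyclic, every ray
leaves at a sink. This gives a bijection `sem` from the rays at `x` to the rays at `y`, whose
inverse is the action of the diagram turned upside down.

The whole theorem comes from four properties of `sem`.

Invariance (`sem_eq_of_equiv`): a reduction only deletes degenerate points or a letter that is read
and written back at once (type 1) or written and read at once (type 2). Functoriality (`sem_glue`):
gluing corresponds to composition.

Image (`exists_hasDepth`, `exists_sem_eq`): the bijections that occur are exactly those that replace
prefixes as soon as a bounded number of letters is known. A diagram has this property because it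
reads boundedly many letters. Conversely, splitting the vertices of the domain lowers the depth of a
bijection, splitting the vertices of the range shortens the prefixes that are written, and what
remains in the end is a permutation.

Faithfulness (`equiv_of_sem_eq`): every diagram is equivalent to one with univalent sources and
sinks to which no reduction applies. In such a reduced diagram no merge is followed by a split, so
every strand is reached from a source through splits only, or from a sink through merges only, and
the letters met on the way form its address. The crucial point is `Reduced.not_canonicalAt`: a
strand that ends at a split marks a cylinder on which `sem` does not act by a single prefix
replacement, since otherwise all strands leaving this split would enter one merge in the same order,
and a type 1 reduction would apply. Therefore `sem` determines which addresses occur and how they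
are joined, and two reduced diagrams with the same action are isomorphic.

Because of faithfulness, the groupoid laws, and even the fact that composition of classes is well
defined, are identities between bijections. Finally, when `y` lists the elements of `Y`, the rays
are the points of the edge shift, and bijections of finite depth are the same as piecewise-canonical
homeomorphisms, which identifies the vertex group with `G(Γ|Y)`.

A vertex of out-degree one needs care: its only edge is a loop `e`, so there is a single ray `eee…`,
and a prefix replacement can be written in several ways. The absence of redundant edges keeps this
degeneracy harmless. -/

/-! ### Rays -/

/-- `α` is an infinite path of `Γ` that starts at the vertex `a`. -/
def DirectedGraph.IsRay (Γ : DirectedGraph V E) (a : V) (α : Stream' E) : Prop :=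
  Γ.init (α.get 0) = a ∧ ∀ n, Γ.term (α.get n) = Γ.init (α.get (n + 1))

theorem isRay_cons {a : V} {e : E} {α : Stream' E} :
    Γ.IsRay a (Stream'.cons e α) ↔ Γ.init e = a ∧ Γ.IsRay (Γ.term e) α := by
  constructor
  · rintro ⟨h, h'⟩
    exact ⟨h, (h' 0).symm, fun n => h' (n + 1)⟩
  · rintro ⟨h, h0, h'⟩
    refine ⟨h, fun n => ?_⟩
    cases n with
    | zero => exact h0.symm
    | succ n => exact h' n

theorem DirectedGraph.IsRay.exists_cons {a : V} {α : Stream' E} (h : Γ.IsRay a α) :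
    ∃ e β, α = Stream'.cons e β ∧ Γ.init e = a ∧ Γ.IsRay (Γ.term e) β := by
  have h' := h
  rw [← Stream'.eta α, isRay_cons] at h'
  exact ⟨_, _, (Stream'.eta α).symm, h'⟩

theorem DirectedGraph.NoDeadEnds.exists_isRay (hΓ : Γ.NoDeadEnds) (a : V) :
    ∃ α, Γ.IsRay a α := by
  choose f hf using hΓ
  refine ⟨fun n => (fun e => f (Γ.term e))^[n] (f a), hf a, fun n => ?_⟩
  have h := hf (Γ.term ((fun e => f (Γ.term e))^[n] (f a)))
  exact h.symm.trans (congrArg Γ.init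
    (Function.iterate_succ_apply' (fun e => f (Γ.term e)) n (f a)).symm)

/-- If the only edge originating from `a` is a loop, then there is only one ray at `a`. -/
theorem DirectedGraph.IsRay.eq_of_loop {a : V} {e : E} (he : ∀ e', Γ.init e' = a → e' = e)
    {α β : Stream' E} (hα : Γ.IsRay a α) (hβ : Γ.IsRay a β) (hl : Γ.term e = a) : α = β := by
  have key : ∀ {α : Stream' E}, Γ.IsRay a α → ∀ n, α.get n = e := by
    intro α hα n
    induction n with
    | zero => exact he _ hα.1
    | succ n ih => exact he _ (by rw [← hα.2 n, ih, hl])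
  exact Stream'.ext fun n => (key hα n).trans (key hβ n).symm

/-- The points of the edge shift starting from a tuple of vertices. -/
def Ray (Γ : DirectedGraph V E) (x : Tuple V) : Type v :=
  {a : Fin x.length × Stream' E // Γ.IsRay (x.get a.1) a.2}

/-! ### Reversed words -/

/-- The stream obtained by putting the reverse of the word `w` in front of `γ`. -/
def revAppend : List E → Stream' E → Stream' E
  | [], γ => γ
  | e :: w, γ => revAppend w (Stream'.cons e γ)

theorem revAppend_eq (w : List E) (γ : Stream' E) : revAppend w γ = w.reverse ++ₛ γ := by
  induction w generalizing γ with
  | nil => rfl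
  | cons e w ih =>
    rw [revAppend, ih, List.reverse_cons, Stream'.append_append_stream]
    rfl

/-- Words are kept with the last letter first, so that prolonging a path at its far end is `::` or
`++` on the left. This is the operation by which cylinders are refined and addresses grow; the
prefix of the path is the right-hand part of the list. -/
theorem revAppend_append (w w' : List E) (γ : Stream' E) :
    revAppend (w' ++ w) γ = revAppend w (revAppend w' γ) := by
  simp [revAppend_eq]

/-- The reverse of `w` is a path from `a` to `b`. -/
def DirectedGraph.IsRevPath (Γ : DirectedGraph V E) (a : V) : List E → V → Prop
  | [], b => b = a
  | e :: w, b => Γ.IsRevPath a w (Γ.init e) ∧ Γ.term e = b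

theorem isRay_revAppend {a b : V} {w : List E} (hw : Γ.IsRevPath a w b) {γ : Stream' E} :
    Γ.IsRay a (revAppend w γ) ↔ Γ.IsRay b γ := by
  induction w generalizing b γ with
  | nil => obtain rfl := hw; rfl
  | cons e w ih =>
    rw [revAppend, ih hw.1, isRay_cons, hw.2]
    simp

theorem DirectedGraph.IsRevPath.eq_end {a b c : V} {w : List E} (h : Γ.IsRevPath a w b)
    (h' : Γ.IsRevPath a w c) : b = c := by
  cases w with
  | nil => exact h.trans h'.symm
  | cons e w => exact h.2.symm.trans h'.2

theorem DirectedGraph.IsRevPath.append {a b c : V} {w w' : List E} (h : Γ.IsRevPath a w b)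
    (h' : Γ.IsRevPath b w' c) : Γ.IsRevPath a (w' ++ w) c := by
  induction w' generalizing c with
  | nil => obtain rfl := h'; exact h
  | cons e w' ih => exact ⟨ih h'.1, h'.2⟩

/-! ### Branching -/

/-- A ray `α` at a vertex `a` leaves along the strand `s` with the remainder `β`: the list `l`
consists either of `s` only, or of strands that correspond to the edges originating from `a`. -/
def Branch {S : Type*} (o : EdgeOrder Γ) (l : List S) (a : V) (α : Stream' E) (s : S)
    (β : Stream' E) : Prop :=
  (l = [s] ∧ α = β) ∨ (2 ≤ l.length ∧ ∃ e, (s, e) ∈ l.zip (o.out a) ∧ α = Stream'.cons e β)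

/-- The list of strands `l` may occur on one side of a point of color `a`. -/
structure Fits {S : Type*} (o : EdgeOrder Γ) (l : List S) (a : V) (col : S → V) : Prop where
  nodup : l.Nodup
  cases : l = [] ∨ (∃ s, l = [s] ∧ col s = a) ∨
    (2 ≤ l.length ∧ l.map col = (o.out a).map Γ.term)

section Branch

variable {S T : Type*} {o : EdgeOrder Γ} {l : List S} {a : V} {col : S → V}
  {α α' β β' : Stream' E} {s s' : S}

theorem Branch.mem (h : Branch o l a α s β) : s ∈ l := by
  rcases h with ⟨rfl, -⟩ | ⟨-, e, h, -⟩
  · simp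
  · exact (List.of_mem_zip h).1

theorem mem_zip_fst_unique {A B : Type*} {l : List A} {m : List B} (h : m.Nodup) {s s' : A} {e : B}
    (hs : (s, e) ∈ l.zip m) (hs' : (s', e) ∈ l.zip m) : s = s' := by
  obtain ⟨i, hi, hi'⟩ := List.getElem_of_mem hs
  obtain ⟨j, hj, hj'⟩ := List.getElem_of_mem hs'
  simp only [List.getElem_zip, Prod.mk.injEq] at hi' hj'
  have := (h.getElem_inj_iff).1 (hi'.2.trans hj'.2.symm)
  subst this
  exact hi'.1.symm.trans hj'.1

theorem mem_zip_snd_unique {A B : Type*} {l : List A} {m : List B} (h : l.Nodup) {s : A} {e e' : B}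
    (hs : (s, e) ∈ l.zip m) (hs' : (s, e') ∈ l.zip m) : e = e' := by
  obtain ⟨i, hi, hi'⟩ := List.getElem_of_mem hs
  obtain ⟨j, hj, hj'⟩ := List.getElem_of_mem hs'
  simp only [List.getElem_zip, Prod.mk.injEq] at hi' hj'
  have := (h.getElem_inj_iff).1 (hi'.1.trans hj'.1.symm)
  subst this
  exact hi'.2.symm.trans hj'.2

theorem exists_mem_zip_left {A B : Type*} {l : List A} {m : List B} (h : l.length = m.length)
    {s : A} (hs : s ∈ l) : ∃ e, (s, e) ∈ l.zip m := by
  obtain ⟨i, hi, rfl⟩ := List.getElem_of_mem hs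
  exact ⟨m[i], List.mem_iff_getElem.2 ⟨i, by simp; omega, by simp⟩⟩

theorem exists_mem_zip_right {A B : Type*} {l : List A} {m : List B} (h : l.length = m.length)
    {e : B} (he : e ∈ m) : ∃ s, (s, e) ∈ l.zip m := by
  obtain ⟨i, hi, rfl⟩ := List.getElem_of_mem he
  exact ⟨l[i], List.mem_iff_getElem.2 ⟨i, by simp; omega, by simp⟩⟩

theorem eq_of_mem_zip {A B C : Type*} {l : List A} {m : List B} {f : A → C} {g : B → C}
    (h : l.map f = m.map g) {s : A} {e : B} (hs : (s, e) ∈ l.zip m) : f s = g e := by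
  obtain ⟨i, hi, hi'⟩ := List.getElem_of_mem hs
  simp only [List.getElem_zip, Prod.mk.injEq] at hi'
  simp only [List.length_zip, lt_inf_iff] at hi
  have : (l.map f)[i]'(by simpa using hi.1) = (m.map g)[i]'(by simpa using hi.2) := by simp [h]
  simpa [hi'.1, hi'.2] using this

theorem mem_zip_swap {A B : Type*} {l : List A} {m : List B} {s : A} {e : B}
    (h : (s, e) ∈ l.zip m) : (e, s) ∈ m.zip l := by
  rw [← List.zip_swap]
  exact List.mem_map.2 ⟨_, h, rfl⟩

theorem mem_zip_comm {A B : Type*} {l : List A} {m : List B} {s : A} {e : B} :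
    (s, e) ∈ l.zip m ↔ (e, s) ∈ m.zip l :=
  ⟨mem_zip_swap, mem_zip_swap⟩

/-- Determinism of splits: the first letter occurs once in the ordered list of edges, so it selects
one strand. -/
theorem Branch.unique (h : Branch o l a α s β) (h' : Branch o l a α s' β') : s = s' ∧ β = β' := by
  rcases h with ⟨rfl, rfl⟩ | ⟨h1, e, he, rfl⟩ <;> rcases h' with ⟨h2, rfl⟩ | ⟨h2, e', he', h⟩
  · exact ⟨by simpa using h2, rfl⟩
  · simp at h2
  · simp [h2] at h1
  · obtain ⟨rfl, rfl⟩ := Stream'.cons_injective2 h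
    exact ⟨mem_zip_fst_unique (o.out_nodup a) he he', rfl⟩

/-- Determinism of merges: the strand of arrival occurs once in the list, so it fixes the letter
that is written. -/
theorem Branch.unique_left (hl : l.Nodup) (h : Branch o l a α s β) (h' : Branch o l a α' s β) :
    α = α' := by
  rcases h with ⟨rfl, rfl⟩ | ⟨h1, e, he, rfl⟩ <;> rcases h' with ⟨h2, rfl⟩ | ⟨h2, e', he', rfl⟩
  · rfl
  · simp at h2
  · simp [h2] at h1
  · rw [mem_zip_snd_unique hl he he']

theorem Branch.map (f : S → T) (h : Branch o l a α s β) : Branch o (l.map f) a α (f s) β := by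
  rcases h with ⟨rfl, rfl⟩ | ⟨h1, e, he, rfl⟩
  · exact .inl ⟨rfl, rfl⟩
  · refine .inr ⟨by simpa using h1, e, ?_, rfl⟩
    rw [List.zip_map_left]
    exact List.mem_map.2 ⟨_, he, rfl⟩

theorem Branch.of_map {f : S → T} {t : T} (h : Branch o (l.map f) a α t β) :
    ∃ s, f s = t ∧ Branch o l a α s β := by
  rcases h with ⟨h, rfl⟩ | ⟨h1, e, he, rfl⟩
  · obtain ⟨s, rfl, hs⟩ := List.map_eq_singleton_iff.1 h
    exact ⟨s, hs, .inl ⟨rfl, rfl⟩⟩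
  · rw [List.zip_map_left] at he
    obtain ⟨⟨s, e'⟩, hs, hs'⟩ := List.mem_map.1 he
    simp only [Prod.map_apply, id_eq, Prod.mk.injEq] at hs'
    obtain ⟨rfl, rfl⟩ := hs'
    exact ⟨s, rfl, .inr ⟨by simpa using h1, e', hs, rfl⟩⟩

theorem Fits.length_eq (h : Fits o l a col) (hl : 2 ≤ l.length) :
    l.length = (o.out a).length := by
  rcases h.cases with rfl | ⟨s, rfl, -⟩ | ⟨-, h⟩
  · simp at hl
  · simp at hl
  · simpa using congrArg List.length h

theorem Fits.map_eq (h : Fits o l a col) (hl : 2 ≤ l.length) :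
    l.map col = (o.out a).map Γ.term := by
  rcases h.cases with rfl | ⟨s, rfl, -⟩ | ⟨-, h⟩
  · simp at hl
  · simp at hl
  · exact h

theorem Fits.isRay_iff (hf : Fits o l a col) (h : Branch o l a α s β) :
    Γ.IsRay a α ↔ Γ.IsRay (col s) β := by
  rcases h with ⟨rfl, rfl⟩ | ⟨h1, e, he, rfl⟩
  · rcases hf.cases with h | ⟨s', h, rfl⟩ | ⟨h, -⟩
    · simp at h
    · rw [List.singleton_inj.1 h]
    · simp at h
  · rw [isRay_cons, eq_of_mem_zip (hf.map_eq h1) he,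
      (o.mem_out a e).1 (List.of_mem_zip he).2]
    simp

theorem Fits.exists_branch (hf : Fits o l a col) (hl : l ≠ []) (hα : Γ.IsRay a α) :
    ∃ s β, Branch o l a α s β := by
  rcases hf.cases with h | ⟨s, rfl, rfl⟩ | ⟨h, -⟩
  · exact absurd h hl
  · exact ⟨s, α, .inl ⟨rfl, rfl⟩⟩
  · obtain ⟨e, β, rfl, he, -⟩ := hα.exists_cons
    obtain ⟨s, hs⟩ := exists_mem_zip_right (hf.length_eq h) ((o.mem_out a e).2 he)
    exact ⟨s, β, .inr ⟨h, e, hs, rfl⟩⟩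

theorem Fits.exists_branch_left (hf : Fits o l a col) (hs : s ∈ l) (β : Stream' E) :
    ∃ α, Branch o l a α s β := by
  rcases hf.cases with rfl | ⟨s', rfl, rfl⟩ | ⟨h, -⟩
  · simp at hs
  · rw [List.mem_singleton.1 hs]
    exact ⟨β, .inl ⟨rfl, rfl⟩⟩
  · obtain ⟨e, he⟩ := exists_mem_zip_left (hf.length_eq h) hs
    exact ⟨_, .inr ⟨h, e, he, rfl⟩⟩

end Branch

/-! ### Turning strand diagrams upside down -/

/-- The graph with all strands reversed. -/
def StrandGraph.flip (A : StrandGraph V) : StrandGraph V where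
  Point := A.Point
  Strand := A.Strand
  finite_point := A.finite_point
  finite_strand := A.finite_strand
  init := A.term
  term := A.init
  pointCol := A.pointCol
  strandCol := A.strandCol
  ins := A.outs
  outs := A.ins
  ins_nodup := A.outs_nodup
  outs_nodup := A.ins_nodup
  mem_ins := A.mem_outs
  mem_outs := A.mem_ins
  acyclic p h := A.acyclic p (by
    rw [← Relation.transGen_swap] at h
    refine Relation.TransGen.mono ?_ _ _ h
    rintro a b ⟨s, h1, h2⟩
    exact ⟨s, h2, h1⟩)

namespace StrandDiagram

variable {o : EdgeOrder Γ} {x y z : Tuple V}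

/-- The strand diagram turned upside down. -/
def flip (A : StrandDiagram o x y) : StrandDiagram o y x where
  toStrandGraph := A.toStrandGraph.flip
  source := A.sink
  sink := A.source
  source_col := A.sink_col
  sink_col := A.source_col
  kind p := by
    rcases A.kind p with k | k | k | k | k
    exacts [.inr (.inl k), .inl k, .inr (.inr (.inr (.inl k))), .inr (.inr (.inl k)),
      .inr (.inr (.inr (.inr ⟨k.2, k.1⟩)))]
  univalentSource_col := A.univalentSink_col
  univalentSink_col := A.univalentSource_col
  split_col := A.merge_col
  merge_col := A.split_col
  degenerate_col p h := by
    obtain ⟨h1, h2, h3⟩ := A.degenerate_col p ⟨h.2, h.1⟩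
    exact ⟨h2, h1, h3⟩

/-- On each of its two sides, a point of any of the five kinds has no strand, one strand of its own
color, or one strand per edge. This lets all kinds be handled at once by `Fits` and `Branch`. -/
theorem fits_outs (A : StrandDiagram o x y) (p : A.Point) :
    Fits o (A.outs p) (A.pointCol p) A.strandCol := by
  refine ⟨A.outs_nodup p, ?_⟩
  have key : ∀ {l : List A.Strand}, l.length ≤ 1 → (∀ s ∈ l, A.strandCol s = A.pointCol p) →
      l = [] ∨ (∃ s, l = [s] ∧ A.strandCol s = A.pointCol p) := by
    intro l hl h
    match l, hl, h with
    | [], _, _ => exact .inl rfl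
    | [s], _, h => exact .inr ⟨s, rfl, h s (by simp)⟩
  rcases A.localCondition p with k | k | k | k | k
  · exact (key k.1.2.le k.2).imp_right .inl
  · exact .inl k.1.1
  · exact .inr (.inr ⟨k.1.2, k.2.1⟩)
  · exact (key k.1.1 k.2.2).imp_right .inl
  · exact (key k.1.2.le k.2.2.1).imp_right .inl

theorem fits_ins (A : StrandDiagram o x y) (p : A.Point) :
    Fits o (A.ins p) (A.pointCol p) A.strandCol := A.flip.fits_outs p

/-! ### The action of a strand diagram on rays -/

/-- A ray at a point moves along a strand to another point. -/
def Step (A : StrandDiagram o x y) (a b : A.Point × Stream' E) : Prop :=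
  ∃ s β, Branch o (A.outs a.1) (A.pointCol a.1) a.2 s β ∧
    Branch o (A.ins b.1) (A.pointCol b.1) b.2 s β

/-- A ray at a point moves along a sequence of strands to another point. -/
def Run (A : StrandDiagram o x y) : A.Point × Stream' E → A.Point × Stream' E → Prop :=
  Relation.ReflTransGen A.Step

variable {A : StrandDiagram o x y}

/-- Leaving a point and entering a point are described by the same relation `Branch`, so steps are
reversible. Statements about merges and sinks thus follow from those about splits and sources. -/
theorem step_flip {a b : A.Point × Stream' E} : A.flip.Step b a ↔ A.Step a b :=
  exists_congr fun _ => exists_congr fun _ => and_comm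

theorem run_flip {a b : A.Point × Stream' E} : A.flip.Run b a ↔ A.Run a b := by
  have h : A.flip.Step = Function.swap A.Step := funext₂ fun _ _ => propext step_flip
  rw [Run, Run, h]
  exact Relation.reflTransGen_swap

theorem Step.unique {a b b' : A.Point × Stream' E} (h : A.Step a b) (h' : A.Step a b') :
    b = b' := by
  obtain ⟨s, β, h1, h2⟩ := h
  obtain ⟨s', β', h1', h2'⟩ := h'
  obtain ⟨rfl, rfl⟩ := h1.unique h1'
  have h3 : b.1 = b'.1 := ((A.mem_ins _ _).1 h2.mem).symm.trans ((A.mem_ins _ _).1 h2'.mem)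
  refine Prod.ext h3 ?_
  rw [← h3] at h2'
  exact h2.unique_left (A.ins_nodup _) h2'

theorem Step.isRay_iff {a b : A.Point × Stream' E} (h : A.Step a b) :
    Γ.IsRay (A.pointCol a.1) a.2 ↔ Γ.IsRay (A.pointCol b.1) b.2 := by
  obtain ⟨s, β, h1, h2⟩ := h
  rw [(A.fits_outs _).isRay_iff h1, (A.fits_ins _).isRay_iff h2]

theorem Run.isRay_iff {a b : A.Point × Stream' E} (h : A.Run a b) :
    Γ.IsRay (A.pointCol a.1) a.2 ↔ Γ.IsRay (A.pointCol b.1) b.2 := by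
  induction h with
  | refl => rfl
  | tail _ h ih => rw [ih, h.isRay_iff]

theorem not_step_of_isSink {a b : A.Point × Stream' E} (h : A.IsSink a.1) : ¬ A.Step a b := by
  rintro ⟨s, β, h1, -⟩
  have := h1.mem
  rw [h] at this
  simp at this

theorem Run.unique_of_isSink {a b b' : A.Point × Stream' E} (h : A.Run a b) (h' : A.Run a b')
    (hb : A.IsSink b.1) (hb' : A.IsSink b'.1) : b = b' := by
  induction h using Relation.ReflTransGen.head_induction_on with
  | refl =>
    rcases h'.cases_head with rfl | ⟨c, hc, -⟩
    · rfl
    · exact absurd hc (not_step_of_isSink hb)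
  | head h1 _ ih =>
    rcases h'.cases_head with rfl | ⟨c, hc, hc'⟩
    · exact absurd h1 (not_step_of_isSink hb')
    · rw [h1.unique hc] at ih
      exact ih hc'

/-- There is a strand from `p` to `q`. -/
def Adj (A : StrandDiagram o x y) (p q : A.Point) : Prop := ∃ s, A.init s = p ∧ A.term s = q

/-- The smaller points are the lower ones: induction along this relation assumes the claim at the
points directly below. -/
theorem wellFounded_adj (A : StrandDiagram o x y) : WellFounded (fun p q => A.Adj q p) := by
  have := A.finite_point
  let r : A.Point → A.Point → Prop := Relation.TransGen (fun p q => A.Adj q p)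
  have h : Std.Irrefl r := ⟨fun p hp => A.flip.acyclic p
    (Relation.TransGen.mono (fun a b ⟨s, h1, h2⟩ => ⟨s, h2, h1⟩) _ _ hp)⟩
  have h' : IsTrans _ r := ⟨fun _ _ _ => Relation.TransGen.trans⟩
  exact Subrelation.wf (r := r) (fun h => Relation.TransGen.single h)
    (Finite.wellFounded_of_trans_of_irrefl r)

theorem Step.adj {a b : A.Point × Stream' E} (h : A.Step a b) : A.Adj a.1 b.1 := by
  obtain ⟨s, β, h1, h2⟩ := h
  exact ⟨s, (A.mem_outs _ _).1 h1.mem, (A.mem_ins _ _).1 h2.mem⟩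

theorem exists_step {a : A.Point × Stream' E} (ha : Γ.IsRay (A.pointCol a.1) a.2)
    (h : ¬ A.IsSink a.1) : ∃ b, A.Step a b := by
  obtain ⟨s, β, hs⟩ := (A.fits_outs a.1).exists_branch h ha
  obtain ⟨α', h'⟩ := (A.fits_ins (A.term s)).exists_branch_left ((A.mem_ins _ s).2 rfl) β
  exact ⟨(A.term s, α'), s, β, hs, h'⟩

theorem exists_run_sink (A : StrandDiagram o x y) (a : A.Point × Stream' E)
    (ha : Γ.IsRay (A.pointCol a.1) a.2) :
    ∃ j β, A.Run a (A.sink j, β) := by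
  obtain ⟨p, α⟩ := a
  induction p using A.wellFounded_adj.induction generalizing α with
  | _ p ih =>
    by_cases h : A.IsSink p
    · exact ⟨A.sink.symm ⟨p, h⟩, α, by rw [Equiv.apply_symm_apply]; exact .refl⟩
    · obtain ⟨b, hb⟩ := exists_step ha h
      obtain ⟨j, β, hj⟩ := ih b.1 hb.adj b.2 (hb.isRay_iff.1 ha)
      exact ⟨j, β, .head hb hj⟩

theorem run_sink_unique {a : A.Point × Stream' E} {j j' : Fin y.length} {β β' : Stream' E}
    (h : A.Run a (A.sink j, β)) (h' : A.Run a (A.sink j', β')) : j = j' ∧ β = β' := by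
  have := h.unique_of_isSink h' (A.sink j).2 (A.sink j').2
  simpa [Subtype.ext_iff.symm] using this

variable (A)

/-- The ray `b` at the bottom of the diagram is the image of the ray `a` at the top. -/
def Rel (a : Ray Γ x) (b : Ray Γ y) : Prop :=
  A.Run (A.source a.1.1, a.1.2) (A.sink b.1.1, b.1.2)

theorem rel_flip {a : Ray Γ x} {b : Ray Γ y} : A.flip.Rel b a ↔ A.Rel a b := run_flip

theorem exists_rel (a : Ray Γ x) : ∃ b, A.Rel a b := by
  obtain ⟨j, β, h⟩ := A.exists_run_sink (A.source a.1.1, a.1.2) (by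
    simpa only [A.source_col] using a.2)
  refine ⟨⟨(j, β), ?_⟩, h⟩
  rw [← A.sink_col]
  exact h.isRay_iff.1 (by simpa only [A.source_col] using a.2)

theorem Rel.unique {A : StrandDiagram o x y} {a : Ray Γ x} {b b' : Ray Γ y} (h : A.Rel a b)
    (h' : A.Rel a b') : b = b' := by
  have := run_sink_unique h h'
  exact Subtype.ext (Prod.ext this.1 this.2)

/-- The bijection of rays defined by a strand diagram. -/
noncomputable def sem : Ray Γ x ≃ Ray Γ y where
  toFun a := (A.exists_rel a).choose
  invFun b := (A.flip.exists_rel b).choose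
  left_inv a := by
    have h1 := (A.exists_rel a).choose_spec
    have h2 := (A.flip.exists_rel (A.exists_rel a).choose).choose_spec
    exact h2.unique (A.rel_flip.2 h1)
  right_inv b := by
    have h1 := (A.flip.exists_rel b).choose_spec
    have h2 := (A.exists_rel (A.flip.exists_rel b).choose).choose_spec
    exact h2.unique (A.rel_flip.1 h1)

variable {A}

theorem rel_sem (a : Ray Γ x) : A.Rel a (A.sem a) := (A.exists_rel a).choose_spec

theorem sem_eq_iff {a : Ray Γ x} {b : Ray Γ y} : A.sem a = b ↔ A.Rel a b :=
  ⟨fun h => h ▸ rel_sem a, fun h => (rel_sem a).unique h⟩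

/-- The inverse map in `sem` is by definition the forward map of the flipped diagram, and flipping
twice gives back the same diagram definitionally. -/
theorem sem_flip : A.flip.sem = A.sem.symm := rfl

end StrandDiagram

namespace StrandDiagram

variable {o : EdgeOrder Γ} {x y z : Tuple V}

/-! ### Equivalent diagrams act in the same way -/

variable {A B : StrandDiagram o x y}

/-- Both actions are everywhere defined functions, so it suffices that runs of `B` can be imitated
in `A`; the converse is automatic. For a reduction from `A` to `B` this is the convenient direction,
as all points of `B` survive from `A`. -/
theorem sem_eq_of_step_lift (P : B.Point → A.Point)
    (hsource : ∀ i, P (B.source i) = A.source i) (hsink : ∀ i, P (B.sink i) = A.sink i)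
    (h : ∀ a b, Γ.IsRay (B.pointCol a.1) a.2 → B.Step a b → A.Run (P a.1, a.2) (P b.1, b.2)) :
    A.sem = B.sem := by
  have key : ∀ a b, Γ.IsRay (B.pointCol a.1) a.2 → B.Run a b →
      A.Run (P a.1, a.2) (P b.1, b.2) := by
    intro a b ha hab
    induction hab with
    | refl => exact .refl
    | tail h1 h2 ih => exact ih.trans (h _ _ ((Run.isRay_iff h1).1 ha) h2)
  refine Equiv.ext fun a => ?_
  rw [sem_eq_iff]
  have := key _ _ (by simpa only [B.source_col] using a.2) (rel_sem (A := B) a)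
  rwa [hsource, hsink] at this

theorem Isomorphic.sem_eq (h : Isomorphic A B) : A.sem = B.sem := by
  obtain ⟨P, S, -, -, hp, -, hi, ho, hs, ht⟩ := h
  refine (sem_eq_of_step_lift P (fun i => (hs i).symm) (fun i => (ht i).symm) ?_).symm
  rintro a b - ⟨s, β, h1, h2⟩
  refine .single ⟨S s, β, ?_, ?_⟩
  · rw [ho, hp]; exact h1.map S
  · rw [hi, hp]; exact h2.map S

theorem Reduction0.sem_eq (h : Reduction0 A B) : A.sem = B.sem := by
  obtain ⟨v, s₁, s₂, P, σ, hv, hv', hD, -, hσ, -, hi, ho⟩ := h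
  refine sem_eq_of_step_lift P hD.source hD.sink ?_
  rintro a b - ⟨t, β, k1, k2⟩
  rw [ho, hD.pointCol] at k1
  rw [hi, hD.pointCol] at k2
  obtain ⟨s, rfl, h1⟩ := k1.of_map
  obtain ⟨s', h', h2⟩ := k2.of_map
  have hP : ∀ q, P q ≠ v := fun q hq => by
    have : P q ∈ Set.range P := ⟨q, rfl⟩
    rw [hD.range_eq] at this
    exact this hq
  rcases (hσ _ _).1 h'.symm with rfl | ⟨rfl | rfl, h⟩
  · exact .single ⟨s, β, h1, h2⟩
  · rcases h with rfl | rfl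
    · exact absurd (((A.mem_ins _ _).1 h2.mem).symm.trans ((A.mem_ins v _).1 (by simp [hv]))) (hP _)
    -- The joined strand of `B` unfolds into two steps of `A` through `v`, where the ray does not
    -- change.
    · exact .tail (b := (v, β)) (.single ⟨s, β, h1, by simp [Branch, hv]⟩)
        ⟨s', β, by simp [Branch, hv'], h2⟩
  · exact absurd (((A.mem_outs _ _).1 h1.mem).symm.trans ((A.mem_outs v _).1 (by simp [hv'])))
      (hP _)

theorem Reduction2.sem_eq (h : Reduction2 A B) : A.sem = B.sem := by
  obtain ⟨v, w, s, P, σ, hm, hs, hvw, hv, hw, hD, -, hσ, -, hi, ho⟩ := h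
  refine sem_eq_of_step_lift P hD.source hD.sink ?_
  rintro a b - ⟨t, β, k1, k2⟩
  rw [ho, hD.pointCol] at k1
  rw [hi, hD.pointCol] at k2
  obtain ⟨r, rfl, h1⟩ := k1.of_map
  obtain ⟨r', h', h2⟩ := k2.of_map
  have hP : ∀ q, P q ≠ v ∧ P q ≠ w := fun q => by
    have : P q ∈ Set.range P := ⟨q, rfl⟩
    rw [hD.range_eq] at this
    simpa using this
  have hsv : A.init s = v := (A.mem_outs v s).1 (by simp [hv])
  have hsw : A.term s = w := (A.mem_ins w s).1 (by simp [hw])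
  have hr1 := (A.mem_outs _ _).1 h1.mem
  have hr2 := (A.mem_ins _ _).1 h2.mem
  have hr : r ≠ s := fun h => (hP a.1).1 (by rw [← hr1, h, hsv])
  have hr' : r' ≠ s := fun h => (hP b.1).2 (by rw [← hr2, h, hsw])
  rcases (hσ _ _ hr hr').1 h'.symm with rfl | h | h
  · exact .single ⟨r, β, h1, h2⟩
  · have e1 := (A.fits_ins v).length_eq hm.2
    have e2 := (A.fits_outs w).length_eq hs.2
    obtain ⟨i, hi, hi'⟩ := List.getElem_of_mem h
    simp only [List.getElem_zip, Prod.mk.injEq] at hi'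
    simp only [List.length_zip, lt_inf_iff] at hi
    obtain ⟨rfl, rfl⟩ := hi'
    have hl : i < (o.out (A.pointCol v)).length := by omega
    -- The merge `v` writes the `i`-th edge at the common color and the split `w` reads it again, so
    -- the ray leaves by the strand with the same position `i`.
    refine .tail (b := (w, Stream'.cons (o.out (A.pointCol v))[i] β))
      (.tail (b := (v, Stream'.cons (o.out (A.pointCol v))[i] β)) (.single ?_) ?_) ?_
    · exact ⟨_, β, h1, .inr ⟨hm.2, _, List.mem_iff_getElem.2 ⟨i, by simp; omega, by simp⟩, rfl⟩⟩
    · exact ⟨s, _, .inl ⟨hv, rfl⟩, .inl ⟨hw, rfl⟩⟩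
    · refine ⟨_, β, .inr ⟨hs.2, _, List.mem_iff_getElem.2 ⟨i, ?_, ?_⟩, rfl⟩, h2⟩
      · simp [← hvw]; omega
      · simp [hvw]
  · exact absurd (hr1.symm.trans ((A.mem_outs w _).1 (List.of_mem_zip h).2)) (hP _).2

/-- The letter read by the split is written back by the merge, as the strands join them in the same
order. The single strand that replaces them may begin or end at a point left over from `v` or `w`,
so the two ends of a step are analysed separately. -/
theorem Reduction1.sem_eq (h : Reduction1 A B) : A.sem = B.sem := by
  obtain ⟨v, w, P, σ, hs, hm, hc, hl, hD, -, hσ, -, -, hio, hv, hw⟩ := h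
  refine sem_eq_of_step_lift P hD.source hD.sink ?_
  rintro a b ha ⟨t, β, h1, h2⟩
  rw [hD.pointCol] at h1 h2 ha
  have hsrc : ∀ s ∈ A.ins v, A.ins v = [s] := fun s h => by
    obtain ⟨s', h'⟩ := List.length_eq_one_iff.1
      (le_antisymm hs.1 (List.length_pos_of_mem h))
    rw [h'] at h ⊢
    rw [List.mem_singleton.1 h]
  have hsnk : ∀ s ∈ A.outs w, A.outs w = [s] := fun s h => by
    obtain ⟨s', h'⟩ := List.length_eq_one_iff.1
      (le_antisymm hm.1 (List.length_pos_of_mem h))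
    rw [h'] at h ⊢
    rw [List.mem_singleton.1 h]
  let K : Set A.Strand := {s | s ∈ A.ins v ∨ s ∈ A.outs v ∨ s ∈ A.outs w}
  have hne : ∃ s, s ∈ A.outs v := List.exists_mem_of_length_pos (by have := hs.2; omega)
  -- Either `t` comes from a strand that the reduction leaves alone, or `t` is the joined strand,
  -- and then the ray can be brought down to `v` in `A`, in zero steps if `v` is the source where it
  -- stands.
  have upper : (∃ s, s ∉ K ∧ σ s = t ∧ Branch o (A.outs (P a.1)) (A.pointCol (P a.1)) a.2 s β) ∨
      ((∃ s ∈ K, σ s = t) ∧ Γ.IsRay (A.pointCol v) β ∧ A.Run (P a.1, a.2) (v, β)) := by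
    by_cases hav : P a.1 = v
    · obtain ⟨s, hsv⟩ := hne
      rw [(hv _ hav).2 s hsv] at h1
      rcases h1 with ⟨h1, h1'⟩ | h1
      · refine .inr ⟨⟨s, .inr (.inl hsv), List.singleton_inj.1 h1⟩, ?_, ?_⟩
        · rwa [← h1', ← hav]
        · rw [hav, h1']
          exact .refl
      · simp at h1
    · by_cases haw : P a.1 = w
      · rw [(hw _ haw).2] at h1
        exact absurd h1.mem (by simp)
      · rw [(hio _ hav haw).2] at h1
        obtain ⟨s, rfl, k1⟩ := h1.of_map
        have e := (A.mem_outs _ _).1 k1.mem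
        by_cases hK : s ∈ K
        · right
          rcases hK with h | h | h
          · have hr : A.Step (P a.1, a.2) (v, β) := ⟨s, β, k1, .inl ⟨hsrc s h, rfl⟩⟩
            exact ⟨⟨s, .inl h, rfl⟩, hr.isRay_iff.1 ha, .single hr⟩
          · exact absurd (e.symm.trans ((A.mem_outs _ _).1 h)) hav
          · exact absurd (e.symm.trans ((A.mem_outs _ _).1 h)) haw
        · exact .inl ⟨s, hK, rfl, k1⟩
  -- The same alternative at the lower end, with `w` in place of `v`.
  have lower : (∃ s, s ∉ K ∧ σ s = t ∧ Branch o (A.ins (P b.1)) (A.pointCol (P b.1)) b.2 s β) ∨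
      ((∃ s ∈ K, σ s = t) ∧ A.Run (w, β) (P b.1, b.2)) := by
    by_cases hbw : P b.1 = w
    · obtain ⟨s, hsv⟩ := hne
      rw [(hw _ hbw).1 s hsv] at h2
      rcases h2 with ⟨h2, h2'⟩ | h2
      · refine .inr ⟨⟨s, .inr (.inl hsv), List.singleton_inj.1 h2⟩, ?_⟩
        rw [hbw, h2']
        exact .refl
      · simp at h2
    · by_cases hbv : P b.1 = v
      · rw [(hv _ hbv).1] at h2
        exact absurd h2.mem (by simp)
      · rw [(hio _ hbv hbw).1] at h2
        obtain ⟨s, rfl, k2⟩ := h2.of_map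
        have e := (A.mem_ins _ _).1 k2.mem
        by_cases hK : s ∈ K
        · right
          rcases hK with h | h | h
          · exact absurd (e.symm.trans ((A.mem_ins _ _).1 h)) hbv
          · rw [hl] at h
            exact absurd (e.symm.trans ((A.mem_ins _ _).1 h)) hbw
          · exact ⟨⟨s, .inr (.inr h), rfl⟩, .single ⟨s, β, .inl ⟨hsnk s h, rfl⟩, k2⟩⟩
        · exact .inl ⟨s, hK, rfl, k2⟩
  clear h1 h2
  rcases upper with ⟨s, hK, rfl, h1⟩ | ⟨⟨s, hK, rfl⟩, hr, h1⟩ <;>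
    rcases lower with ⟨s', hK', h', h2⟩ | ⟨⟨s', hK', h'⟩, h2⟩
  · rcases (hσ _ _).1 h' with rfl | ⟨h, -⟩
    · exact .single ⟨s', β, h1, h2⟩
    · exact absurd h hK'
  · rcases (hσ _ _).1 h' with rfl | ⟨-, h⟩
    · exact absurd hK' hK
    · exact absurd h hK
  · rcases (hσ _ _).1 h' with rfl | ⟨h, -⟩
    · exact absurd hK hK'
    · exact absurd h hK'
  -- Both ends lie on the joined strand, and only the passage from `v` to `w` is missing. The split
  -- can act only on a genuine ray at the color of `v`; this is why `upper` records `IsRay`.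
  · refine h1.trans (.head ?_ h2)
    obtain ⟨s, γ, hb⟩ := (A.fits_outs v).exists_branch (fun h => by
      have := hs.2; simp [h] at this) hr
    exact ⟨s, γ, hb, by rw [← hl, ← hc]; exact hb⟩

theorem sem_eq_of_equiv (h : setoid o x y A B) : A.sem = B.sem := by
  induction h with
  | rel A B h =>
    rcases h with h | h | h | h
    exacts [h.sem_eq, h.sem_eq, h.sem_eq, h.sem_eq]
  | refl => rfl
  | symm _ _ _ ih => exact ih.symm
  | trans _ _ _ _ _ h1 h2 => exact h1.trans h2

/-! ### The action of a composition -/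

section Glue

variable {A : StrandDiagram o x y} {B : StrandDiagram o y z}

/-- A univalent sink of `A` disappears in the glued diagram, so the run is followed only to the last
point above the seam, with the ray ready to leave along the `j`-th seam. For a merge-sink that point
is the sink itself. -/
theorem glue_run_left {p : A.Point} {α : Stream' E} {j : Fin y.length} {β : Stream' E}
    (h : A.Run (p, α) (A.sink j, β)) (hp : ¬ A.IsUnivalentSink p) :
    ∃ c, (A.glue B).Run (.inl ⟨p, hp⟩, α) c ∧
      Branch o ((A.glue B).outs c.1) ((A.glue B).pointCol c.1) c.2 (.inr (.inr j)) β := by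
  generalize ha : (p, α) = a at h
  induction h using Relation.ReflTransGen.head_induction_on generalizing p α with
  | refl =>
    obtain ⟨rfl, rfl⟩ := Prod.mk.inj ha
    refine ⟨_, .refl, .inl ⟨?_, rfl⟩⟩
    exact (dif_pos (A.sink j).2).trans
      (congrArg (fun i => [Sum.inr (Sum.inr i)]) (A.sink.symm_apply_apply j))
  | head h1 h2 ih =>
    subst ha
    rename_i c
    obtain ⟨p', α'⟩ := c
    obtain ⟨s, γ, hs, hs'⟩ := h1
    have hout : (A.glue B).outs (.inl ⟨p, hp⟩) = (A.outs p).map glueLeft :=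
      dif_neg (fun h => by have := hs.mem; simp [show A.outs p = [] from h] at this)
    have hb : Branch o ((A.glue B).outs (.inl ⟨p, hp⟩)) ((A.glue B).pointCol (.inl ⟨p, hp⟩)) α
        (glueLeft s) γ := by
      rw [hout]
      exact hs.map glueLeft
    have ht : A.term s = p' := (A.mem_ins _ _).1 hs'.mem
    by_cases hp' : A.IsUnivalentSink p'
    -- The next point is the univalent sink that the seam absorbs: the strand towards it has become
    -- the seam, and the run in the glued diagram stops here.
    · refine ⟨_, .refl, ?_⟩
      rcases h2.cases_head with h3 | ⟨c, hc, -⟩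
      · obtain ⟨h4, rfl⟩ := Prod.mk.inj h3
        have hg : glueLeft (B := B) s = .inr (.inr j) := by
          unfold glueLeft
          rw [dif_pos (by rwa [ht])]
          congr 2
          rw [Equiv.symm_apply_eq]
          exact Subtype.ext (ht.trans h4)
        rw [← hg]
        convert hb using 1
        rcases hs' with ⟨-, h⟩ | ⟨h, -⟩
        · exact h
        · have := hp'.2
          simp only at h
          omega
      · exact absurd hc (not_step_of_isSink hp'.1)
    · obtain ⟨c, hc, hc'⟩ := ih hp' rfl
      refine ⟨c, .head ⟨glueLeft s, γ, hb, ?_⟩ hc, hc'⟩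
      exact hs'.map glueLeft

theorem glue_run_right {q : B.Point} {α : Stream' E} {j : Fin y.length} {β : Stream' E}
    (h : B.Run (B.source j, β) (q, α)) (hq : ¬ B.IsUnivalentSource q) :
    ∃ c, (A.glue B).Run c (.inr ⟨q, hq⟩, α) ∧
      Branch o ((A.glue B).ins c.1) ((A.glue B).pointCol c.1) c.2 (.inr (.inr j)) β := by
  generalize ha : (q, α) = a at h
  induction h generalizing q α with
  | refl =>
    obtain ⟨rfl, rfl⟩ := Prod.mk.inj ha
    refine ⟨_, .refl, .inl ⟨?_, rfl⟩⟩
    exact (dif_pos (B.source j).2).trans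
      (congrArg (fun i => [Sum.inr (Sum.inr i)]) (B.source.symm_apply_apply j))
  | tail h2 h1 ih =>
    subst ha
    rename_i c
    obtain ⟨q', α'⟩ := c
    obtain ⟨s, γ, hs', hs⟩ := h1
    have hin : (A.glue B).ins (.inr ⟨q, hq⟩) = (B.ins q).map glueRight :=
      dif_neg (fun h => by have := hs.mem; simp [show B.ins q = [] from h] at this)
    have hb : Branch o ((A.glue B).ins (.inr ⟨q, hq⟩)) ((A.glue B).pointCol (.inr ⟨q, hq⟩)) α
        (glueRight s) γ := by
      rw [hin]
      exact hs.map glueRight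
    have ht : B.init s = q' := (B.mem_outs _ _).1 hs'.mem
    by_cases hq' : B.IsUnivalentSource q'
    · refine ⟨_, .refl, ?_⟩
      rcases Relation.ReflTransGen.cases_tail h2 with h3 | ⟨c, -, hc⟩
      · obtain ⟨h4, rfl⟩ := Prod.mk.inj h3
        have hg : glueRight (A := A) s = .inr (.inr j) := by
          unfold glueRight
          rw [dif_pos (by rwa [ht])]
          congr 2
          rw [Equiv.symm_apply_eq]
          exact Subtype.ext (ht.trans h4)
        rw [← hg]
        convert hb using 1
        rcases hs' with ⟨-, h⟩ | ⟨h, -⟩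
        · exact h
        · have := hq'.2
          simp only at h
          omega
      · exact absurd (step_flip.2 hc) (not_step_of_isSink (A := B.flip) hq'.1)
    · obtain ⟨c, hc, hc'⟩ := ih hq' rfl
      refine ⟨c, .tail hc ⟨glueRight s, γ, ?_, hb⟩, hc'⟩
      exact hs'.map glueRight

theorem sem_glue (A : StrandDiagram o x y) (B : StrandDiagram o y z) :
    (A.glue B).sem = A.sem.trans B.sem := by
  refine Equiv.ext fun a => ?_
  rw [sem_eq_iff]
  obtain ⟨c, hc, hc'⟩ := glue_run_left (B := B) (rel_sem (A := A) a)
    (not_isUnivalentSink_of_isSource (A.source _).2)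
  obtain ⟨d, hd, hd'⟩ := glue_run_right (A := A) (rel_sem (A := B) (A.sem a))
    (not_isUnivalentSource_of_isSink (B.sink _).2)
  -- The two halves are linked by one step across the seam on which the intermediate ray `A.sem a`
  -- leaves `A` and enters `B`.
  exact (hc.tail ⟨_, _, hc', hd'⟩).trans hd

end Glue

end StrandDiagram

/-! ### Piecewise-canonical bijections of rays -/

section Piecewise

variable {x y z : Tuple V}

/-- The bijection `f` maps `iwγ` to `jrγ` for all rays `γ` at the vertex `c`, at which the
reversed words `w` and `r` end. -/
structure CanonicalAt (f : Ray Γ x ≃ Ray Γ y) (i : Fin x.length) (w : List E) (j : Fin y.length)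
    (r : List E) (c : V) : Prop where
  left : Γ.IsRevPath (x.get i) w c
  right : Γ.IsRevPath (y.get j) r c
  map : ∀ γ, Γ.IsRay c γ → ∀ a, a.1 = (i, revAppend w γ) → (f a).1 = (j, revAppend r γ)

/-- The bijection `f` is canonical on all cylinders of words of length at least `N`. -/
def HasDepth (f : Ray Γ x ≃ Ray Γ y) (N : ℕ) : Prop :=
  ∀ i w c, Γ.IsRevPath (x.get i) w c → N ≤ w.length → ∃ j r, CanonicalAt f i w j r c

theorem CanonicalAt.extend {f : Ray Γ x ≃ Ray Γ y} {i w j r} {c c' : V}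
    (h : CanonicalAt f i w j r c) {u : List E} (hu : Γ.IsRevPath c u c') :
    CanonicalAt f i (u ++ w) j (u ++ r) c' := by
  refine ⟨h.left.append hu, h.right.append hu, fun γ hγ a ha => ?_⟩
  rw [revAppend_append] at ha ⊢
  exact h.map _ ((isRay_revAppend hu).2 hγ) a ha

theorem CanonicalAt.symm {f : Ray Γ x ≃ Ray Γ y} {i w j r} {c : V}
    (h : CanonicalAt f i w j r c) : CanonicalAt f.symm j r i w c := by
  refine ⟨h.right, h.left, fun γ hγ b hb => ?_⟩
  let a : Ray Γ x := ⟨(i, revAppend w γ), (isRay_revAppend h.left).2 hγ⟩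
  have : f a = b := Subtype.ext ((h.map γ hγ a rfl).trans hb.symm)
  rw [← this, f.symm_apply_apply]

theorem CanonicalAt.trans {f : Ray Γ x ≃ Ray Γ y} {g : Ray Γ y ≃ Ray Γ z} {i w j r k s} {c : V}
    (h : CanonicalAt f i w j r c) (h' : CanonicalAt g j r k s c) :
    CanonicalAt (f.trans g) i w k s c :=
  ⟨h.left, h'.right, fun γ hγ a ha => h'.map γ hγ _ (h.map γ hγ a ha)⟩

theorem isRevPath_concat {a c : V} {e : E} {w : List E} :
    Γ.IsRevPath a (w ++ [e]) c ↔ Γ.init e = a ∧ Γ.IsRevPath (Γ.term e) w c := by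
  induction w generalizing c with
  | nil => simp [DirectedGraph.IsRevPath, eq_comm]
  | cons e' w ih =>
    simp only [List.cons_append, DirectedGraph.IsRevPath]
    rw [ih, and_assoc]

theorem revAppend_concat (w : List E) (e : E) (γ : Stream' E) :
    revAppend (w ++ [e]) γ = Stream'.cons e (revAppend w γ) := revAppend_append _ _ _

section Branch

variable {S : Type*} {o : EdgeOrder Γ} {l : List S} {a : V} {col : S → V}

/-- The word `u` is what a ray gains at a point when it arrives along `s`: one letter at a merge,
nothing otherwise. -/
theorem Fits.exists_word (hf : Fits o l a col) {s : S} (hs : s ∈ l) :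
    ∃ u, Γ.IsRevPath a u (col s) ∧ ∀ β, Branch o l a (revAppend u β) s β := by
  rcases hf.cases with rfl | ⟨s', rfl, rfl⟩ | ⟨h, h'⟩
  · simp at hs
  · rw [List.mem_singleton.1 hs]
    exact ⟨[], rfl, fun β => .inl ⟨rfl, rfl⟩⟩
  · obtain ⟨e, he⟩ := exists_mem_zip_left (hf.length_eq h) hs
    exact ⟨[e], ⟨(o.mem_out a e).1 (List.of_mem_zip he).2, (eq_of_mem_zip h' he).symm⟩,
      fun β => .inr ⟨h, e, he, rfl⟩⟩

/-- One known letter is enough to decide by which strand the ray leaves, and at most this letter is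
used up. -/
theorem Fits.exists_leave (hf : Fits o l a col) (hl : l ≠ []) {w : List E} {c : V}
    (hw : Γ.IsRevPath a w c) (hw' : 1 ≤ w.length) :
    ∃ s ∈ l, ∃ w', Γ.IsRevPath (col s) w' c ∧ w.length ≤ w'.length + 1 ∧
      ∀ γ, Branch o l a (revAppend w γ) s (revAppend w' γ) := by
  rcases hf.cases with h | ⟨s, rfl, rfl⟩ | ⟨h, h'⟩
  · exact absurd h hl
  · exact ⟨s, by simp, w, hw, by omega, fun γ => .inl ⟨rfl, rfl⟩⟩
  · obtain rfl | ⟨w', e, rfl⟩ := List.eq_nil_or_concat w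
    · simp at hw'
    rw [List.concat_eq_append] at hw hw' ⊢
    rw [isRevPath_concat] at hw
    obtain ⟨s, hs⟩ := exists_mem_zip_right (hf.length_eq h) ((o.mem_out a e).2 hw.1)
    refine ⟨s, (List.of_mem_zip hs).1, w', ?_, by simp, fun γ => .inr ⟨h, e, hs, ?_⟩⟩
    · rw [eq_of_mem_zip h' hs]; exact hw.2
    · exact revAppend_concat _ _ _

end Branch

/-- Each point reads at most one letter and the diagram is finite and acyclic, so a prefix of
bounded length determines the whole route of a ray; the rest of the ray is copied. -/
theorem StrandDiagram.exists_hasDepth {o : EdgeOrder Γ} (A : StrandDiagram o x y) :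
    ∃ N, HasDepth A.sem N := by
  have key : ∀ p : A.Point, ∃ N, ∀ w c, Γ.IsRevPath (A.pointCol p) w c → N ≤ w.length →
      ∃ j r, Γ.IsRevPath (y.get j) r c ∧
        ∀ γ, A.Run (p, revAppend w γ) (A.sink j, revAppend r γ) := by
    intro p
    induction p using A.wellFounded_adj.induction with
    | _ p ih =>
      by_cases h : A.IsSink p
      · refine ⟨0, fun w c hw _ => ⟨A.sink.symm ⟨p, h⟩, w, ?_, fun γ => ?_⟩⟩
        · rw [← A.sink_col, Equiv.apply_symm_apply]
          exact hw
        · rw [Equiv.apply_symm_apply]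
          exact .refl
      · have ih' : ∀ s : {s // A.init s = p}, ∃ N, ∀ w c,
            Γ.IsRevPath (A.pointCol (A.term s)) w c → N ≤ w.length →
            ∃ j r, Γ.IsRevPath (y.get j) r c ∧
              ∀ γ, A.Run (A.term s, revAppend w γ) (A.sink j, revAppend r γ) :=
          fun s => ih _ ⟨s, s.2, rfl⟩
        choose N hN using ih'
        have := A.finite_strand
        obtain ⟨M, hM⟩ := (Set.finite_range N).bddAbove
        -- `M` letters are enough below every strand leaving `p`, and `p` itself may read one more.
        refine ⟨M + 1, fun w c hw hl => ?_⟩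
        obtain ⟨s, hs, w', hw', hl', hb⟩ := (A.fits_outs p).exists_leave h hw (by omega)
        obtain ⟨u, hu, hb'⟩ := (A.fits_ins (A.term s)).exists_word ((A.mem_ins _ s).2 rfl)
        have hs' := (A.mem_outs _ _).1 hs
        have hm : N ⟨s, hs'⟩ ≤ M := hM ⟨_, rfl⟩
        obtain ⟨j, r, hr, hrun⟩ := hN ⟨s, hs'⟩ (w' ++ u) c (hu.append hw') (by
          rw [List.length_append]; omega)
        refine ⟨j, r, hr, fun γ => .head ⟨s, _, hb γ, ?_⟩ (hrun γ)⟩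
        rw [revAppend_append]
        exact hb' _
  choose N hN using key
  have := A.finite_point
  obtain ⟨M, hM⟩ := (Set.finite_range N).bddAbove
  refine ⟨M, fun i w c hw hl => ?_⟩
  obtain ⟨j, r, hr, hrun⟩ := hN (A.source i) w c (by rwa [A.source_col])
    ((hM ⟨_, rfl⟩).trans hl)
  refine ⟨j, r, hw, hr, fun γ hγ a ha => ?_⟩
  have hrel : A.Rel a ⟨(j, revAppend r γ), (isRay_revAppend hr).2 hγ⟩ := by
    unfold StrandDiagram.Rel
    rw [ha]
    exact hrun γ
  rw [StrandDiagram.sem_eq_iff.2 hrel]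

end Piecewise

/-! ### Construction of strand diagrams -/

theorem Fits.map {S T : Type*} {o : EdgeOrder Γ} {l : List S} {a : V} {col : S → V}
    (h : Fits o l a col) {f : S → T} {col' : T → V} (hf : ∀ s ∈ l, ∀ t ∈ l, f s = f t → s = t)
    (hc : ∀ s ∈ l, col' (f s) = col s) : Fits o (l.map f) a col' := by
  refine ⟨List.Nodup.map_on hf h.nodup, ?_⟩
  rcases h.cases with rfl | ⟨s, rfl, rfl⟩ | ⟨h1, h2⟩
  · exact .inl rfl
  · exact .inr (.inl ⟨_, rfl, hc s (by simp)⟩)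
  · refine .inr (.inr ⟨by simpa using h1, ?_⟩)
    rw [List.map_map, ← h2]
    exact List.map_congr_left hc

namespace StrandDiagram

variable {o : EdgeOrder Γ} {x y z : Tuple V}

/-- The kind of a point can be recovered from its two sides: besides `Fits`, it is only required
that the point is not isolated, that it does not branch on both sides, and that a point with one
strand on each side lies at a loop. -/
theorem localCondition_of_fits {G : StrandGraph V} {p : G.Point}
    (hi : Fits o (G.ins p) (G.pointCol p) G.strandCol)
    (ho : Fits o (G.outs p) (G.pointCol p) G.strandCol)
    (h0 : G.ins p ≠ [] ∨ G.outs p ≠ []) (h1 : (G.ins p).length ≤ 1 ∨ (G.outs p).length ≤ 1)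
    (h2 : (G.ins p).length = 1 → (G.outs p).length = 1 →
      ∃ e, o.out (G.pointCol p) = [e] ∧ Γ.term e = G.pointCol p) :
    LocalCondition o G p := by
  simp only [LocalCondition, StrandGraph.IsUnivalentSource, StrandGraph.IsUnivalentSink,
    StrandGraph.IsSplit, StrandGraph.IsMerge, StrandGraph.IsDegenerate, StrandGraph.IsSource,
    StrandGraph.IsSink]
  rcases hi.cases with hi | ⟨s, hi, hs⟩ | ⟨hi, hi'⟩ <;>
    rcases ho.cases with ho | ⟨t, ho, ht⟩ | ⟨ho, ho'⟩
  · simp [hi, ho] at h0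
  · simp [hi, ho, ht]
  · simp [hi, ho, ho']
  · simp [hi, ho, hs]
  · simp only [hi, ho] at h2
    simp [hi, ho, hs, ht, h2]
  · simp [hi, ho, ho', hs]
  · simp [ho, hi, hi']
  · simp [ho, hi, hi', ht]
  · omega

/-- A strand graph with the local conditions of a strand diagram. -/
def ofLocalCondition (G : StrandGraph V) (source : Fin x.length ≃ {p // G.IsSource p})
    (sink : Fin y.length ≃ {p // G.IsSink p}) (source_col : ∀ i, G.pointCol (source i) = x.get i)
    (sink_col : ∀ i, G.pointCol (sink i) = y.get i) (h : ∀ p, LocalCondition o G p) :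
    StrandDiagram o x y where
  toStrandGraph := G
  source := source
  sink := sink
  source_col := source_col
  sink_col := sink_col
  kind p := by
    rcases h p with k | k | k | k | k
    exacts [.inl k.1, .inr (.inl k.1), .inr (.inr (.inl k.1)), .inr (.inr (.inr (.inl k.1))),
      .inr (.inr (.inr (.inr k.1)))]
  univalentSource_col p := (h p).col.1
  univalentSink_col p := (h p).col.2.1
  split_col p := (h p).col.2.2.1
  merge_col p := (h p).col.2.2.2.1
  degenerate_col p := (h p).col.2.2.2.2

theorem acyclic_of_rank {P S : Type*} {init term : S → P} (rank : P → ℕ)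
    (h : ∀ s, rank (init s) < rank (term s)) (p : P) :
    ¬ Relation.TransGen (fun a b => ∃ s, init s = a ∧ term s = b) p p := by
  have key : ∀ a b, Relation.TransGen (fun a b => ∃ s, init s = a ∧ term s = b) a b →
      rank a < rank b := by
    intro a b hab
    induction hab with
    | single h' => obtain ⟨s, rfl, rfl⟩ := h'; exact h s
    | tail _ h' ih => obtain ⟨s, rfl, rfl⟩ := h'; exact ih.trans (h s)
  exact fun hp => lt_irrefl _ (key p p hp)

theorem exists_rank (A : StrandDiagram o x y) :
    ∃ rank : A.Point → ℕ, ∀ s, rank (A.init s) < rank (A.term s) := by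
  have := A.finite_point
  -- The rank counts the points strictly above `p`.
  refine ⟨fun p => {q | Relation.TransGen A.Adj q p}.ncard, fun s => ?_⟩
  refine Set.ncard_lt_ncard ⟨fun q hq => hq.tail ⟨s, rfl, rfl⟩, fun h => ?_⟩ (Set.toFinite _)
  exact A.acyclic _ (h (show A.init s ∈ _ from .single ⟨s, rfl, rfl⟩))

/-! ### Fans

In a fan every strand goes from a source directly to a sink. -/

/-- The strands originating from the `i`-th source terminate at the sinks in the list `L i`. -/
structure IsFan (o : EdgeOrder Γ) (x y : Tuple V) (par : Fin y.length → Fin x.length)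
    (L : Fin x.length → List (Fin y.length)) : Prop where
  fits : ∀ i, Fits o (L i) (x.get i) y.get
  ne_nil : ∀ i, L i ≠ []
  mem : ∀ i j, j ∈ L i ↔ par j = i

section Fan

variable {par : Fin y.length → Fin x.length} {L : Fin x.length → List (Fin y.length)}

/-- The graph underlying a fan. -/
def fanGraph (h : IsFan o x y par L) : StrandGraph V where
  Point := Fin x.length ⊕ Fin y.length
  Strand := Fin y.length
  finite_point := inferInstance
  finite_strand := inferInstance
  init j := .inl (par j)
  term := .inr
  pointCol := Sum.elim x.get y.get
  strandCol := y.get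
  ins := Sum.elim (fun _ => []) (fun j => [j])
  outs := Sum.elim L (fun _ => [])
  ins_nodup p := by rcases p with p | p <;> simp
  outs_nodup p := by
    rcases p with p | p
    · exact (h.fits p).nodup
    · simp
  mem_ins p s := by rcases p with p | p <;> simp [eq_comm]
  mem_outs p s := by rcases p with p | p <;> simp [h.mem]
  acyclic := acyclic_of_rank (Sum.elim (fun _ => 0) (fun _ => 1)) (by simp)

/-- The strand diagram of a fan. -/
noncomputable def fan (h : IsFan o x y par L) : StrandDiagram o x y :=
  ofLocalCondition (fanGraph h)
    (Equiv.ofBijective (fun i => ⟨.inl i, rfl⟩)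
      ⟨fun i j hij => Sum.inl_injective (congrArg Subtype.val hij), by
      rintro ⟨p | p, hp⟩
      · exact ⟨p, rfl⟩
      · exact absurd hp (List.cons_ne_nil _ _)⟩)
    (Equiv.ofBijective (fun i => ⟨.inr i, rfl⟩)
      ⟨fun i j hij => Sum.inr_injective (congrArg Subtype.val hij), by
      rintro ⟨p | p, hp⟩
      · exact absurd hp (h.ne_nil p)
      · exact ⟨p, rfl⟩⟩)
    (fun _ => rfl) (fun _ => rfl) (by
      rintro (i | j)
      · exact localCondition_of_fits ⟨List.nodup_nil, .inl rfl⟩ (h.fits i) (.inr (h.ne_nil i))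
          (.inl (by simp [fanGraph])) (by simp [fanGraph])
      · exact localCondition_of_fits ⟨List.nodup_singleton _, .inr (.inl ⟨j, rfl, rfl⟩)⟩
          ⟨List.nodup_nil, .inl rfl⟩ (.inl (List.cons_ne_nil _ _))
          (.inl (by simp [fanGraph])) (by simp [fanGraph]))

theorem fan_sem_of_branch (h : IsFan o x y par L) {a : Ray Γ x} {b : Ray Γ y}
    (hb : Branch o (L a.1.1) (x.get a.1.1) a.1.2 b.1.1 b.1.2) : (fan h).sem a = b := by
  rw [sem_eq_iff]
  exact .single ⟨b.1.1, b.1.2, hb, .inl ⟨rfl, rfl⟩⟩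

end Fan

end StrandDiagram

/-! ### Every piecewise-canonical bijection is defined by a strand diagram -/

theorem EdgeOrder.loop_of_out_eq (hΓ : Γ.NoRedundantEdges) (o : EdgeOrder Γ) {a : V} {e : E}
    (h : o.out a = [e]) : (∀ e', Γ.init e' = a → e' = e) ∧ Γ.init e = a ∧ Γ.term e = a := by
  have h1 : ∀ e', Γ.init e' = a → e' = e := fun e' he' => by
    have := (o.mem_out a e').2 he'
    rwa [h, List.mem_singleton] at this
  have h2 : Γ.init e = a := (o.mem_out a e).1 (by simp [h])
  exact ⟨h1, h2, (hΓ e fun e' he' => h1 e' (he'.trans h2)).trans h2⟩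

theorem EdgeOrder.out_ne_nil (hΓ : Γ.NoDeadEnds) (o : EdgeOrder Γ) (a : V) : o.out a ≠ [] := by
  obtain ⟨e, he⟩ := hΓ a
  exact List.ne_nil_of_mem ((o.mem_out a e).2 he)

namespace StrandDiagram

variable {o : EdgeOrder Γ} {x y z : Tuple V}

/-- The vertices of a tuple that are selected by `S` can be split. -/
theorem exists_isFan (hΓ₀ : Γ.NoDeadEnds) (hΓ₁ : Γ.NoRedundantEdges) (o : EdgeOrder Γ)
    (x : Tuple V) (S : Fin x.length → Prop) :
    ∃ (y : Tuple V) (par : Fin y.length → Fin x.length)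
      (L : Fin x.length → List (Fin y.length)), IsFan o x y par L ∧
      (∀ i, S i → (L i).map y.get = (o.out (x.get i)).map Γ.term) ∧
      (∀ i, ¬ S i → ∃ k, L i = [k]) := by
  classical
  -- The colors that replace the `i`-th vertex; the new tuple is the disjoint union of these lists,
  -- numbered by an arbitrary `e`.
  let cl : Fin x.length → List V := fun i =>
    if S i then (o.out (x.get i)).map Γ.term else [x.get i]
  let I : Type := Σ i, Fin (cl i).length
  let e : I ≃ Fin (Fintype.card I) := Fintype.equivFin I
  let y : Tuple V := ⟨Fintype.card I, fun k => (cl (e.symm k).1).get (e.symm k).2⟩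
  let L : Fin x.length → List (Fin y.length) := fun i =>
    (List.finRange (cl i).length).map fun k => e ⟨i, k⟩
  have hL : ∀ i, (L i).map y.get = cl i := by
    intro i
    have : y.get ∘ (fun k => e ⟨i, k⟩) = (cl i).get := by
      funext k
      change (fun p : I => (cl p.1).get p.2) (e.symm (e ⟨i, k⟩)) = _
      rw [e.symm_apply_apply]
    simp only [L, List.map_map, this]
    exact List.map_get_finRange _
  have hlen : ∀ i, (L i).length = (cl i).length := fun i => by simp [L]
  have hS : ∀ i, ¬ S i → ∃ k, L i = [k] := by
    intro i hi
    rw [← List.length_eq_one_iff, hlen]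
    simp [cl, hi]
  refine ⟨y, fun k => (e.symm k).1, L, ⟨fun i => ⟨?_, ?_⟩, fun i h => ?_, fun i j => ?_⟩,
    fun i hi => ?_, hS⟩
  · refine (List.nodup_finRange _).map fun k k' h => ?_
    exact eq_of_heq (Sigma.mk.inj (e.injective h)).2
  · right
    by_cases hi : S i
    · have h' : cl i = (o.out (x.get i)).map Γ.term := if_pos hi
      -- A selected vertex of out-degree one gives a single strand. This is admissible because its
      -- only edge is a loop, so the color of the strand is that of the vertex.
      rcases Nat.lt_or_ge (L i).length 2 with h2 | h2
      · have h3 : (o.out (x.get i)).length = (L i).length := by rw [hlen, h']; simp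
        have h4 := List.length_pos_iff.2 (o.out_ne_nil hΓ₀ (x.get i))
        obtain ⟨f, hf⟩ := List.length_eq_one_iff.1 (show (o.out (x.get i)).length = 1 by omega)
        obtain ⟨k, hk⟩ := List.length_eq_one_iff.1 (show (L i).length = 1 by omega)
        have h5 := hL i
        rw [h', hf, hk] at h5
        exact .inl ⟨k, hk, by simpa [(o.loop_of_out_eq hΓ₁ hf).2.2] using h5⟩
      · exact .inr ⟨h2, (hL i).trans h'⟩
    · obtain ⟨k, hk⟩ := hS i hi
      have h5 := hL i
      rw [hk, show cl i = [x.get i] from if_neg hi] at h5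
      exact .inl ⟨k, hk, by simpa using h5⟩
  · have h1 : cl i = [] := by rw [← hL, h]; rfl
    by_cases hi : S i
    · exact o.out_ne_nil hΓ₀ (x.get i) (by simpa [cl, hi] using h1)
    · simp [cl, hi] at h1
  · constructor
    · intro h
      obtain ⟨k, -, rfl⟩ := List.mem_map.1 h
      simp
    · rintro rfl
      exact List.mem_map.2 ⟨(e.symm j).2, List.mem_finRange _, by simp⟩
  · exact (hL i).trans (if_pos hi)

/-- The fan strips the first letter from the rays at the selected vertices and leaves the others
alone. The last clause traces each new vertex back, which is needed to transport depth through the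
inverse. -/
theorem exists_split (hΓ₀ : Γ.NoDeadEnds) (hΓ₁ : Γ.NoRedundantEdges) (o : EdgeOrder Γ)
    (x : Tuple V) (S : Fin x.length → Prop) :
    ∃ (y : Tuple V) (F : StrandDiagram o x y),
      (∀ i, S i → ∀ e, Γ.init e = x.get i → ∃ k, CanonicalAt F.sem i [e] k [] (Γ.term e)) ∧
      (∀ i, ¬ S i → ∃ k, CanonicalAt F.sem i [] k [] (x.get i)) ∧
      (∀ k, ∃ i, ¬ S i ∨ ∃ e, CanonicalAt F.sem i [e] k [] (y.get k)) := by
  obtain ⟨y, par, L, h, hS, hS'⟩ := exists_isFan hΓ₀ hΓ₁ o x S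
  have key : ∀ i, S i → ∀ k e, (k, e) ∈ (L i).zip (o.out (x.get i)) →
      CanonicalAt (fan h).sem i [e] k [] (Γ.term e) ∧ y.get k = Γ.term e := by
    intro i hi k e hke
    have hk := eq_of_mem_zip (hS i hi) hke
    have he := (o.mem_out _ _).1 (List.of_mem_zip hke).2
    refine ⟨⟨⟨he, rfl⟩, hk.symm, fun γ hγ a ha => ?_⟩, hk⟩
    let b : Ray Γ y := ⟨(k, γ), by rwa [hk]⟩
    have hb : (fan h).sem a = b := by
      refine fan_sem_of_branch h ?_
      rw [ha]
      rcases (h.fits i).cases with h' | ⟨k', h', -⟩ | ⟨h', -⟩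
      · exact absurd h' (h.ne_nil i)
      · have h1 : (o.out (x.get i)).length = 1 := by
          simpa [h'] using (congrArg List.length (hS i hi)).symm
        obtain ⟨e', he'⟩ := List.length_eq_one_iff.1 h1
        obtain ⟨h2, h3, h4⟩ := o.loop_of_out_eq hΓ₁ he'
        obtain rfl := h2 e he
        have h5 : k' = k := by simpa [h', he', eq_comm] using hke
        refine .inl ⟨by rw [h', h5], ?_⟩
        rw [h4] at hγ
        -- At a vertex of out-degree one the fan reads no letter, but stripping `e` makes no
        -- difference there, because the only ray satisfies `eγ = γ`.
        exact DirectedGraph.IsRay.eq_of_loop h2 (isRay_cons.2 ⟨h3, by rwa [h4]⟩) hγ h4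
      · exact .inr ⟨h', e, hke, rfl⟩
    rw [hb]
    rfl
  have hlen : ∀ i, S i → (L i).length = (o.out (x.get i)).length := fun i hi => by
    simpa using congrArg List.length (hS i hi)
  refine ⟨y, fan h, fun i hi e he => ?_, fun i hi => ?_, fun k => ⟨par k, ?_⟩⟩
  · obtain ⟨k, hk⟩ := exists_mem_zip_right (hlen i hi) ((o.mem_out _ _).2 he)
    exact ⟨k, (key i hi k e hk).1⟩
  · obtain ⟨k, hk⟩ := hS' i hi
    have hk' : y.get k = x.get i := by
      rcases (h.fits i).cases with h' | ⟨k', h', h''⟩ | ⟨h', -⟩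
      · simp [hk] at h'
      · rw [hk, List.singleton_inj] at h'
        rw [h', h'']
      · simp [hk] at h'
    refine ⟨k, rfl, hk'.symm, fun γ hγ a ha => ?_⟩
    have hb : (fan h).sem a = ⟨(k, γ), by rwa [hk']⟩ :=
      fan_sem_of_branch h (by rw [ha]; exact .inl ⟨hk, rfl⟩)
    rw [hb]
    rfl
  · by_cases hi : S (par k)
    · obtain ⟨e, he⟩ := exists_mem_zip_left (hlen _ hi) ((h.mem _ k).2 rfl)
      obtain ⟨h1, h2⟩ := key _ hi k e he
      exact .inr ⟨e, by rwa [h2]⟩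
    · exact .inl hi

/-- The target of the first cylinder lies inside that of the second, as `r'` is the prefix part of
the reversed word `r ++ r'`. A ray in the smaller target has preimages in both sources, and `f` is
injective. -/
theorem CanonicalAt.left_unique (hΓ₀ : Γ.NoDeadEnds) {f : Ray Γ x ≃ Ray Γ y} {i i' j w w' r r'}
    {c c' : V} (h : CanonicalAt f i w j (r ++ r') c) (h' : CanonicalAt f i' w' j r' c') :
    i = i' := by
  obtain ⟨γ, hγ⟩ := hΓ₀.exists_isRay c
  let a : Ray Γ x := ⟨(i, revAppend w γ), (isRay_revAppend h.left).2 hγ⟩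
  have ha := h.map γ hγ a rfl
  rw [revAppend_append] at ha
  have hr : Γ.IsRay c' (revAppend r γ) := by
    rw [← isRay_revAppend h'.right, ← revAppend_append]
    exact (isRay_revAppend h.right).2 hγ
  let a' : Ray Γ x := ⟨(i', revAppend w' (revAppend r γ)), (isRay_revAppend h'.left).2 hr⟩
  have ha' := h'.map _ hr a' rfl
  have : a = a' := f.injective (Subtype.ext (ha.trans ha'.symm))
  exact congrArg (fun a : Ray Γ x => a.1.1) this

theorem exists_sem_eq_of_permutation (hΓ₀ : Γ.NoDeadEnds) (o : EdgeOrder Γ)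
    (f : Ray Γ x ≃ Ray Γ y) (J : Fin x.length → Fin y.length)
    (hJ : ∀ i, CanonicalAt f i [] (J i) [] (x.get i)) : ∃ A : StrandDiagram o x y, A.sem = f := by
  have hb : Function.Bijective J := by
    refine ⟨fun i i' h => ?_, fun j => ?_⟩
    · have h' := hJ i'
      rw [← h] at h'
      exact CanonicalAt.left_unique (r := []) hΓ₀ (hJ i) h'
    · obtain ⟨γ, hγ⟩ := hΓ₀.exists_isRay (y.get j)
      obtain ⟨a, ha⟩ := f.surjective ⟨(j, γ), hγ⟩
      refine ⟨a.1.1, ?_⟩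
      have := (hJ a.1.1).map a.1.2 a.2 a rfl
      rw [ha] at this
      exact (congrArg Prod.fst this).symm
  let e := Equiv.ofBijective J hb
  have h : IsFan o x y e.symm (fun i => [J i]) :=
    ⟨fun i => ⟨List.nodup_singleton _, .inr (.inl ⟨_, rfl, (hJ i).right.symm⟩)⟩,
      fun i => List.cons_ne_nil _ _, fun i j => by
        rw [List.mem_singleton, Equiv.symm_apply_eq]; rfl⟩
  refine ⟨fan h, Equiv.ext fun a => fan_sem_of_branch h (.inl ⟨?_, ?_⟩)⟩
  · rw [(hJ a.1.1).map a.1.2 a.2 a rfl]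
  · rw [(hJ a.1.1).map a.1.2 a.2 a rfl]
    rfl

/-- Here the domain needs no further splitting. Splitting vertices of the range removes one letter
from each nonempty target word, until `f` merely permutes the entries; the diagrams of these
splittings are then attached upside down. -/
theorem exists_sem_eq_of_prefix (hΓ₀ : Γ.NoDeadEnds) (hΓ₁ : Γ.NoRedundantEdges) (o : EdgeOrder Γ)
    (M : ℕ) (f : Ray Γ x ≃ Ray Γ y)
    (h : ∀ i, ∃ j r, r.length ≤ M ∧ CanonicalAt f i [] j r (x.get i)) :
    ∃ A : StrandDiagram o x y, A.sem = f := by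
  induction M generalizing y with
  | zero =>
    choose J R hR hJ using h
    refine exists_sem_eq_of_permutation hΓ₀ o f J fun i => ?_
    have := hJ i
    rwa [List.length_eq_zero_iff.1 (Nat.le_zero.1 (hR i))] at this
  | succ M ih =>
    choose J R hR hJ using h
    -- The vertices `j` that are the full image of some `i`, with an empty target word, must stay
    -- unsplit.
    obtain ⟨y', F, h1, h2, -⟩ := exists_split hΓ₀ hΓ₁ o y fun j => ∀ i, ¬ (J i = j ∧ R i = [])
    obtain ⟨A, hA⟩ := ih (f.trans F.sem) fun i => by
      rcases List.eq_nil_or_concat (R i) with hr | ⟨r, e, hr⟩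
      · obtain ⟨k, hk⟩ := h2 (J i) fun h => h i ⟨rfl, hr⟩
        have h3 := hJ i
        rw [hr] at h3
        have h4 : x.get i = y.get (J i) := h3.right
        exact ⟨k, [], by simp, h3.trans (by rwa [h4])⟩
      · rw [List.concat_eq_append] at hr
        have h3 := hJ i
        have h3' := h3.right
        rw [hr, isRevPath_concat] at h3'
        -- If the vertex were also the full image of some `i'`, then `i = i'` by injectivity,
        -- although the target word of `i` is nonempty.
        obtain ⟨k, hk⟩ := h1 (J i) (fun i' hi' => by
          have h4 := hJ i'
          rw [hi'.1, hi'.2] at h4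
          have := CanonicalAt.left_unique (r := R i) hΓ₀ (by rwa [List.append_nil]) h4
          rw [← this, hr] at hi'
          simp at hi') e h3'.1
        refine ⟨k, r, ?_, ?_⟩
        · have := hR i
          rw [hr] at this
          simpa using this
        · rw [hr] at h3
          simpa using h3.trans (hk.extend h3'.2)
    refine ⟨A.glue F.flip, ?_⟩
    rw [sem_glue, sem_flip, hA]
    ext a
    simp

/-- Splitting every vertex of the domain uses up one letter of the input, so what remains to be done
has depth smaller by one. At depth zero only the target words are left to be shortened. -/
theorem exists_sem_eq (hΓ₀ : Γ.NoDeadEnds) (hΓ₁ : Γ.NoRedundantEdges) (o : EdgeOrder Γ) {N : ℕ}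
    {f : Ray Γ x ≃ Ray Γ y} (h : HasDepth f N) : ∃ A : StrandDiagram o x y, A.sem = f := by
  induction N generalizing x with
  | zero =>
    have h' : ∀ i, ∃ j r, CanonicalAt f i [] j r (x.get i) := fun i => h i [] _ rfl le_rfl
    choose J R hR using h'
    obtain ⟨M, hM⟩ := (Set.finite_range fun i => (R i).length).bddAbove
    exact exists_sem_eq_of_prefix hΓ₀ hΓ₁ o M f fun i => ⟨J i, R i, hM ⟨i, rfl⟩, hR i⟩
  | succ N ih =>
    obtain ⟨x', F, -, -, h1⟩ := exists_split hΓ₀ hΓ₁ o x fun _ => True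
    obtain ⟨A, hA⟩ := ih (f := F.sem.symm.trans f) fun k w c hw hl => by
      obtain ⟨i, hi | ⟨e, he⟩⟩ := h1 k
      · exact absurd trivial hi
      · have h2 := he.symm.extend hw
        obtain ⟨j, r, hj⟩ := h i (w ++ [e]) c h2.right (by simpa using hl)
        rw [List.append_nil] at h2
        exact ⟨j, r, h2.trans hj⟩
    refine ⟨F.glue A, ?_⟩
    rw [sem_glue, hA]
    ext a
    simp

end StrandDiagram

namespace StrandDiagram

variable {o : EdgeOrder Γ} {x y z : Tuple V}

/-! ### Equivalence and turning upside down -/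

section Flip

variable {A B : StrandDiagram o x y}

theorem Isomorphic.flip (h : Isomorphic A B) : Isomorphic A.flip B.flip := by
  obtain ⟨P, S, h1, h2, h3, h4, h5, h6, h7, h8⟩ := h
  exact ⟨P, S, h2, h1, h3, h4, h6, h5, h8, h7⟩

theorem DeletesPoints.flip {P : B.Point → A.Point} {D : Set A.Point}
    (h : DeletesPoints A B P D) : DeletesPoints A.flip B.flip P D :=
  ⟨h.injective, h.range_eq, h.pointCol, h.sink, h.source⟩

theorem Reduction0.flip (h : Reduction0 A B) : Reduction0 A.flip B.flip := by
  obtain ⟨v, s₁, s₂, P, σ, hv, hv', hD, hσ, hσ', hc, hi, ho⟩ := h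
  refine ⟨v, s₂, s₁, P, σ, hv', hv, hD.flip, hσ, fun s s' => (hσ' s s').trans ?_, hc, ho, hi⟩
  exact or_congr_right (and_congr or_comm or_comm)

theorem Reduction1.flip (h : Reduction1 A B) : Reduction1 A.flip B.flip := by
  obtain ⟨v, w, P, σ, hs, hm, hc, hl, hD, hσ, hσ', hc1, hc2, hio, hv, hw⟩ := h
  refine ⟨w, v, P, σ, hm, hs, hc.symm, hl.symm, ?_, hσ, fun s s' => (hσ' s s').trans ?_,
    fun s hs => ?_, fun s hs => ?_, fun q h1 h2 => (hio q h2 h1).symm, fun q hq => ?_,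
    fun q hq => ?_⟩
  · have key : ∀ D, D = {p | (p = v ∧ ¬ A.IsSource v) ∨ (p = w ∧ ¬ A.IsSink w)} →
        DeletesPoints A.flip B.flip P D := by
      rintro _ rfl
      exact hD.flip
    exact key _ (Set.ext fun p => or_comm)
  · have key : ∀ s : A.Strand, (s ∈ A.ins v ∨ s ∈ A.outs v ∨ s ∈ A.outs w) ↔
        (s ∈ A.outs w ∨ s ∈ A.ins w ∨ s ∈ A.ins v) := fun s => by
      rw [← hl]
      tauto
    exact or_congr_right (and_congr (key s) (key s'))
  · exact hc1 s (by rw [hl]; exact hs)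
  · exact (hc2 s (by rw [hl]; exact hs)).trans hc
  · exact ⟨(hw q hq).2, fun s hs => (hw q hq).1 s (by rw [hl]; exact hs)⟩
  · exact ⟨fun s hs => (hv q hq).2 s (by rw [hl]; exact hs), (hv q hq).1⟩

theorem Reduction2.flip (h : Reduction2 A B) : Reduction2 A.flip B.flip := by
  obtain ⟨v, w, s, P, σ, hm, hs, hvw, hv, hw, hD, hσ, hσ', hc, hi, ho⟩ := h
  refine ⟨w, v, s, P, σ, hs, hm, hvw.symm, hw, hv, ?_, hσ,
    fun r r' hr hr' => (hσ' r r' hr hr').trans ?_, hc, ho, hi⟩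
  · have key : ∀ D, D = {v, w} → DeletesPoints A.flip B.flip P D := by
      rintro _ rfl
      exact hD.flip
    exact key _ (Set.pair_comm w v)
  · exact or_congr_right (or_comm.trans (or_congr mem_zip_comm mem_zip_comm))

theorem equiv_flip (h : setoid o x y A B) : setoid o y x A.flip B.flip := by
  induction h with
  | rel A B h =>
    refine .rel _ _ ?_
    rcases h with h | h | h | h
    exacts [.inl h.flip, .inr (.inl h.flip), .inr (.inr (.inl h.flip)),
      .inr (.inr (.inr h.flip))]
  | refl => exact .refl _
  | symm _ _ _ ih => exact .symm _ _ ih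
  | trans _ _ _ _ _ h1 h2 => exact .trans _ _ _ h1 h2

end Flip

/-! ### Short-circuiting strands

Some internal points are removed, together with all strands originating from them. -/

theorem ne_of_transGen {A : StrandDiagram o x y} {p q : A.Point}
    (h : Relation.TransGen A.Adj p q) : p ≠ q := by
  rintro rfl
  exact A.acyclic _ h

theorem adj_of_mem_outs {A : StrandDiagram o x y} {p : A.Point} {s : A.Strand} (h : s ∈ A.outs p) :
    A.Adj p (A.term s) := ⟨s, (A.mem_outs _ _).1 h, rfl⟩

theorem adj_of_mem_ins {A : StrandDiagram o x y} {p : A.Point} {s : A.Strand} (h : s ∈ A.ins p) :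
    A.Adj (A.init s) p := ⟨s, rfl, (A.mem_ins _ _).1 h⟩

/-- The valence conditions at a point of a strand diagram. -/
theorem valence (A : StrandDiagram o x y) (p : A.Point) :
    (A.ins p ≠ [] ∨ A.outs p ≠ []) ∧ ((A.ins p).length ≤ 1 ∨ (A.outs p).length ≤ 1) ∧
    ((A.ins p).length = 1 → (A.outs p).length = 1 →
      ∃ e, o.out (A.pointCol p) = [e] ∧ Γ.term e = A.pointCol p) := by
  refine ⟨?_, ?_, fun h1 h2 => (A.degenerate_col p ⟨h1, h2⟩).2.2⟩
  · by_contra! h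
    exact not_isSource_and_isSink p h.1 h.2
  · rcases A.kind p with k | k | k | k | k
    · exact .inl (by simp [show A.ins p = [] from k.1])
    · exact .inr (by simp [show A.outs p = [] from k.1])
    · exact .inl k.1
    · exact .inr k.1
    · exact .inl k.1.le

/-- The points in `D` can be removed, if a strand `s` that does not terminate in `D` is replaced
by `σ s`. -/
structure IsShortcut (A : StrandDiagram o x y) (D : Set A.Point) (σ : A.Strand → A.Strand) :
    Prop where
  not_source : ∀ p ∈ D, ¬ A.IsSource p
  not_sink : ∀ p ∈ D, ¬ A.IsSink p
  kept : ∀ s, A.init (σ s) ∉ D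
  eq_self : ∀ s, A.init s ∉ D → σ s = s
  inj : ∀ s s', A.term s ∉ D → A.term s' ∉ D → σ s = σ s' → s = s'
  surj : ∀ t, A.init t ∉ D → ∃ s, A.term s ∉ D ∧ σ s = t
  col : ∀ s, A.term s ∉ D → A.strandCol (σ s) = A.strandCol s
  walk : ∀ s, A.term s ∉ D → Relation.ReflTransGen A.Adj (A.init (σ s)) (A.init s)

section Shortcut

variable {A : StrandDiagram o x y} {D : Set A.Point} {σ : A.Strand → A.Strand}

theorem IsShortcut.eq_choose (h : IsShortcut A D σ) {s : A.Strand} (hs : A.term s ∉ D) :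
    (h.surj (σ s) (h.kept s)).choose = s := by
  have := (h.surj (σ s) (h.kept s)).choose_spec
  exact h.inj _ _ this.1 hs this.2

/-- The graph obtained by removing the points in `D`. -/
noncomputable def shortcutGraph (h : IsShortcut A D σ) : StrandGraph V where
  Point := {p // p ∉ D}
  Strand := {s // A.init s ∉ D}
  finite_point := by
    have := A.finite_point
    infer_instance
  finite_strand := by
    have := A.finite_strand
    infer_instance
  init s := ⟨A.init s, s.2⟩
  -- A remaining strand ends where the unique strand rerouted onto it used to end.
  term s := ⟨A.term (h.surj s s.2).choose, (h.surj s s.2).choose_spec.1⟩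
  pointCol p := A.pointCol p
  strandCol s := A.strandCol s
  ins p := (A.ins p).map fun s => ⟨σ s, h.kept s⟩
  outs p := (A.outs p).map fun s => ⟨σ s, h.kept s⟩
  ins_nodup p := (A.ins_nodup p).map_on fun s hs s' hs' he => by
    refine h.inj s s' ?_ ?_ (congrArg Subtype.val he)
    · rw [(A.mem_ins _ _).1 hs]; exact p.2
    · rw [(A.mem_ins _ _).1 hs']; exact p.2
  outs_nodup p := (A.outs_nodup p).map_on fun s hs s' hs' he => by
    have he' : σ s = σ s' := congrArg Subtype.val he
    rwa [h.eq_self s (by rw [(A.mem_outs _ _).1 hs]; exact p.2),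
      h.eq_self s' (by rw [(A.mem_outs _ _).1 hs']; exact p.2)] at he'
  mem_ins p t := by
    rw [List.mem_map]
    constructor
    · rintro ⟨s, hs, rfl⟩
      have hs' := (A.mem_ins _ _).1 hs
      refine Subtype.ext ?_
      dsimp only
      rw [h.eq_choose (by rw [hs']; exact p.2), hs']
    · rintro rfl
      refine ⟨(h.surj t t.2).choose, (A.mem_ins _ _).2 rfl,
        Subtype.ext (h.surj t t.2).choose_spec.2⟩
  mem_outs p t := by
    rw [List.mem_map]
    constructor
    · rintro ⟨s, hs, rfl⟩
      have hs' := (A.mem_outs _ _).1 hs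
      refine Subtype.ext ?_
      dsimp only
      rw [h.eq_self s (by rw [hs']; exact p.2), hs']
    · rintro rfl
      exact ⟨t, (A.mem_outs _ _).2 rfl, Subtype.ext (h.eq_self _ t.2)⟩
  -- A strand is rerouted onto one that starts at the same point or higher up, so a rank for `A`
  -- still increases along all strands.
  acyclic := by
    obtain ⟨rank, hr⟩ := A.exists_rank
    have hr' : ∀ p q, Relation.ReflTransGen A.Adj p q → rank p ≤ rank q := by
      intro p q hpq
      induction hpq with
      | refl => rfl
      | tail _ h ih => obtain ⟨s, rfl, rfl⟩ := h; exact ih.trans (hr s).le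
    refine acyclic_of_rank (fun p => rank p) fun t => ?_
    obtain ⟨h1, h2⟩ := (h.surj t t.2).choose_spec
    have h3 := h.walk _ h1
    rw [h2] at h3
    exact (hr' _ _ h3).trans_lt (hr _)

/-- A reduction at internal points removes points whose lower strands are continued by upper ones;
the three types differ only in the rerouting `σ`, and the output has the shape in which reductions
are stated. -/
theorem exists_shortcut (h : IsShortcut A D σ) :
    ∃ (B : StrandDiagram o x y) (P : B.Point → A.Point) (τ : A.Strand → B.Strand),
      DeletesPoints A B P D ∧ Function.Surjective τ ∧ (∀ s s', τ s = τ s' ↔ σ s = σ s') ∧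
      (∀ s, B.strandCol (τ s) = A.strandCol (σ s)) ∧
      (∀ q, B.ins q = (A.ins (P q)).map τ) ∧ (∀ q, B.outs q = (A.outs (P q)).map τ) := by
  let τ : A.Strand → (shortcutGraph h).Strand := fun s => ⟨σ s, h.kept s⟩
  have hsource : ∀ p, A.IsSource p → p ∉ D := fun p hp hD => h.not_source p hD hp
  have hsink : ∀ p, A.IsSink p → p ∉ D := fun p hp hD => h.not_sink p hD hp
  let B : StrandDiagram o x y := ofLocalCondition (shortcutGraph h)
    (A.source.trans (Equiv.ofBijective
      (fun p => ⟨⟨p.1, hsource p.1 p.2⟩, List.map_eq_nil_iff.2 p.2⟩)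
      ⟨fun p p' hp => Subtype.ext (congrArg (fun q => q.1.1) hp),
        fun p => ⟨⟨p.1.1, List.map_eq_nil_iff.1 p.2⟩, rfl⟩⟩))
    (A.sink.trans (Equiv.ofBijective
      (fun p => ⟨⟨p.1, hsink p.1 p.2⟩, List.map_eq_nil_iff.2 p.2⟩)
      ⟨fun p p' hp => Subtype.ext (congrArg (fun q => q.1.1) hp),
        fun p => ⟨⟨p.1.1, List.map_eq_nil_iff.1 p.2⟩, rfl⟩⟩))
    A.source_col A.sink_col (fun p => by
      obtain ⟨h0, h1, h2⟩ := A.valence p.1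
      refine localCondition_of_fits ((A.fits_ins p.1).map ?_ ?_) ((A.fits_outs p.1).map ?_ ?_)
        ?_ ?_ ?_
      · intro s hs s' hs' he
        refine h.inj s s' ?_ ?_ (congrArg Subtype.val he)
        · rw [(A.mem_ins _ _).1 hs]; exact p.2
        · rw [(A.mem_ins _ _).1 hs']; exact p.2
      · intro s hs
        exact h.col s (by rw [(A.mem_ins _ _).1 hs]; exact p.2)
      · intro s hs s' hs' he
        have he' : σ s = σ s' := congrArg Subtype.val he
        rwa [h.eq_self s (by rw [(A.mem_outs _ _).1 hs]; exact p.2),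
          h.eq_self s' (by rw [(A.mem_outs _ _).1 hs']; exact p.2)] at he'
      · intro s hs
        exact congrArg A.strandCol (h.eq_self s (by rw [(A.mem_outs _ _).1 hs]; exact p.2))
      · exact h0.imp (fun h => mt List.map_eq_nil_iff.1 h) (fun h => mt List.map_eq_nil_iff.1 h)
      · simpa [shortcutGraph] using h1
      · simpa [shortcutGraph] using h2)
  refine ⟨B, Subtype.val, τ, ⟨Subtype.val_injective, ?_, fun _ => rfl, fun _ => rfl,
    fun _ => rfl⟩, fun t => ⟨t.1, Subtype.ext (h.eq_self _ t.2)⟩, fun s s' => Subtype.ext_iff,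
    fun _ => rfl, fun _ => rfl, fun _ => rfl⟩
  exact Subtype.range_coe

end Shortcut

/-! ### Reductions can be carried out -/

section Exists

variable {A : StrandDiagram o x y}

/-- The diagram `B` has fewer points than `A`, and if the sources and the sinks of `A` are
univalent, then so are those of `B`. -/
structure IsSmaller (B A : StrandDiagram o x y) : Prop where
  card_lt : Nat.card B.Point < Nat.card A.Point
  source : (∀ i, A.IsUnivalentSource (A.source i)) → ∀ i, B.IsUnivalentSource (B.source i)
  sink : (∀ i, A.IsUnivalentSink (A.sink i)) → ∀ i, B.IsUnivalentSink (B.sink i)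

theorem DeletesPoints.isSmaller {B : StrandDiagram o x y} {P : B.Point → A.Point}
    {D : Set A.Point} (h : DeletesPoints A B P D) (hD : D.Nonempty) {τ : A.Strand → B.Strand}
    (hi : ∀ q, B.ins q = (A.ins (P q)).map τ) (ho : ∀ q, B.outs q = (A.outs (P q)).map τ) :
    IsSmaller B A := by
  have := A.finite_point
  have := B.finite_point
  refine ⟨?_, fun hA i => ⟨(B.source i).2, ?_⟩, fun hA i => ⟨(B.sink i).2, ?_⟩⟩
  · have := Fintype.ofFinite A.Point
    have := Fintype.ofFinite B.Point
    rw [Nat.card_eq_fintype_card, Nat.card_eq_fintype_card]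
    refine Fintype.card_lt_of_injective_not_surjective P h.injective fun hs => ?_
    obtain ⟨p, hp⟩ := hD
    have : p ∈ Set.range P := hs p
    rw [h.range_eq] at this
    exact this hp
  · rw [ho, List.length_map, h.source]
    exact (hA i).2
  · rw [hi, List.length_map, h.sink]
    exact (hA i).2

open Classical in
theorem exists_reduction0 {v : A.Point} (hv : A.IsDegenerate v) :
    ∃ B, Reduction0 A B ∧ IsSmaller B A := by
  obtain ⟨s₁, h1⟩ := List.length_eq_one_iff.1 hv.1
  obtain ⟨s₂, h2⟩ := List.length_eq_one_iff.1 hv.2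
  have m1 : s₁ ∈ A.ins v := by simp [h1]
  have m2 : s₂ ∈ A.outs v := by simp [h2]
  have t1 := (A.mem_ins _ _).1 m1
  have t2 := (A.mem_outs _ _).1 m2
  have i1 : A.init s₁ ≠ v := ne_of_transGen (.single (adj_of_mem_ins m1))
  have i2 : A.term s₂ ≠ v := (ne_of_transGen (.single (adj_of_mem_outs m2))).symm
  have e1 : ∀ s, A.term s = v → s = s₁ := fun s hs => by
    have := (A.mem_ins _ _).2 hs; simpa [h1] using this
  have e2 : ∀ s, A.init s = v → s = s₂ := fun s hs => by
    have := (A.mem_outs _ _).2 hs; simpa [h2] using this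
  obtain ⟨c1, c2, -⟩ := A.degenerate_col v hv
  have hcol : A.strandCol s₁ = A.strandCol s₂ := (c1 _ m1).trans (c2 _ m2).symm
  -- The lower strand `s₂` starts at the removed point, so the joined strand is represented by `s₁`.
  let σ : A.Strand → A.Strand := fun s => if s = s₂ then s₁ else s
  have σ1 : σ s₂ = s₁ := if_pos rfl
  have σ2 : ∀ s, s ≠ s₂ → σ s = s := fun s hs => if_neg hs
  have h : IsShortcut A {v} σ := by
    refine ⟨?_, ?_, fun s => ?_, fun s hs => ?_, fun s s' hs hs' he => ?_, fun t ht => ?_,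
      fun s hs => ?_, fun s hs => ?_⟩
    · rintro _ rfl h; simp [h1, StrandGraph.IsSource] at h
    · rintro _ rfl h; simp [h2, StrandGraph.IsSink] at h
    · by_cases hs : s = s₂
      · subst hs; rwa [σ1]
      · rw [σ2 s hs]; exact fun h => hs (e2 s h)
    · refine σ2 s ?_
      rintro rfl
      exact hs t2
    · by_cases a : s = s₂ <;> by_cases b : s' = s₂
      · rw [a, b]
      · rw [a, σ1, σ2 s' b] at he; exact absurd (he ▸ t1) hs'
      · rw [b, σ1, σ2 s a] at he; exact absurd (he ▸ t1) hs
      · rwa [σ2 s a, σ2 s' b] at he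
    · by_cases a : t = s₁
      · exact ⟨s₂, i2, σ1.trans a.symm⟩
      · exact ⟨t, fun h => a (e1 t h), σ2 t (by rintro rfl; exact ht t2)⟩
    · by_cases a : s = s₂
      · rw [a, σ1, hcol]
      · rw [σ2 s a]
    · by_cases a : s = s₂
      · rw [a, σ1, t2]; exact .single (adj_of_mem_ins m1)
      · rw [σ2 s a]
  obtain ⟨B, P, τ, hD, hτ, hτ', hc, hi, ho⟩ := exists_shortcut h
  refine ⟨B, ⟨v, s₁, s₂, P, τ, h1, h2, hD, hτ, fun s s' => ?_, fun s => ?_, hi, ho⟩,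
    hD.isSmaller ⟨v, rfl⟩ hi ho⟩
  · rw [hτ']
    by_cases a : s = s₂ <;> by_cases b : s' = s₂
    · simp [a, b]
    · rw [a, σ1, σ2 s' b]
      simp [b, eq_comm]
      tauto
    · rw [b, σ1, σ2 s a]
      simp [a]
    · rw [σ2 s a, σ2 s' b]
      simp only [a, b, or_false]
      constructor
      · exact .inl
      · rintro (h | ⟨rfl, rfl⟩)
        exacts [h, rfl]
  · rw [hc]
    by_cases a : s = s₂
    · rw [a, σ1, hcol]
    · rw [σ2 s a]

open Classical in
theorem exists_reduction1 {v w : A.Point} (hv : A.IsSplit v) (hw : A.IsMerge w)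
    (hvs : ¬ A.IsSource v) (hws : ¬ A.IsSink w) (hvw : A.pointCol v = A.pointCol w)
    (hl : A.outs v = A.ins w) : ∃ B, Reduction1 A B ∧ IsSmaller B A := by
  obtain ⟨s₁, h1⟩ := List.length_eq_one_iff.1 (le_antisymm hv.1 (List.length_pos_iff.2 hvs))
  obtain ⟨s₂, h2⟩ := List.length_eq_one_iff.1 (le_antisymm hw.1 (List.length_pos_iff.2 hws))
  obtain ⟨s₀, m0⟩ := List.exists_mem_of_length_pos (by have := hv.2; omega : 0 < (A.outs v).length)
  have m1 : s₁ ∈ A.ins v := by simp [h1]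
  have m2 : s₂ ∈ A.outs w := by simp [h2]
  have t1 := (A.mem_ins _ _).1 m1
  have t2 := (A.mem_outs _ _).1 m2
  have a1 : A.Adj (A.init s₁) v := adj_of_mem_ins m1
  have a0 : A.Adj v w := by
    have := adj_of_mem_outs m0
    rw [hl] at m0
    rwa [(A.mem_ins _ _).1 m0] at this
  have a2 : A.Adj w (A.term s₂) := adj_of_mem_outs m2
  have i1 : A.init s₁ ∉ ({v, w} : Set A.Point) := by
    rintro (h | h)
    · exact ne_of_transGen (.single a1) h
    · exact ne_of_transGen (.tail (.single a1) a0) h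
  have i2 : A.term s₂ ∉ ({v, w} : Set A.Point) := by
    rintro (h | h)
    · exact ne_of_transGen (.tail (.single a0) a2) h.symm
    · exact ne_of_transGen (.single a2) h.symm
  -- The strands that start at a removed point. All of them are absorbed into `s₁`, and only `s₂`
  -- among them ends at a remaining point.
  let K : Set A.Strand := {s | s ∈ A.outs v ∨ s ∈ A.outs w}
  have hK : ∀ s, s ∈ K ↔ A.init s ∈ ({v, w} : Set A.Point) := fun s => by
    simp [K, A.mem_outs]
  have hterm : ∀ t, t ≠ s₁ → t ∉ K → A.term t ∉ ({v, w} : Set A.Point) := by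
    rintro t h h' (h3 | h3)
    · have := (A.mem_ins _ _).2 h3
      rw [h1, List.mem_singleton] at this
      exact h this
    · have := (A.mem_ins _ _).2 h3
      rw [← hl] at this
      exact h' (.inl this)
  have hKs : ∀ s, s ∈ K → A.term s ∉ ({v, w} : Set A.Point) → s = s₂ := by
    rintro s (h | h) h'
    · rw [hl, A.mem_ins] at h
      exact absurd (.inr h) h'
    · simpa [h2] using h
  have hK2 : s₂ ∈ K := .inr m2
  have hne1 : s₁ ∉ K := fun h => i1 ((hK _).1 h)
  have hs1 : ∀ s, A.term s ∉ ({v, w} : Set A.Point) → s ≠ s₁ := by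
    rintro s hs rfl
    exact hs (.inl t1)
  have hcol1 : A.strandCol s₁ = A.pointCol v := (A.split_col v hv).2 _ m1
  have hcol2 : A.strandCol s₂ = A.pointCol v := ((A.merge_col w hw).2 _ m2).trans hvw.symm
  let σ : A.Strand → A.Strand := fun s => if s ∈ K then s₁ else s
  have σ1 : ∀ s, s ∈ K → σ s = s₁ := fun s hs => if_pos hs
  have σ2 : ∀ s, s ∉ K → σ s = s := fun s hs => if_neg hs
  have h : IsShortcut A {v, w} σ := by
    refine ⟨?_, ?_, fun s => ?_, fun s hs => σ2 s (mt (hK s).1 hs), fun s s' hs hs' he => ?_,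
      fun t ht => ?_, fun s hs => ?_, fun s hs => ?_⟩
    · rintro _ (rfl | rfl) h
      · exact hvs h
      · have := hw.2
        rw [show A.ins _ = [] from h] at this
        simp at this
    · rintro _ (rfl | rfl) h
      · have := hv.2
        rw [show A.outs _ = [] from h] at this
        simp at this
      · exact hws h
    · by_cases hs : s ∈ K
      · rwa [σ1 s hs]
      · rw [σ2 s hs]; exact mt (hK s).2 hs
    · by_cases a : s ∈ K <;> by_cases b : s' ∈ K
      · rw [hKs s a hs, hKs s' b hs']
      · rw [σ1 s a, σ2 s' b] at he; exact absurd he.symm (hs1 s' hs')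
      · rw [σ2 s a, σ1 s' b] at he; exact absurd he (hs1 s hs)
      · rwa [σ2 s a, σ2 s' b] at he
    · have ht' := mt (hK t).1 ht
      by_cases a : t = s₁
      · exact ⟨s₂, i2, (σ1 _ hK2).trans a.symm⟩
      · exact ⟨t, hterm t a ht', σ2 t ht'⟩
    · by_cases a : s ∈ K
      · rw [σ1 s a, hKs s a hs, hcol1, hcol2]
      · rw [σ2 s a]
    · by_cases a : s ∈ K
      · rw [σ1 s a, hKs s a hs, t2]; exact .tail (.single a1) a0
      · rw [σ2 s a]
  obtain ⟨B, P, τ, hD, hτ, hτ', hc, hi, ho⟩ := exists_shortcut h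
  have hP : ∀ q, P q ≠ v ∧ P q ≠ w := fun q => by
    have : P q ∈ Set.range P := ⟨q, rfl⟩
    rw [hD.range_eq] at this
    simpa using this
  refine ⟨B, ⟨v, w, P, τ, hv, hw, hvw, hl, ?_, hτ, fun s s' => ?_, fun s hs => ?_,
    fun s hs => ?_, fun q _ _ => ⟨hi q, ho q⟩, fun q hq => absurd hq (hP q).1,
    fun q hq => absurd hq (hP q).2⟩, hD.isSmaller ⟨v, .inl rfl⟩ hi ho⟩
  · convert hD using 1
    ext p
    constructor
    · rintro (h | h)
      exacts [.inl h.1, .inr h.1]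
    · rintro (rfl | rfl)
      exacts [.inl ⟨rfl, hvs⟩, .inr ⟨rfl, hws⟩]
  · have hmem : ∀ s, (s ∈ A.ins v ∨ s ∈ A.outs v ∨ s ∈ A.outs w) ↔ (s = s₁ ∨ s ∈ K) := fun s => by
      simp [K, h1]
    rw [hτ', hmem, hmem]
    by_cases a : s ∈ K <;> by_cases b : s' ∈ K
    · simp [σ1, a, b]
    · rw [σ1 s a, σ2 s' b]
      have : s ≠ s' := fun h => b (h ▸ a)
      simp [a, b, this, eq_comm]
    · rw [σ2 s a, σ1 s' b]
      have : s ≠ s' := fun h => a (h ▸ b)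
      simp [a, b, this]
    · rw [σ2 s a, σ2 s' b]
      simp only [a, b, or_false]
      constructor
      · exact .inl
      · rintro (h | ⟨rfl, rfl⟩)
        exacts [h, rfl]
  · rw [hc]
    by_cases a : s ∈ K
    · have : s = s₂ := by
        rcases a with a | a
        · exact absurd a hs
        · simpa [h2] using a
      rw [σ1 s a, this, hcol1, hcol2]
    · rw [σ2 s a]
  · rw [hc, σ1 s (.inl hs), hcol1]

-- The common strand of the merge and the split carries the color of both, so their colors agree
-- without being assumed, and the incoming and outgoing lists can be paired.
open Classical in
theorem exists_reduction2 {s : A.Strand} (hv : A.IsMerge (A.init s)) (hw : A.IsSplit (A.term s)) :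
    ∃ B, Reduction2 A B ∧ IsSmaller B A := by
  obtain ⟨v, hv'⟩ : ∃ v, A.init s = v := ⟨_, rfl⟩
  obtain ⟨w, hw'⟩ : ∃ w, A.term s = w := ⟨_, rfl⟩
  rw [hv'] at hv
  rw [hw'] at hw
  have ms1 := (A.mem_outs _ _).2 hv'
  have ms2 := (A.mem_ins _ _).2 hw'
  have h1 : A.outs v = [s] := by
    obtain ⟨t, ht⟩ := List.length_eq_one_iff.1 (le_antisymm hv.1 (List.length_pos_of_mem ms1))
    rw [ht] at ms1 ⊢
    rw [List.mem_singleton.1 ms1]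
  have h2 : A.ins w = [s] := by
    obtain ⟨t, ht⟩ := List.length_eq_one_iff.1 (le_antisymm hw.1 (List.length_pos_of_mem ms2))
    rw [ht] at ms2 ⊢
    rw [List.mem_singleton.1 ms2]
  have hvw : A.pointCol v = A.pointCol w :=
    ((A.merge_col v hv).2 s ms1).symm.trans ((A.split_col w hw).2 s ms2)
  have hlen : (A.ins v).length = (A.outs w).length := by
    rw [(A.fits_ins v).length_eq hv.2, (A.fits_outs w).length_eq hw.2, hvw]
  have a0 : A.Adj v w := ⟨s, hv', hw'⟩
  have i1 : ∀ r ∈ A.ins v, A.init r ∉ ({v, w} : Set A.Point) := by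
    rintro r hr (h | h)
    · exact ne_of_transGen (.single (adj_of_mem_ins hr)) h
    · exact ne_of_transGen (.tail (.single (adj_of_mem_ins hr)) a0) h
  have i2 : ∀ r ∈ A.outs w, A.term r ∉ ({v, w} : Set A.Point) := by
    rintro r hr (h | h)
    · exact ne_of_transGen (.tail (.single a0) (adj_of_mem_outs hr)) h.symm
    · exact ne_of_transGen (.single (adj_of_mem_outs hr)) h.symm
  have hterm : ∀ r, A.term r ∈ ({v, w} : Set A.Point) ↔ r ∈ A.ins v ∨ r = s := fun r => by
    have : r = s ↔ r ∈ A.ins w := by simp [h2]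
    rw [this, A.mem_ins, A.mem_ins]; rfl
  have hinit : ∀ r, A.init r ∈ ({v, w} : Set A.Point) ↔ r = s ∨ r ∈ A.outs w := fun r => by
    have : r = s ↔ r ∈ A.outs v := by simp [h1]
    rw [this, A.mem_outs, A.mem_outs]; rfl
  obtain ⟨r₀, hr₀⟩ := List.exists_mem_of_length_pos
    (by have := hv.2; omega : 0 < (A.ins v).length)
  have hzip : ∀ r ∈ A.outs w, ∃ r', (r', r) ∈ (A.ins v).zip (A.outs w) :=
    fun r hr => exists_mem_zip_right hlen hr
  have hs1 : s ∉ A.ins v := fun h => i1 s h (.inl hv')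
  have hs2 : s ∉ A.outs w := fun h => i2 s h (.inr hw')
  -- A strand below the split is represented by its partner above the merge. The value `r₀` at `s`
  -- is a dummy; it only has to start at a remaining point.
  let σ : A.Strand → A.Strand := fun r =>
    if h : r ∈ A.outs w then (hzip r h).choose else if r = s then r₀ else r
  have σ1 : ∀ {r} r', (r', r) ∈ (A.ins v).zip (A.outs w) → σ r = r' := fun {r} r' h => by
    have hr := (List.of_mem_zip h).2
    have := (hzip r hr).choose_spec
    simp only [σ, dif_pos hr]
    exact mem_zip_fst_unique (A.outs_nodup w) this h
  have σ2 : ∀ r, r ∉ A.outs w → r ≠ s → σ r = r := fun r h h' => by simp [σ, h, h']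
  have σ3 : σ s = r₀ := by simp [σ, hs2]
  have hcol : ∀ r r', (r', r) ∈ (A.ins v).zip (A.outs w) → A.strandCol r' = A.strandCol r :=
    fun r r' h => eq_of_mem_zip (((A.fits_ins v).map_eq hv.2).trans
      (by rw [(A.fits_outs w).map_eq hw.2, hvw])) h
  have h : IsShortcut A {v, w} σ := by
    refine ⟨?_, ?_, fun r => ?_, fun r hr => ?_, fun r r' hr hr' he => ?_,
      fun t ht => ?_, fun r hr => ?_, fun r hr => ?_⟩
    · rintro _ (rfl | rfl) h
      · have := hv.2
        rw [show A.ins _ = [] from h] at this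
        simp at this
      · simp [StrandGraph.IsSource, h2] at h
    · rintro _ (rfl | rfl) h
      · simp [StrandGraph.IsSink, h1] at h
      · have := hw.2
        rw [show A.outs _ = [] from h] at this
        simp at this
    · by_cases hr : r ∈ A.outs w
      · obtain ⟨r', h⟩ := hzip r hr
        rw [σ1 r' h]
        exact i1 _ (List.of_mem_zip h).1
      · by_cases hr' : r = s
        · rw [hr', σ3]
          exact i1 _ hr₀
        · rw [σ2 r hr hr', hinit]
          tauto
    · rw [hinit] at hr
      exact σ2 r (by tauto) (by tauto)
    · rw [hterm] at hr hr'
      by_cases a : r ∈ A.outs w <;> by_cases b : r' ∈ A.outs w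
      · obtain ⟨t, ht⟩ := hzip r a
        obtain ⟨t', ht'⟩ := hzip r' b
        rw [σ1 t ht, σ1 t' ht'] at he
        subst he
        exact mem_zip_snd_unique (A.ins_nodup v) ht ht'
      · obtain ⟨t, ht⟩ := hzip r a
        rw [σ1 t ht, σ2 r' b (by tauto)] at he
        exact absurd (he ▸ (List.of_mem_zip ht).1) (by tauto)
      · obtain ⟨t, ht⟩ := hzip r' b
        rw [σ1 t ht, σ2 r a (by tauto)] at he
        exact absurd (he ▸ (List.of_mem_zip ht).1) (by tauto)
      · rwa [σ2 r a (by tauto), σ2 r' b (by tauto)] at he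
    · rw [hinit] at ht
      by_cases a : t ∈ A.ins v
      · obtain ⟨r, hr⟩ := exists_mem_zip_left hlen a
        exact ⟨r, i2 r (List.of_mem_zip hr).2, σ1 t hr⟩
      · exact ⟨t, by rw [hterm]; tauto, σ2 t (by tauto) (by tauto)⟩
    · rw [hterm] at hr
      by_cases a : r ∈ A.outs w
      · obtain ⟨t, ht⟩ := hzip r a
        rw [σ1 t ht, hcol r t ht]
      · rw [σ2 r a (by tauto)]
    · rw [hterm] at hr
      by_cases a : r ∈ A.outs w
      · obtain ⟨t, ht⟩ := hzip r a
        rw [σ1 t ht, (A.mem_outs _ _).1 a]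
        exact .tail (.single (adj_of_mem_ins (List.of_mem_zip ht).1)) a0
      · rw [σ2 r a (by tauto)]
  obtain ⟨B, P, τ, hD, hτ, hτ', hc, hi, ho⟩ := exists_shortcut h
  refine ⟨B, ⟨v, w, s, P, τ, hv, hw, hvw, h1, h2, hD, fun t => ?_, fun r r' hr hr' => ?_,
    fun r hr => ?_, hi, ho⟩, hD.isSmaller ⟨v, .inl rfl⟩ hi ho⟩
  · obtain ⟨r, rfl⟩ := hτ t
    by_cases hr : r = s
    · refine ⟨r₀, fun h => hs1 (h ▸ hr₀), (hτ' _ _).2 ?_⟩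
      rw [hr, σ3]
      exact h.eq_self _ (i1 _ hr₀)
    · exact ⟨r, hr, rfl⟩
  · rw [hτ']
    have hdisj : ∀ r, r ∈ A.ins v → r ∉ A.outs w := fun r h h' => i1 r h (.inr
      ((A.mem_outs _ _).1 h'))
    by_cases a : r ∈ A.outs w <;> by_cases b : r' ∈ A.outs w
    · constructor
      · intro he
        obtain ⟨t, ht⟩ := hzip r a
        obtain ⟨t', ht'⟩ := hzip r' b
        rw [σ1 t ht, σ1 t' ht'] at he
        subst he
        exact .inl (mem_zip_snd_unique (A.ins_nodup v) ht ht')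
      · rintro (rfl | h | h)
        · rfl
        · exact absurd a (hdisj _ (List.of_mem_zip h).1)
        · exact absurd b (hdisj _ (List.of_mem_zip h).1)
    · obtain ⟨t, ht⟩ := hzip r a
      rw [σ1 t ht, σ2 r' b hr']
      constructor
      · rintro rfl
        exact .inr (.inr ht)
      · rintro (rfl | h | h)
        · exact absurd a b
        · exact absurd (List.of_mem_zip h).2 b
        · exact mem_zip_fst_unique (A.outs_nodup w) ht h
    · obtain ⟨t, ht⟩ := hzip r' b
      rw [σ1 t ht, σ2 r a hr]
      constructor
      · rintro rfl
        exact .inr (.inl ht)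
      · rintro (rfl | h | h)
        · exact absurd b a
        · exact mem_zip_fst_unique (A.outs_nodup w) h ht
        · exact absurd (List.of_mem_zip h).2 a
    · rw [σ2 r a hr, σ2 r' b hr']
      constructor
      · exact .inl
      · rintro (h | h | h)
        · exact h
        · exact absurd (List.of_mem_zip h).2 b
        · exact absurd (List.of_mem_zip h).2 a
  · rw [hc]
    by_cases a : r ∈ A.outs w
    · obtain ⟨t, ht⟩ := hzip r a
      rw [σ1 t ht, hcol r t ht]
    · rw [σ2 r a hr]

end Exists

end StrandDiagram

namespace StrandDiagram

variable {o : EdgeOrder Γ} {x y z : Tuple V}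

/-! ### Making the sources univalent -/

section Attach

variable (A : StrandDiagram o x y) (i₀ : Fin x.length)

open Classical in
/-- The graph obtained by adding a univalent source and a strand from it to the source `i₀`. -/
noncomputable def attachGraph : StrandGraph V where
  Point := Option A.Point
  Strand := Option A.Strand
  finite_point := by
    have := A.finite_point
    infer_instance
  finite_strand := by
    have := A.finite_strand
    infer_instance
  init s := s.map A.init
  term s := s.elim (some (A.source i₀)) fun s => some (A.term s)
  pointCol p := p.elim (A.pointCol (A.source i₀)) A.pointCol
  strandCol s := s.elim (A.pointCol (A.source i₀)) A.strandCol
  ins p := p.elim [] fun p => if p = A.source i₀ then [none] else (A.ins p).map some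
  outs p := p.elim [none] fun p => (A.outs p).map some
  ins_nodup p := by
    rcases p with _ | p
    · exact List.nodup_nil
    · by_cases h : p = A.source i₀
      · simp [h]
      · simpa [h] using (A.ins_nodup p).map (Option.some_injective _)
  outs_nodup p := by
    rcases p with _ | p
    · exact List.nodup_singleton _
    · exact (A.outs_nodup p).map (Option.some_injective _)
  mem_ins p s := by
    have hi : A.ins (A.source i₀) = [] := (A.source i₀).2
    rcases p with _ | p
    · rcases s with _ | s <;> simp
    · by_cases h : p = A.source i₀
      · subst h
        rcases s with _ | s
        · simp
        · simp [← A.mem_ins, hi]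
      · rcases s with _ | s
        · simp [h, Ne.symm h]
        · simp [h, A.mem_ins]
  mem_outs p s := by
    rcases p with _ | p <;> rcases s with _ | s <;> simp [A.mem_outs]
  acyclic := by
    obtain ⟨rank, hr⟩ := A.exists_rank
    refine acyclic_of_rank (fun p => p.elim 0 fun p => rank p + 1) fun s => ?_
    rcases s with _ | s
    · simp
    · simpa using hr s

open Classical in
/-- The graph obtained by adding a split-source, a merge and a strand from this merge to the
source `i₀`. -/
noncomputable def expandGraph : StrandGraph V where
  Point := A.Point ⊕ Bool
  Strand := A.Strand ⊕ Option {s // s ∈ A.outs (A.source i₀)}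
  finite_point := by
    have := A.finite_point
    infer_instance
  finite_strand := by
    have := A.finite_strand
    infer_instance
  init := Sum.elim (fun s => .inl (A.init s)) fun s => s.elim (.inr true) fun _ => .inr false
  term := Sum.elim (fun s => .inl (A.term s))
    fun s => s.elim (.inl (A.source i₀)) fun _ => .inr true
  pointCol := Sum.elim A.pointCol fun _ => A.pointCol (A.source i₀)
  strandCol := Sum.elim A.strandCol
    fun s => s.elim (A.pointCol (A.source i₀)) fun s => A.strandCol s
  ins := Sum.elim (fun p => if p = A.source i₀ then [.inr none] else (A.ins p).map .inl)
    fun b => if b then (A.outs (A.source i₀)).attach.map fun s => .inr (some s) else []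
  outs := Sum.elim (fun p => (A.outs p).map .inl)
    fun b => if b then [.inr none] else (A.outs (A.source i₀)).attach.map fun s => .inr (some s)
  ins_nodup p := by
    rcases p with p | _ | _
    · by_cases h : p = A.source i₀
      · simp [h]
      · simpa [h] using (A.ins_nodup p).map Sum.inl_injective
    · simp
    · refine (List.nodup_attach.2 (A.outs_nodup _)).map fun s s' h => ?_
      simpa using h
  outs_nodup p := by
    rcases p with p | _ | _
    · exact (A.outs_nodup p).map Sum.inl_injective
    · refine (List.nodup_attach.2 (A.outs_nodup _)).map fun s s' h => ?_
      simpa using h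
    · simp
  mem_ins p s := by
    have hi : A.ins (A.source i₀) = [] := (A.source i₀).2
    rcases p with p | _ | _
    · by_cases h : p = A.source i₀
      · subst h
        rcases s with s | _ | s
        · simp [← A.mem_ins, hi]
        · simp
        · simp
      · rcases s with s | _ | s
        · simp [h, A.mem_ins]
        · simp [h, Ne.symm h]
        · simp [h]
    · rcases s with s | _ | s <;> simp
    · rcases s with s | _ | s <;> simp
  mem_outs p s := by
    rcases p with p | _ | _ <;> rcases s with s | _ | s <;> simp [A.mem_outs]
  acyclic := by
    obtain ⟨rank, hr⟩ := A.exists_rank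
    refine acyclic_of_rank
      (Sum.elim (fun p => rank p + 2) fun b => if b then 1 else 0) fun s => ?_
    rcases s with s | _ | s
    · simpa using hr s
    · simp
    · simp

end Attach

section Extend

variable {A : StrandDiagram o x y} {i₀ : Fin x.length}

/-- The graph `G` arises from `A` by putting something above the source `i₀`, with the new source
`u` and a strand `t` from the new part to the old source. -/
structure IsExtension (A : StrandDiagram o x y) (i₀ : Fin x.length) (G : StrandGraph V)
    (f : A.Point → G.Point) (g : A.Strand → G.Strand) (u : G.Point) (t : G.Strand) : Prop where
  split : A.IsSplit (A.source i₀)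
  f_injective : Function.Injective f
  f_ne : ∀ p, f p ≠ u
  rest : ∀ q, q = u ∨ (∃ p, q = f p) ∨ (G.ins q ≠ [] ∧ G.outs q ≠ [])
  pointCol : ∀ p, G.pointCol (f p) = A.pointCol p
  pointCol_u : G.pointCol u = A.pointCol (A.source i₀)
  strandCol : ∀ s, G.strandCol (g s) = A.strandCol s
  strandCol_t : G.strandCol t = A.pointCol (A.source i₀)
  ins_u : G.ins u = []
  outs_u : G.outs u ≠ []
  ins_source : G.ins (f (A.source i₀)) = [t]
  ins : ∀ p : A.Point, p ≠ A.source i₀ → G.ins (f p) = (A.ins p).map g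
  outs : ∀ p, G.outs (f p) = (A.outs p).map g
  local_rest : ∀ q, (∀ p, q ≠ f p) → LocalCondition o G q

variable {G : StrandGraph V} {f : A.Point → G.Point} {g : A.Strand → G.Strand} {u : G.Point}
  {t : G.Strand}

theorem IsExtension.localCondition (h : IsExtension A i₀ G f g u t) (q : G.Point) :
    LocalCondition o G q := by
  by_cases hq : ∃ p, q = f p
  · obtain ⟨p, rfl⟩ := hq
    by_cases hp : p = A.source i₀
    · subst hp
      exact .of_split h.split (A.split_col _ h.split).1 g (h.pointCol _) h.strandCol (h.outs _)
        h.ins_source h.strandCol_t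
    · exact (A.localCondition p).transfer g (h.pointCol _) h.strandCol (h.ins p hp) (h.outs p)
  · exact h.local_rest q (not_exists.1 hq)

theorem IsExtension.isSource_iff (h : IsExtension A i₀ G f g u t) (q : G.Point) :
    G.IsSource q ↔ q = u ∨ ∃ p, q = f p ∧ p ≠ A.source i₀ ∧ A.IsSource p := by
  constructor
  · intro hq
    rcases h.rest q with rfl | ⟨p, rfl⟩ | h'
    · exact .inl rfl
    · have hp : p ≠ A.source i₀ := by
        rintro rfl
        exact List.cons_ne_nil _ _ (h.ins_source.symm.trans hq)
      exact .inr ⟨p, rfl, hp, List.map_eq_nil_iff.1 ((h.ins p hp).symm.trans hq)⟩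
    · exact absurd hq h'.1
  · rintro (rfl | ⟨p, rfl, hp, hs⟩)
    · exact h.ins_u
    · exact (h.ins p hp).trans (List.map_eq_nil_iff.2 hs)

theorem IsExtension.isSink_iff (h : IsExtension A i₀ G f g u t) (q : G.Point) :
    G.IsSink q ↔ ∃ p, q = f p ∧ A.IsSink p := by
  constructor
  · intro hq
    rcases h.rest q with rfl | ⟨p, rfl⟩ | h'
    · exact absurd hq h.outs_u
    · exact ⟨p, rfl, List.map_eq_nil_iff.1 ((h.outs p).symm.trans hq)⟩
    · exact absurd hq h'.2
  · rintro ⟨p, rfl, hs⟩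
    exact (h.outs p).trans (List.map_eq_nil_iff.2 hs)

theorem IsExtension.source_ne {i : Fin x.length} (hi : i ≠ i₀) :
    (A.source i : A.Point) ≠ A.source i₀ :=
  fun h => hi (A.source.injective (Subtype.ext h))

theorem IsExtension.exists_source (h : IsExtension A i₀ G f g u t) :
    ∃ e : Fin x.length ≃ {p // G.IsSource p},
      (e i₀ : G.Point) = u ∧ ∀ i, i ≠ i₀ → (e i : G.Point) = f (A.source i) := by
  classical
  let k : Fin x.length → {p // G.IsSource p} := fun i =>
    if hi : i = i₀ then ⟨u, h.ins_u⟩ else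
      ⟨f (A.source i), (h.isSource_iff _).2 (.inr ⟨_, rfl, source_ne hi, (A.source i).2⟩)⟩
  have k0 : (k i₀ : G.Point) = u := by simp [k]
  have k1 : ∀ i, i ≠ i₀ → (k i : G.Point) = f (A.source i) := fun i hi => by simp [k, hi]
  refine ⟨Equiv.ofBijective k ⟨fun i j hij => ?_, fun q => ?_⟩, k0, k1⟩
  · have hij' := congrArg Subtype.val hij
    by_cases hi : i = i₀ <;> by_cases hj : j = i₀
    · rw [hi, hj]
    · rw [hi, k0, k1 j hj] at hij'
      exact absurd hij'.symm (h.f_ne _)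
    · rw [hj, k0, k1 i hi] at hij'
      exact absurd hij' (h.f_ne _)
    · rw [k1 i hi, k1 j hj] at hij'
      exact A.source.injective (Subtype.ext (h.f_injective hij'))
  · rcases (h.isSource_iff q.1).1 q.2 with hq | ⟨p, hq, hp, hs⟩
    · exact ⟨i₀, Subtype.ext (k0.trans hq.symm)⟩
    · refine ⟨A.source.symm ⟨p, hs⟩, Subtype.ext ?_⟩
      rw [k1, Equiv.apply_symm_apply, hq]
      rintro rfl
      exact hp (by simp)

/-- An extension of `A`, as a strand diagram. -/
noncomputable def extension (h : IsExtension A i₀ G f g u t) : StrandDiagram o x y :=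
  ofLocalCondition G h.exists_source.choose
    (A.sink.trans (Equiv.ofBijective (fun p => ⟨f p.1, (h.isSink_iff _).2 ⟨_, rfl, p.2⟩⟩)
      ⟨fun p p' hp => Subtype.ext (h.f_injective (congrArg Subtype.val hp)), fun q => by
        obtain ⟨p, hq, hp⟩ := (h.isSink_iff q.1).1 q.2
        exact ⟨⟨p, hp⟩, Subtype.ext hq.symm⟩⟩))
    (fun i => by
      by_cases hi : i = i₀
      · rw [hi, h.exists_source.choose_spec.1, h.pointCol_u, A.source_col]
      · rw [h.exists_source.choose_spec.2 i hi, h.pointCol, A.source_col])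
    (fun i => (h.pointCol _).trans (A.sink_col i)) h.localCondition

theorem extension_source_self (h : IsExtension A i₀ G f g u t) :
    (((extension h).source i₀).1 : G.Point) = u := h.exists_source.choose_spec.1

theorem extension_source (h : IsExtension A i₀ G f g u t) {i : Fin x.length} (hi : i ≠ i₀) :
    (((extension h).source i).1 : G.Point) = f (A.source i) := h.exists_source.choose_spec.2 i hi

theorem isExtension_attachGraph (hv : A.IsSplit (A.source i₀)) :
    IsExtension A i₀ (attachGraph A i₀) some some none none where
  split := hv
  f_injective := Option.some_injective _
  f_ne := Option.some_ne_none
  rest q := by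
    rcases q with _ | p
    exacts [.inl rfl, .inr (.inl ⟨p, rfl⟩)]
  pointCol _ := rfl
  pointCol_u := rfl
  strandCol _ := rfl
  strandCol_t := rfl
  ins_u := rfl
  outs_u := List.cons_ne_nil _ _
  ins_source := if_pos rfl
  ins _ hp := if_neg hp
  outs _ := rfl
  local_rest q hq := by
    rcases q with _ | p
    · exact localCondition_of_fits ⟨List.nodup_nil, .inl rfl⟩
        ⟨List.nodup_singleton _, .inr (.inl ⟨none, rfl, rfl⟩)⟩ (.inr (List.cons_ne_nil _ _))
        (.inl (Nat.zero_le _)) (fun h => absurd h Nat.zero_ne_one)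
    · exact absurd rfl (hq p)

/-- The new strands from the new source to the new merge. -/
def expandStrand (A : StrandDiagram o x y) (i₀ : Fin x.length)
    (s : {s // s ∈ A.outs (A.source i₀)}) : (expandGraph A i₀).Strand := .inr (some s)

theorem expandStrand_injective : Function.Injective (expandStrand A i₀) :=
  Sum.inr_injective.comp (Option.some_injective _)

theorem length_map_attach {S T : Type*} {l : List S} (f : {s // s ∈ l} → T) :
    (l.attach.map f).length = l.length := by simp

/-- The same list of new strands leaves the new split-source and enters the new merge, so this
condition serves both points. -/
theorem expandGraph_fits (hv : A.IsSplit (A.source i₀)) :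
    Fits o ((A.outs (A.source i₀)).attach.map (expandStrand A i₀)) (A.pointCol (A.source i₀))
      (expandGraph A i₀).strandCol := by
  have h := A.fits_outs (A.source i₀)
  refine ⟨(List.nodup_attach.2 h.nodup).map expandStrand_injective, .inr (.inr ⟨?_, ?_⟩)⟩
  · rw [length_map_attach]
    exact hv.2
  · rw [← h.map_eq hv.2, List.map_map]
    exact List.attach_map_val (f := A.strandCol)

theorem isExtension_expandGraph (hv : A.IsSplit (A.source i₀)) :
    IsExtension A i₀ (expandGraph A i₀) .inl .inl (.inr false) (.inr none) where
  split := hv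
  f_injective := Sum.inl_injective
  f_ne _ := Sum.inl_ne_inr
  rest q := by
    rcases q with p | _ | _
    · exact .inr (.inl ⟨p, rfl⟩)
    · exact .inl rfl
    · refine .inr (.inr ⟨fun h => ?_, List.cons_ne_nil _ _⟩)
      have h1 := (length_map_attach (expandStrand A i₀)).symm.trans (congrArg List.length h)
      have := hv.2
      rw [h1] at this
      exact absurd this (by simp)
  pointCol _ := rfl
  pointCol_u := rfl
  strandCol _ := rfl
  strandCol_t := rfl
  ins_u := rfl
  outs_u h := by
    have h1 := (length_map_attach (expandStrand A i₀)).symm.trans (congrArg List.length h)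
    have := hv.2
    rw [h1] at this
    exact absurd this (by simp)
  ins_source := if_pos rfl
  ins _ hp := if_neg hp
  outs _ := rfl
  local_rest q hq := by
    have hl : 2 ≤ ((A.outs (A.source i₀)).attach.map (expandStrand A i₀)).length :=
      hv.2.trans (length_map_attach _).ge
    rcases q with p | _ | _
    · exact absurd rfl (hq p)
    · exact localCondition_of_fits ⟨List.nodup_nil, .inl rfl⟩ (expandGraph_fits hv)
        (.inr (List.ne_nil_of_length_pos (lt_of_lt_of_le Nat.two_pos hl))) (.inl (Nat.zero_le _))
        (fun h => absurd h Nat.zero_ne_one)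
    · refine localCondition_of_fits (expandGraph_fits hv)
        ⟨List.nodup_singleton _, .inr (.inl ⟨.inr none, rfl, rfl⟩)⟩
        (.inr (List.cons_ne_nil _ _)) (.inr le_rfl) fun h => ?_
      exact absurd (hl.trans_eq h) (by simp)

/-- The new split-source and the new merge bound the same strands in the same order. Collapsing them
turns the split-source into a univalent source, whose strand leads to the old source. -/
theorem reduction1_expand (hv : A.IsSplit (A.source i₀)) :
    Reduction1 (extension (isExtension_expandGraph hv))
      (extension (isExtension_attachGraph hv)) := by
  have hD := isExtension_expandGraph hv
  have hA := isExtension_attachGraph hv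
  let P : Option A.Point → A.Point ⊕ Bool := fun p => p.elim (.inr false) .inl
  let σ : A.Strand ⊕ Option {s // s ∈ A.outs (A.source i₀)} → Option A.Strand :=
    Sum.elim some fun _ => none
  have hl : 2 ≤ ((A.outs (A.source i₀)).attach.map (expandStrand A i₀)).length :=
    hv.2.trans (length_map_attach _).ge
  have hmem : ∀ s, (s ∈ (expandGraph A i₀).ins (.inr false) ∨
      s ∈ (expandGraph A i₀).outs (.inr false) ∨ s ∈ (expandGraph A i₀).outs (.inr true)) ↔
      σ s = none := by
    rintro (s | _ | s)
    · refine iff_of_false ?_ (Option.some_ne_none s)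
      rintro (h | h | h)
      · exact Sum.inl_ne_inr (((expandGraph A i₀).mem_ins _ _).1 h)
      · exact Sum.inl_ne_inr (((expandGraph A i₀).mem_outs _ _).1 h)
      · exact Sum.inl_ne_inr (((expandGraph A i₀).mem_outs _ _).1 h)
    · exact iff_of_true (.inr (.inr (((expandGraph A i₀).mem_outs _ _).2 rfl))) rfl
    · exact iff_of_true (.inr (.inl (((expandGraph A i₀).mem_outs _ _).2 rfl))) rfl
  have hout : ∀ s, s ∈ (expandGraph A i₀).outs (.inr false) ↔ ∃ k, s = .inr (some k) := by
    intro s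
    refine ((expandGraph A i₀).mem_outs _ _).trans ⟨fun h => ?_, ?_⟩
    · rcases s with s | _ | s
      · exact absurd h Sum.inl_ne_inr
      · exact absurd (Sum.inr_injective h).symm Bool.false_ne_true
      · exact ⟨s, rfl⟩
    · rintro ⟨k, rfl⟩
      rfl
  refine ⟨(.inr false : A.Point ⊕ Bool), (.inr true : A.Point ⊕ Bool), P, σ, ⟨Nat.zero_le _, hl⟩,
    ⟨le_rfl, hl⟩, rfl, rfl, ⟨?_, ?_, ?_, ?_, ?_⟩, ?_, fun s s' => ?_, ?_, ?_, ?_, ?_, ?_⟩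
  · rintro (_ | p) (_ | q) h
    · rfl
    · exact absurd h Sum.inr_ne_inl
    · exact absurd h Sum.inl_ne_inr
    · exact congrArg some (Sum.inl_injective h)
  · ext q
    constructor
    · rintro ⟨_ | p, rfl⟩ (⟨-, h⟩ | ⟨h, -⟩)
      · exact h rfl
      · exact absurd (Sum.inr_injective h) Bool.false_ne_true
      · exact h rfl
      · exact absurd h Sum.inl_ne_inr
    · rintro h
      rcases q with p | _ | _
      · exact ⟨some p, rfl⟩
      · exact ⟨none, rfl⟩
      · exact absurd (Or.inr ⟨rfl, List.cons_ne_nil _ _⟩) h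
  · rintro (_ | p) <;> rfl
  · intro i
    by_cases hi : i = i₀
    · subst hi
      exact (congrArg P (extension_source_self hA)).trans (extension_source_self hD).symm
    · exact (congrArg P (extension_source hA hi)).trans (extension_source hD hi).symm
  · intro i
    rfl
  · rintro (_ | s)
    exacts [⟨.inr none, rfl⟩, ⟨.inl s, rfl⟩]
  · refine Iff.trans ?_ (or_congr_right (and_congr (hmem s) (hmem s')).symm)
    rcases s with s | s <;> rcases s' with s' | s'
    · exact ⟨fun h => .inl (congrArg Sum.inl (Option.some_injective _ h)), fun h =>
        h.elim (fun h => congrArg some (Sum.inl_injective h))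
          fun h => absurd h.1 (Option.some_ne_none s)⟩
    · exact iff_of_false (Option.some_ne_none s) fun h =>
        h.elim Sum.inl_ne_inr fun h => absurd h.1 (Option.some_ne_none s)
    · exact iff_of_false (Option.some_ne_none s').symm fun h =>
        h.elim Sum.inr_ne_inl fun h => absurd h.2 (Option.some_ne_none s')
    · exact iff_of_true rfl (.inr ⟨rfl, rfl⟩)
  · rintro (s | _ | k) h
    · rfl
    · rfl
    · exact absurd ((hout _).2 ⟨k, rfl⟩) h
  · intro s hs
    obtain ⟨k, rfl⟩ := (hout s).1 hs
    rfl
  · rintro (_ | p) h1 h2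
    · exact absurd rfl h1
    · refine ⟨?_, ?_⟩
      · by_cases hp : p = A.source i₀
        · subst hp
          exact hA.ins_source.trans (congrArg (List.map σ) hD.ins_source).symm
        · refine (hA.ins p hp).trans (Eq.trans ?_ (congrArg (List.map σ) (hD.ins p hp)).symm)
          exact (List.map_map (f := Sum.inl) (g := σ)).symm
      · exact (List.map_map (f := Sum.inl) (g := σ)).symm
  · rintro (_ | p) h
    · refine ⟨rfl, fun s hs => ?_⟩
      obtain ⟨k, rfl⟩ := (hout s).1 hs
      rfl
    · exact absurd h Sum.inl_ne_inr
  · rintro (_ | p) h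
    · exact absurd (Sum.inr_injective h) Bool.false_ne_true
    · exact absurd h Sum.inl_ne_inr

-- The new merge cancels against the old split-source, and each new strand is joined with an old
-- one. What is left is `A`, with the new split-source in the role of the old one.
open Classical in
theorem reduction2_expand (hv : A.IsSplit (A.source i₀)) :
    Reduction2 (extension (isExtension_expandGraph hv)) A := by
  have hD := isExtension_expandGraph hv
  have hns : ∀ i, (A.sink i : A.Point) ≠ A.source i₀ := fun i h =>
    not_isSource_and_isSink _ (h ▸ (A.source i₀).2) (A.sink i).2
  obtain ⟨s₀, hs₀⟩ := List.exists_mem_of_length_pos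
    (by have := hv.2; omega : 0 < (A.outs (A.source i₀)).length)
  let P : A.Point → A.Point ⊕ Bool := fun p => if p = A.source i₀ then .inr false else .inl p
  have P0 : P (A.source i₀) = .inr false := if_pos rfl
  have P1 : ∀ p : A.Point, p ≠ A.source i₀ → P p = .inl p := fun p hp => if_neg hp
  let σ : A.Strand ⊕ Option {s // s ∈ A.outs (A.source i₀)} → A.Strand :=
    Sum.elim id fun s => s.elim s₀ Subtype.val
  have hl : 2 ≤ ((A.outs (A.source i₀)).attach.map (expandStrand A i₀)).length :=
    hv.2.trans (length_map_attach _).ge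
  let g : A.Strand → (expandGraph A i₀).Strand := Sum.inl
  have hzip : ((A.outs (A.source i₀)).attach.map (expandStrand A i₀)).zip
      ((A.outs (A.source i₀)).map g) = (A.outs (A.source i₀)).attach.map
        fun k => (expandStrand A i₀ k, g k.1) := by
    have : (A.outs (A.source i₀)).map g = (A.outs (A.source i₀)).attach.map fun k => g k.1 :=
      (List.attach_map_val (f := g)).symm
    rw [this]
    exact List.zip_map'
  have hz : ∀ r r', (r, r') ∈ ((A.outs (A.source i₀)).attach.map (expandStrand A i₀)).zip
      ((A.outs (A.source i₀)).map g) ↔ ∃ k, r = .inr (some k) ∧ r' = .inl k.1 := by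
    intro r r'
    rw [hzip, List.mem_map]
    constructor
    · rintro ⟨k, -, h⟩
      obtain ⟨rfl, rfl⟩ := Prod.mk.inj h
      exact ⟨k, rfl, rfl⟩
    · rintro ⟨k, rfl, rfl⟩
      exact ⟨k, List.mem_attach _ _, rfl⟩
  refine ⟨(.inr true : A.Point ⊕ Bool), (.inl (A.source i₀) : A.Point ⊕ Bool), .inr none, P, σ,
    ⟨le_rfl, hl⟩, ⟨(congrArg List.length hD.ins_source).le, hv.2.trans (List.length_map _).ge⟩,
    rfl, rfl, hD.ins_source, ⟨?_, ?_, ?_, ?_, ?_⟩, ?_, fun r r' hr hr' => ?_, ?_, ?_, ?_⟩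
  · intro p q h
    by_cases hp : p = A.source i₀ <;> by_cases hq : q = A.source i₀
    · rw [hp, hq]
    · rw [hp, P0, P1 q hq] at h
      exact absurd h Sum.inr_ne_inl
    · rw [hq, P0, P1 p hp] at h
      exact absurd h Sum.inl_ne_inr
    · rw [P1 p hp, P1 q hq] at h
      exact Sum.inl_injective h
  · ext q
    constructor
    · rintro ⟨p, rfl⟩
      by_cases hp : p = A.source i₀
      · rw [hp, P0]
        rintro (h | h)
        · exact absurd (Sum.inr_injective h) Bool.false_ne_true
        · exact Sum.inr_ne_inl h
      · rw [P1 p hp]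
        rintro (h | h)
        · exact Sum.inl_ne_inr h
        · exact hp (Sum.inl_injective h)
    · intro h
      rcases q with p | _ | _
      · exact ⟨p, P1 p fun hp => h (.inr (congrArg Sum.inl hp))⟩
      · exact ⟨_, P0⟩
      · exact absurd (.inl rfl) h
  · intro p
    by_cases hp : p = A.source i₀
    · rw [hp, P0]
      rfl
    · rw [P1 p hp]
      rfl
  · intro i
    by_cases hi : i = i₀
    · subst hi
      exact P0.trans (extension_source_self hD).symm
    · exact (P1 _ (IsExtension.source_ne hi)).trans (extension_source hD hi).symm
  · intro i
    exact P1 _ (hns i)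
  · exact fun t => ⟨.inl t, Sum.inl_ne_inr, rfl⟩
  · refine Iff.trans ?_ (or_congr_right (or_congr (hz r r') (hz r' r)).symm)
    rcases r with r | _ | r
    · rcases r' with r' | _ | r'
      · refine ⟨fun h => .inl (congrArg Sum.inl h), ?_⟩
        rintro (h | ⟨k, h, -⟩ | ⟨k, h, -⟩)
        · exact Sum.inl_injective h
        · exact absurd h Sum.inl_ne_inr
        · exact absurd h Sum.inl_ne_inr
      · exact absurd rfl hr'
      · refine ⟨fun h => .inr (.inr ⟨r', rfl, congrArg Sum.inl h⟩), ?_⟩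
        rintro (h | ⟨k, h, -⟩ | ⟨k, h, h'⟩)
        · exact absurd h Sum.inl_ne_inr
        · exact absurd h Sum.inl_ne_inr
        · exact (Sum.inl_injective h').trans
            (congrArg Subtype.val (Option.some_injective _ (Sum.inr_injective h))).symm
    · exact absurd rfl hr
    · rcases r' with r' | _ | r'
      · refine ⟨fun h => .inr (.inl ⟨r, rfl, congrArg Sum.inl h.symm⟩), ?_⟩
        rintro (h | ⟨k, h, h'⟩ | ⟨k, h, -⟩)
        · exact absurd h Sum.inr_ne_inl
        · exact (congrArg Subtype.val (Option.some_injective _ (Sum.inr_injective h))).trans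
            (Sum.inl_injective h').symm
        · exact absurd h Sum.inl_ne_inr
      · exact absurd rfl hr'
      · refine ⟨fun h => .inl (congrArg (fun k => Sum.inr (some k)) (Subtype.ext h)), ?_⟩
        rintro (h | ⟨k, -, h⟩ | ⟨k, -, h⟩)
        · exact congrArg Subtype.val (Option.some_injective _ (Sum.inr_injective h))
        · exact absurd h Sum.inr_ne_inl
        · exact absurd h Sum.inr_ne_inl
  · rintro (r | _ | r) hr
    · rfl
    · exact absurd rfl hr
    · rfl
  · intro p
    by_cases hp : p = A.source i₀
    · rw [hp, P0]
      exact (A.source i₀).2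
    · rw [P1 p hp]
      refine Eq.trans ?_ (congrArg (List.map σ) (hD.ins p hp)).symm
      exact (List.map_id _).symm.trans (List.map_map (f := Sum.inl) (g := σ)).symm
  · intro p
    by_cases hp : p = A.source i₀
    · rw [hp, P0]
      refine Eq.trans ?_ (List.map_map (f := expandStrand A i₀) (g := σ)).symm
      exact (List.attach_map_subtype_val _).symm
    · rw [P1 p hp]
      exact (List.map_id _).symm.trans (List.map_map (f := Sum.inl) (g := σ)).symm

/-- The expanded diagram reduces to `A` by type 2 and to the diagram with an added univalent source
by type 1, so these two are equivalent. -/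
theorem exists_attach (hv : A.IsSplit (A.source i₀)) :
    ∃ B : StrandDiagram o x y, setoid o x y A B ∧ B.IsUnivalentSource (B.source i₀) ∧
      (∀ i, i ≠ i₀ → A.IsUnivalentSource (A.source i) → B.IsUnivalentSource (B.source i)) ∧
      ((∀ i, A.IsUnivalentSink (A.sink i)) → ∀ i, B.IsUnivalentSink (B.sink i)) := by
  have h := isExtension_attachGraph hv
  refine ⟨extension h, ?_, ⟨(Subtype.prop _), ?_⟩, fun i hi hA => ⟨(Subtype.prop _), ?_⟩,
    fun hA i => ⟨(Subtype.prop _), ?_⟩⟩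
  · exact .trans _ _ _ (.symm _ _ (.rel _ _ (.inr (.inr (.inr (reduction2_expand hv))))))
      (.rel _ _ (.inr (.inr (.inl (reduction1_expand hv)))))
  · exact congrArg (fun p => ((attachGraph A i₀).outs p).length) (extension_source_self h)
  · refine (congrArg (fun p => ((attachGraph A i₀).outs p).length) (extension_source h hi)).trans ?_
    exact (congrArg List.length (h.outs _)).trans ((List.length_map _).trans hA.2)
  · refine (congrArg List.length (h.ins _ fun h' => ?_)).trans ((List.length_map _).trans (hA i).2)
    exact not_isSource_and_isSink _ (h' ▸ (A.source i₀).2) (A.sink i).2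

/-- The split-sources are replaced one after another. The clause on sinks allows the same to be done
afterwards upside down without spoiling the result. -/
theorem exists_univalentSource (A : StrandDiagram o x y) :
    ∃ B : StrandDiagram o x y, setoid o x y A B ∧ (∀ i, B.IsUnivalentSource (B.source i)) ∧
      ((∀ i, A.IsUnivalentSink (A.sink i)) → ∀ i, B.IsUnivalentSink (B.sink i)) := by
  have key : ∀ I : Finset (Fin x.length), ∃ B : StrandDiagram o x y, setoid o x y A B ∧
      (∀ i ∈ I, B.IsUnivalentSource (B.source i)) ∧
      ((∀ i, A.IsUnivalentSink (A.sink i)) → ∀ i, B.IsUnivalentSink (B.sink i)) := by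
    intro I
    induction I using Finset.induction_on with
    | empty => exact ⟨A, .refl _, by simp, id⟩
    | insert i I hi ih =>
      obtain ⟨B, h1, h2, h3⟩ := ih
      by_cases h : B.IsUnivalentSource (B.source i)
      · refine ⟨B, h1, fun j hj => ?_, h3⟩
        rcases Finset.mem_insert.1 hj with rfl | hj
        exacts [h, h2 j hj]
      · obtain ⟨C, h4, h5, h6, h7⟩ := exists_attach (isSplit_of_isSource (B.source i).2 h)
        refine ⟨C, .trans _ _ _ h1 h4, fun j hj => ?_, fun hA => h7 (h3 hA)⟩
        by_cases hji : j = i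
        · rw [hji]; exact h5
        · exact h6 j hji (h2 j ((Finset.mem_insert.1 hj).resolve_left hji))
  obtain ⟨B, h1, h2, h3⟩ := key Finset.univ
  exact ⟨B, h1, fun i => h2 i (Finset.mem_univ i), h3⟩

theorem exists_univalent (A : StrandDiagram o x y) :
    ∃ B : StrandDiagram o x y, setoid o x y A B ∧ (∀ i, B.IsUnivalentSource (B.source i)) ∧
      ∀ i, B.IsUnivalentSink (B.sink i) := by
  obtain ⟨B, h1, h2, -⟩ := A.exists_univalentSource
  obtain ⟨C, h3, h4, h5⟩ := B.flip.exists_univalentSource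
  exact ⟨C.flip, .trans _ _ _ h1 (equiv_flip h3), h5 h2, h4⟩

end Extend

end StrandDiagram

namespace StrandDiagram

variable {o : EdgeOrder Γ} {x y z : Tuple V}

/-! ### Reduced strand diagrams -/

/-- The sources and sinks are univalent and no reduction is possible. -/
structure Reduced (A : StrandDiagram o x y) : Prop where
  source : ∀ i, A.IsUnivalentSource (A.source i)
  sink : ∀ i, A.IsUnivalentSink (A.sink i)
  not_degenerate : ∀ p, ¬ A.IsDegenerate p
  not_merge_split : ∀ s, A.IsMerge (A.init s) → ¬ A.IsSplit (A.term s)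
  outs_ne_ins : ∀ p q, A.IsSplit p → A.IsMerge q → A.pointCol p = A.pointCol q →
    A.outs p ≠ A.ins q

/-- Once sources and sinks are univalent, every available reduction takes place at internal points,
lowers the number of points and keeps the sources and sinks univalent, so the process stops. -/
theorem exists_reduced (A : StrandDiagram o x y) :
    ∃ B : StrandDiagram o x y, setoid o x y A B ∧ B.Reduced := by
  obtain ⟨A', hA, h1, h2⟩ := A.exists_univalent
  suffices h : ∀ n, ∀ A : StrandDiagram o x y, Nat.card A.Point = n →
      (∀ i, A.IsUnivalentSource (A.source i)) → (∀ i, A.IsUnivalentSink (A.sink i)) →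
      ∃ B : StrandDiagram o x y, setoid o x y A B ∧ B.Reduced by
    obtain ⟨B, hB, hB'⟩ := h _ A' rfl h1 h2
    exact ⟨B, .trans _ _ _ hA hB, hB'⟩
  intro n
  induction n using Nat.strong_induction_on with
  | _ n ih =>
    rintro A rfl h1 h2
    have step : ∀ B : StrandDiagram o x y, setoid o x y A B → IsSmaller B A →
        ∃ B : StrandDiagram o x y, setoid o x y A B ∧ B.Reduced := by
      intro B hB hs
      obtain ⟨C, hC, hC'⟩ := ih _ hs.card_lt B rfl (hs.source h1) (hs.sink h2)
      exact ⟨C, .trans _ _ _ hB hC, hC'⟩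
    by_cases h3 : ∃ p, A.IsDegenerate p
    · obtain ⟨B, hB, hs⟩ := exists_reduction0 h3.choose_spec
      exact step B (.rel _ _ (.inr (.inl hB))) hs
    by_cases h4 : ∃ s, A.IsMerge (A.init s) ∧ A.IsSplit (A.term s)
    · obtain ⟨B, hB, hs⟩ := exists_reduction2 h4.choose_spec.1 h4.choose_spec.2
      exact step B (.rel _ _ (.inr (.inr (.inr hB)))) hs
    by_cases h5 : ∃ p q, A.IsSplit p ∧ A.IsMerge q ∧ A.pointCol p = A.pointCol q ∧
        A.outs p = A.ins q
    · obtain ⟨p, q, hp, hq, hc, hl⟩ := h5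
      -- Sources have only one outgoing strand here, so the split is internal.
      have hp' : ¬ A.IsSource p := fun h => by
        have h' := (h1 (A.source.symm ⟨p, h⟩)).2
        rw [Equiv.apply_symm_apply] at h'
        exact absurd (hp.2.trans_eq h') (by simp)
      have hq' : ¬ A.IsSink q := fun h => by
        have h' := (h2 (A.sink.symm ⟨q, h⟩)).2
        rw [Equiv.apply_symm_apply] at h'
        exact absurd (hq.2.trans_eq h') (by simp)
      obtain ⟨B, hB, hs⟩ := exists_reduction1 hp hq hp' hq' hc hl
      exact step B (.rel _ _ (.inr (.inr (.inl hB)))) hs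
    · exact ⟨A, .refl _, h1, h2, fun p hp => h3 ⟨p, hp⟩, fun s hs hs' => h4 ⟨s, hs, hs'⟩,
        fun p q hp hq hc hl => h5 ⟨p, q, hp, hq, hc, hl⟩⟩

variable {A B : StrandDiagram o x y}

theorem Reduced.flip (h : A.Reduced) : A.flip.Reduced where
  source := h.sink
  sink := h.source
  not_degenerate p hp := h.not_degenerate p ⟨hp.2, hp.1⟩
  not_merge_split s h1 h2 := h.not_merge_split s h2 h1
  outs_ne_ins p q hp hq hc hl := h.outs_ne_ins q p hq hp hc.symm hl.symm

theorem Reduced.not_isSplit_source (h : A.Reduced) (i : Fin x.length) :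
    ¬ A.IsSplit (A.source i) := fun hi => by
  have := hi.2
  have := (h.source i).2
  omega

theorem Reduced.exists_ins_eq (h : A.Reduced) {p : A.Point} (hp : A.IsSplit p) :
    ∃ t, A.ins p = [t] := by
  refine List.length_eq_one_iff.1 (le_antisymm hp.1 (List.length_pos_iff.2 fun h' => ?_))
  refine h.not_isSplit_source (A.source.symm ⟨p, h'⟩) ?_
  rw [Equiv.apply_symm_apply]
  exact hp

theorem Reduced.kind (h : A.Reduced) (p : A.Point) :
    (∃ i, p = A.source i) ∨ (∃ i, p = A.sink i) ∨ A.IsSplit p ∨ A.IsMerge p := by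
  rcases A.kind p with k | k | k | k | k
  · exact .inl ⟨A.source.symm ⟨p, k.1⟩, by rw [Equiv.apply_symm_apply]⟩
  · exact .inr (.inl ⟨A.sink.symm ⟨p, k.1⟩, by rw [Equiv.apply_symm_apply]⟩)
  · exact .inr (.inr (.inl k))
  · exact .inr (.inr (.inr k))
  · exact absurd k (h.not_degenerate p)

/-! ### Addresses of strands -/

/-- The strand `s` is reached from the `i`-th source through splits only, and `w` is the reversed
word of the edges chosen at these splits. -/
def Address (A : StrandDiagram o x y) (i : Fin x.length) : List E → A.Strand → Prop
  | [], s => A.init s = A.source i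
  | e :: w, s => ∃ t, A.Address i w t ∧ A.IsSplit (A.term t) ∧
      (s, e) ∈ (A.outs (A.term t)).zip (o.out (A.pointCol (A.term t)))

variable {i i' : Fin x.length} {j j' : Fin y.length} {w w' r r' : List E} {s s' : A.Strand}

theorem Reduced.address_unique (hA : A.Reduced) (h : A.Address i w s) (h' : A.Address i w s') :
    s = s' := by
  induction w generalizing s s' with
  | nil => exact eq_of_mem_univalent (hA.source i).2 ((A.mem_outs _ _).2 h) ((A.mem_outs _ _).2 h')
  | cons e w ih =>
    obtain ⟨t, h1, -, h2⟩ := h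
    obtain ⟨t', h1', -, h2'⟩ := h'
    obtain rfl := ih h1 h1'
    exact mem_zip_fst_unique (o.out_nodup _) h2 h2'

theorem not_address_nil_cons {e : E} (h : A.Address i [] s) : ¬ A.Address i' (e :: w) s := by
  rintro ⟨t, -, -, h2⟩
  have h3 := (A.mem_outs _ _).1 (List.of_mem_zip h2).1
  have h4 := (A.mem_ins _ t).2 (h3.symm.trans h)
  rw [(A.source i).2] at h4
  simp at h4

/-- A split has exactly one incoming strand, so climbing from `s` to a source leaves no choice. -/
theorem Reduced.address_injective (hA : A.Reduced) (h : A.Address i w s)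
    (h' : A.Address i' w' s) : i = i' ∧ w = w' := by
  induction w generalizing w' s with
  | nil =>
    cases w' with
    | nil => exact ⟨A.source.injective (Subtype.ext (h.symm.trans h')), rfl⟩
    | cons e w' => exact absurd h' (not_address_nil_cons h)
  | cons e w ih =>
    cases w' with
    | nil => exact absurd h (not_address_nil_cons h')
    | cons e' w' =>
      obtain ⟨t, h1, h2, h3⟩ := h
      obtain ⟨t', h1', h2', h3'⟩ := h'
      have h4 := (A.mem_outs _ _).1 (List.of_mem_zip h3).1
      have h4' := (A.mem_outs _ _).1 (List.of_mem_zip h3').1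
      obtain ⟨t₀, ht₀⟩ := hA.exists_ins_eq h2
      have h5 := (A.mem_ins _ t').2 (h4'.symm.trans h4)
      have h6 := (A.mem_ins _ t).2 rfl
      rw [ht₀, List.mem_singleton] at h5 h6
      obtain rfl : t = t' := h6.trans h5.symm
      obtain ⟨rfl, rfl⟩ := ih h1 h1'
      exact ⟨rfl, by rw [mem_zip_snd_unique (A.outs_nodup _) h3 h3']⟩

/-- Climb from `s`: above a split there is a single strand, and it does not start at a merge since
no merge is followed by a split. Hence the climb can end only at a source. -/
theorem Reduced.exists_address (hA : A.Reduced) (s : A.Strand) (hs : ¬ A.IsMerge (A.init s)) :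
    ∃ i w, A.Address i w s := by
  obtain ⟨p, hp⟩ : ∃ p, A.init s = p := ⟨_, rfl⟩
  induction p using A.flip.wellFounded_adj.induction generalizing s with
  | _ p ih =>
    rcases hA.kind p with ⟨i, hi⟩ | ⟨i, hi⟩ | h | h
    · exact ⟨i, [], hp.trans hi⟩
    · have := (A.mem_outs _ s).2 (hp.trans hi)
      rw [(A.sink i).2] at this
      simp at this
    · obtain ⟨t, ht⟩ := hA.exists_ins_eq h
      have ht' := (A.mem_ins p t).1 (by simp [ht])
      obtain ⟨i, w, hw⟩ := ih (A.init t) ⟨t, ht', rfl⟩ t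
        (fun h' => hA.not_merge_split t h' (by rwa [ht'])) rfl
      obtain ⟨e, he⟩ := exists_mem_zip_left ((A.fits_outs p).length_eq h.2) ((A.mem_outs p s).2 hp)
      exact ⟨i, e :: w, t, hw, by rwa [ht'], by rwa [ht']⟩
    · exact absurd (hp ▸ h) hs

theorem Address.isRevPath (h : A.Address i w s) (hA : A.Reduced) :
    Γ.IsRevPath (x.get i) w (A.strandCol s) := by
  induction w generalizing s with
  | nil =>
    refine ((A.univalentSource_col _ (hA.source i) s ((A.mem_outs _ _).2 h)).trans ?_)
    exact A.source_col i
  | cons e w ih =>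
    obtain ⟨t, h1, h2, h3⟩ := h
    have h4 := A.split_col _ h2
    refine ⟨?_, (eq_of_mem_zip h4.1 h3).symm⟩
    rw [(o.mem_out _ _).1 (List.of_mem_zip h3).2, ← h4.2 t ((A.mem_ins _ _).2 rfl)]
    exact ih h1

/-- Every letter of an address was read at a genuine split. Words with this property are the ones on
which the target of a canonical map is unique. -/
theorem Address.two_le_length (h : A.Address i w s) {e : E} (he : e ∈ w) :
    2 ≤ (o.out (Γ.init e)).length := by
  induction w generalizing s with
  | nil => simp at he
  | cons e' w ih =>
    obtain ⟨t, h1, h2, h3⟩ := h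
    rcases List.mem_cons.1 he with rfl | he
    · rw [(o.mem_out _ _).1 (List.of_mem_zip h3).2, ← (A.fits_outs _).length_eq h2.2]
      exact h2.2
    · exact ih h1 he

theorem Address.exists_run (h : A.Address i w s) (hA : A.Reduced) (γ : Stream' E) :
    ∃ α, A.Run (A.source i, revAppend w γ) (A.init s, α) ∧
      Branch o (A.outs (A.init s)) (A.pointCol (A.init s)) α s γ := by
  induction w generalizing s γ with
  | nil =>
    refine ⟨γ, ?_, .inl ⟨?_, rfl⟩⟩
    · rw [show A.init s = A.source i from h]
      exact .refl
    · obtain ⟨t, ht⟩ := List.length_eq_one_iff.1 (hA.source i).2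
      have := (A.mem_outs _ _).2 h
      rw [show A.init s = A.source i from h, ht]
      rw [ht, List.mem_singleton] at this
      rw [this]
  | cons e w ih =>
    obtain ⟨t, h1, h2, h3⟩ := h
    obtain ⟨α, hα, hb⟩ := ih h1 (Stream'.cons e γ)
    have h4 := (A.mem_outs _ _).1 (List.of_mem_zip h3).1
    refine ⟨Stream'.cons e γ, hα.tail ⟨t, _, hb, ?_⟩, ?_⟩
    · obtain ⟨t₀, ht₀⟩ := hA.exists_ins_eq h2
      have h5 := (A.mem_ins _ t).2 rfl
      rw [ht₀, List.mem_singleton] at h5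
      rw [h4]
      exact .inl ⟨by rw [ht₀, h5], rfl⟩
    · rw [h4]
      exact .inr ⟨h2.2, e, h3, rfl⟩

/-- With addresses from both sides, a ray comes down through splits that read off `w`, crosses `s`,
and continues through merges that write `r`. -/
theorem Address.canonicalAt (h : A.Address i w s) (h' : A.flip.Address j r s) (hA : A.Reduced) :
    CanonicalAt A.sem i w j r (A.strandCol s) := by
  have h1 := h.isRevPath hA
  have h2 := h'.isRevPath hA.flip
  refine ⟨h1, h2, fun γ hγ a ha => ?_⟩
  obtain ⟨α, hα, hb⟩ := h.exists_run hA γ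
  obtain ⟨β, hβ, hb'⟩ := h'.exists_run hA.flip γ
  have h3 : A.sem a = ⟨(j, revAppend r γ), (isRay_revAppend h2).2 hγ⟩ := by
    refine sem_eq_iff.2 ?_
    unfold Rel
    rw [ha]
    exact Relation.ReflTransGen.trans (hα.tail (c := (A.term s, β)) ⟨s, γ, hb, hb'⟩) (run_flip.1 hβ)
  rw [h3]

end StrandDiagram

/-! ### Uniqueness of targets of canonical maps -/

theorem eq_of_revAppend_eq {w w' : List E} (hl : w.length = w'.length) {γ γ' : Stream' E}
    (h : revAppend w γ = revAppend w' γ') : w = w' ∧ γ = γ' := by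
  induction w generalizing w' γ γ' with
  | nil =>
    obtain rfl := List.length_eq_zero_iff.1 hl.symm
    exact ⟨rfl, h⟩
  | cons e w ih =>
    obtain ⟨e', w', rfl⟩ := List.exists_cons_of_length_eq_add_one hl.symm
    obtain ⟨rfl, h2⟩ := ih (γ := .cons e γ) (γ' := .cons e' γ') (by simpa using hl) h
    obtain ⟨rfl, rfl⟩ := Stream'.cons_injective2 h2
    exact ⟨rfl, rfl⟩

/-- If the words differed, some nonempty `u` would satisfy `γ = uγ` for all rays `γ` at `c`, so all
these rays would begin with the same edge, against the out-degree at `c`. At a loop of out-degree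
one the conclusion does fail, hence the conditions on the letters. -/
theorem eq_of_forall_revAppend_eq (hΓ₀ : Γ.NoDeadEnds) (o : EdgeOrder Γ) {c : V} {r r' : List E}
    (hr : ∀ e ∈ r, 2 ≤ (o.out (Γ.init e)).length) (hr' : ∀ e ∈ r', 2 ≤ (o.out (Γ.init e)).length)
    (h : ∀ γ, Γ.IsRay c γ → revAppend r γ = revAppend r' γ) : r = r' := by
  wlog hl : r.length ≤ r'.length generalizing r r'
  · exact (this hr' hr (fun γ hγ => (h γ hγ).symm) (not_le.1 hl).le).symm
  -- `v` is the initial part of the longer path; it is as long as `r` and will turn out to equal it.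
  obtain ⟨u, v, rfl, hv⟩ : ∃ u v, r' = u ++ v ∧ r.length = v.length :=
    ⟨r'.take (r'.length - r.length), r'.drop (r'.length - r.length), by simp, by simp; omega⟩
  have key : ∀ γ, Γ.IsRay c γ → r = v ∧ γ = revAppend u γ := fun γ hγ =>
    eq_of_revAppend_eq hv ((h γ hγ).trans (revAppend_append _ _ _))
  obtain ⟨γ, hγ⟩ := hΓ₀.exists_isRay c
  obtain rfl := (key γ hγ).1
  obtain rfl | ⟨u', e, rfl⟩ := List.eq_nil_or_concat u
  · rfl
  simp only [List.concat_eq_append, revAppend_concat] at key hr'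
  have he : Γ.init e = c := by
    rw [(key γ hγ).2, isRay_cons] at hγ
    exact hγ.1
  have h2 := hr' e (by simp)
  rw [he] at h2
  -- A second edge at `c`: a ray beginning with it cannot start with `u`.
  obtain ⟨e', he', hne⟩ : ∃ e' ∈ o.out c, e' ≠ e := by
    classical
    by_contra! hall
    have := List.nodup_iff_count_le_one.1 (o.out_nodup c) e
    rw [List.eq_replicate_of_mem hall, List.count_replicate_self] at this
    omega
  obtain ⟨δ, hδ⟩ := hΓ₀.exists_isRay (Γ.term e')
  have h3 := (key (Stream'.cons e' δ) (isRay_cons.2 ⟨(o.mem_out _ _).1 he', hδ⟩)).2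
  exact absurd (Stream'.cons_injective2 h3).1 hne

theorem CanonicalAt.right_unique (hΓ₀ : Γ.NoDeadEnds) (o : EdgeOrder Γ) {x y : Tuple V}
    {f : Ray Γ x ≃ Ray Γ y} {i j j' w r r'} {c c' : V} (hr : ∀ e ∈ r, 2 ≤ (o.out (Γ.init e)).length)
    (hr' : ∀ e ∈ r', 2 ≤ (o.out (Γ.init e)).length)
    (h : CanonicalAt f i w j r c) (h' : CanonicalAt f i w j' r' c') : j = j' ∧ r = r' := by
  obtain rfl := h.left.eq_end h'.left
  have key : ∀ γ, Γ.IsRay c γ → j = j' ∧ revAppend r γ = revAppend r' γ := fun γ hγ => by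
    let a : Ray Γ x := ⟨(i, revAppend w γ), (isRay_revAppend h.left).2 hγ⟩
    exact Prod.ext_iff.1 ((h.map γ hγ a rfl).symm.trans (h'.map γ hγ a rfl))
  obtain ⟨γ, hγ⟩ := hΓ₀.exists_isRay c
  exact ⟨(key γ hγ).1, eq_of_forall_revAppend_eq hΓ₀ o hr hr' fun γ hγ => (key γ hγ).2⟩

/-- Since a vertex of out-degree `1` cannot be left, a path that ends at a vertex of larger
out-degree does not visit any such vertex. -/
theorem two_le_length_of_isRevPath (hΓ₀ : Γ.NoDeadEnds) (hΓ₁ : Γ.NoRedundantEdges)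
    (o : EdgeOrder Γ) {a c : V} {w : List E} (hw : Γ.IsRevPath a w c) (hc : 2 ≤ (o.out c).length) :
    ∀ e ∈ w, 2 ≤ (o.out (Γ.init e)).length := by
  induction w generalizing c with
  | nil => simp
  | cons e w ih =>
    have he : 2 ≤ (o.out (Γ.init e)).length := by
      by_contra hlt
      have := List.length_pos_iff.2 (o.out_ne_nil hΓ₀ (Γ.init e))
      obtain ⟨e', he'⟩ := List.length_eq_one_iff.1 (by omega : (o.out (Γ.init e)).length = 1)
      obtain ⟨h1, h2, h3⟩ := o.loop_of_out_eq hΓ₁ he'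
      obtain rfl := h1 e rfl
      rw [← hw.2, h3, he'] at hc
      simp at hc
    exact List.forall_mem_cons.2 ⟨he, ih hw.1 he⟩

theorem map_eq_of_zip {S T : Type*} {l : List S} {m : List T} {n : List E} {f : S → T}
    (hl : l.length = n.length) (hm : m.length = n.length)
    (h : ∀ s t e, (s, e) ∈ l.zip n → (t, e) ∈ m.zip n → f s = t) : l.map f = m := by
  refine List.ext_getElem (by simp [hl, hm]) fun k h1 h2 => ?_
  rw [List.getElem_map]
  have h1' : k < l.length := by simpa using h1
  refine h _ _ n[k] ?_ ?_
  · exact List.mem_iff_getElem.2 ⟨k, by simp; omega, by simp⟩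
  · exact List.mem_iff_getElem.2 ⟨k, by simp; omega, by simp⟩

/-! ### Reduced strand diagrams are determined by their action on rays -/

namespace StrandDiagram

variable {o : EdgeOrder Γ} {x y : Tuple V} {A B : StrandDiagram o x y} {i : Fin x.length}
  {j : Fin y.length} {w r : List E} {s : A.Strand}

/-- Suppose `sem` sends `iw` to `jr`. Then it sends the cylinder of each strand leaving the split,
with edge `e`, to `jre`. By induction downwards such a strand does not end at a split, so it has an
address from below, which must be `jre` because targets are unique. Hence all these strands enter,
in order, the merge above the strand with address `jr`, and a type 1 reduction would be possible. -/
theorem Reduced.not_canonicalAt (hΓ₀ : Γ.NoDeadEnds) (hΓ₁ : Γ.NoRedundantEdges) (hA : A.Reduced)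
    (h : A.Address i w s) (hs : A.IsSplit (A.term s)) {c : V} : ¬ CanonicalAt A.sem i w j r c := by
  obtain ⟨p, hp⟩ : ∃ p, A.term s = p := ⟨_, rfl⟩
  induction p using A.wellFounded_adj.induction generalizing s w r c with
  | _ p ih =>
    intro hc
    obtain rfl := hc.left.eq_end (h.isRevPath hA)
    rw [hp] at hs
    have hcol : A.strandCol s = A.pointCol p := (A.split_col p hs).2 s ((A.mem_ins _ _).2 hp)
    rw [hcol] at hc
    have hlen := (A.fits_outs p).length_eq hs.2
    -- The word `r` ends at the color of the split, which has at least two outgoing edges, so `r`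
    -- avoids the loops of out-degree one, and uniqueness of targets applies.
    have hr := two_le_length_of_isRevPath hΓ₀ hΓ₁ o hc.right (hs.2.trans_eq hlen)
    have key : ∀ s' e, (s', e) ∈ (A.outs p).zip (o.out (A.pointCol p)) →
        A.flip.Address j (e :: r) s' := by
      intro s' e he
      have hi := (A.mem_outs _ _).1 (List.of_mem_zip he).1
      have hinit := (o.mem_out _ _).1 (List.of_mem_zip he).2
      have h1 : A.Address i (e :: w) s' := ⟨s, h, by rwa [hp], by rwa [hp]⟩
      have h2 := hc.extend (u := [e]) (c' := Γ.term e) ⟨hinit, rfl⟩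
      have h3 : ¬ A.IsSplit (A.term s') := fun h3 => ih _ ⟨s', hi, rfl⟩ h1 h3 rfl h2
      obtain ⟨j', r', h4⟩ := hA.flip.exists_address s' h3
      obtain ⟨rfl, rfl⟩ := CanonicalAt.right_unique hΓ₀ o (List.forall_mem_append.2
        ⟨by rw [List.forall_mem_singleton, hinit, ← hlen]; exact hs.2, hr⟩)
        (fun _ => h4.two_le_length) h2 (h1.canonicalAt h4 hA)
      exact h4
    have hpos : 0 < (A.outs p).length := by have := hs.2; omega
    obtain ⟨s₀, hs₀⟩ := List.exists_mem_of_length_pos hpos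
    obtain ⟨e₀, he₀⟩ := exists_mem_zip_left hlen hs₀
    obtain ⟨t, h1, h2, h3⟩ := key s₀ e₀ he₀
    have hcol' : A.pointCol p = A.pointCol (A.init t) :=
      ((o.mem_out _ _).1 (List.of_mem_zip he₀).2).symm.trans
        ((o.mem_out _ _).1 (List.of_mem_zip h3).2)
    have hlen' := (A.fits_ins (A.init t)).length_eq h2.2
    -- By uniqueness of addresses the merge is the same for all the outgoing strands, and the
    -- letters show that the positions agree; this is the excluded equality of lists.
    refine hA.outs_ne_ins p (A.init t) hs h2 hcol' (Eq.trans (List.map_id _).symm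
      (map_eq_of_zip hlen (hlen'.trans (by rw [hcol'])) fun s' s'' e he he' => ?_))
    obtain ⟨t', h1', h2', h3'⟩ := key s' e he
    obtain rfl := hA.flip.address_unique h1 h1'
    rw [hcol'] at he'
    exact mem_zip_fst_unique (o.out_nodup _) h3' he'

/-- Where `A` splits, `B` has to split too: otherwise the strand of `B` with this address would also
have an address from below, and the common action would be canonical on its cylinder. -/
theorem Reduced.address_transfer (hΓ₀ : Γ.NoDeadEnds) (hΓ₁ : Γ.NoRedundantEdges) (hA : A.Reduced)
    (hB : B.Reduced) (hAB : A.sem = B.sem) (h : A.Address i w s) :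
    ∃ s', B.Address i w s' := by
  induction w generalizing s with
  | nil =>
    obtain ⟨t, ht⟩ := List.length_eq_one_iff.1 (hB.source i).2
    exact ⟨t, (B.mem_outs _ _).1 (by simp [ht])⟩
  | cons e w ih =>
    obtain ⟨t, h1, h2, h3⟩ := h
    obtain ⟨t', h1'⟩ := ih h1
    have h2' : B.IsSplit (B.term t') := by
      by_contra h2'
      obtain ⟨j, r, h4⟩ := hB.flip.exists_address t' h2'
      exact hA.not_canonicalAt hΓ₀ hΓ₁ h1 h2 (hAB ▸ h1'.canonicalAt h4 hB)
    have hcol : B.pointCol (B.term t') = A.pointCol (A.term t) := by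
      rw [← (A.split_col _ h2).2 t ((A.mem_ins _ _).2 rfl),
        ← (B.split_col _ h2').2 t' ((B.mem_ins _ _).2 rfl)]
      exact (h1'.isRevPath hB).eq_end (h1.isRevPath hA)
    obtain ⟨s', hs'⟩ := exists_mem_zip_right ((B.fits_outs (B.term t')).length_eq h2'.2)
      (hcol ▸ (List.of_mem_zip h3).2)
    exact ⟨s', t', h1', h2', hs'⟩

theorem Reduced.isSplit_transfer (hΓ₀ : Γ.NoDeadEnds) (hΓ₁ : Γ.NoRedundantEdges) (hA : A.Reduced)
    (hB : B.Reduced) (hAB : A.sem = B.sem) (h : A.Address i w s) {s' : B.Strand}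
    (h' : B.Address i w s') (hs : A.IsSplit (A.term s)) : B.IsSplit (B.term s') := by
  by_contra h2
  obtain ⟨j, r, h4⟩ := hB.flip.exists_address s' h2
  exact hA.not_canonicalAt hΓ₀ hΓ₁ h hs (hAB ▸ h'.canonicalAt h4 hB)

/-! ### Matching strands and points of two reduced diagrams -/

/-- The strands `s` and `s'` have a common address from above or from below. -/
def Matches (A B : StrandDiagram o x y) (s : A.Strand) (s' : B.Strand) : Prop :=
  (∃ i w, A.Address i w s ∧ B.Address i w s') ∨
    ∃ j r, A.flip.Address j r s ∧ B.flip.Address j r s'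

theorem Matches.symm {s' : B.Strand} (h : Matches A B s s') : Matches B A s' s :=
  h.imp (fun ⟨i, w, h⟩ => ⟨i, w, h.symm⟩) fun ⟨i, w, h⟩ => ⟨i, w, h.symm⟩

theorem Matches.flip {s' : B.Strand} (h : Matches A B s s') : Matches A.flip B.flip s s' :=
  Or.symm h

theorem Matches.strandCol {s' : B.Strand} (h : Matches A B s s') (hA : A.Reduced)
    (hB : B.Reduced) : B.strandCol s' = A.strandCol s := by
  rcases h with ⟨i, w, h, h'⟩ | ⟨j, r, h, h'⟩
  · exact (h'.isRevPath hB).eq_end (h.isRevPath hA)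
  · exact (h'.isRevPath hB.flip).eq_end (h.isRevPath hA.flip)

/-- A strand with both addresses makes the action canonical on its cylinder. This forces its
counterpart in `B` to end not at a split but on the way to a sink, and uniqueness of targets gives
the lower address. So matching from above and matching from below agree. -/
theorem Reduced.address_flip_transfer (hΓ₀ : Γ.NoDeadEnds) (hΓ₁ : Γ.NoRedundantEdges)
    (hA : A.Reduced) (hB : B.Reduced) (hAB : A.sem = B.sem) (h : A.Address i w s) {s' : B.Strand}
    (h' : B.Address i w s') (hs : A.flip.Address j r s) : B.flip.Address j r s' := by
  have h1 := h.canonicalAt hs hA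
  rw [hAB] at h1
  have h2 : ¬ B.IsSplit (B.term s') := fun h2 => hB.not_canonicalAt hΓ₀ hΓ₁ h' h2 h1
  obtain ⟨j', r', h3⟩ := hB.flip.exists_address s' h2
  obtain ⟨rfl, rfl⟩ := CanonicalAt.right_unique hΓ₀ o (fun _ => hs.two_le_length)
    (fun _ => h3.two_le_length) h1 (h'.canonicalAt h3 hB)
  exact h3

theorem Reduced.matches_unique (hΓ₀ : Γ.NoDeadEnds) (hΓ₁ : Γ.NoRedundantEdges) (hA : A.Reduced)
    (hB : B.Reduced) (hAB : A.sem = B.sem) {t t' : B.Strand} (h : Matches A B s t)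
    (h' : Matches A B s t') : t = t' := by
  rcases h with ⟨i, w, h1, h2⟩ | ⟨j, r, h1, h2⟩ <;>
    rcases h' with ⟨i', w', h3, h4⟩ | ⟨j', r', h3, h4⟩
  · obtain ⟨rfl, rfl⟩ := hA.address_injective h1 h3
    exact hB.address_unique h2 h4
  · exact hB.flip.address_unique (hA.address_flip_transfer hΓ₀ hΓ₁ hB hAB h1 h2 h3) h4
  · exact hB.flip.address_unique h2 (hA.address_flip_transfer hΓ₀ hΓ₁ hB hAB h3 h4 h1)
  · obtain ⟨rfl, rfl⟩ := hA.flip.address_injective h1 h3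
    exact hB.flip.address_unique h2 h4

theorem sem_flip_eq (h : A.sem = B.sem) : A.flip.sem = B.flip.sem := by
  rw [sem_flip, sem_flip, h]

theorem Reduced.exists_matches (hΓ₀ : Γ.NoDeadEnds) (hΓ₁ : Γ.NoRedundantEdges) (hA : A.Reduced)
    (hB : B.Reduced) (hAB : A.sem = B.sem) (s : A.Strand) : ∃ t, Matches A B s t := by
  by_cases hs : A.IsMerge (A.init s)
  · obtain ⟨j, r, h⟩ := hA.flip.exists_address s (hA.not_merge_split s hs)
    obtain ⟨t, ht⟩ := hA.flip.address_transfer hΓ₀ hΓ₁ hB.flip (sem_flip_eq hAB) h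
    exact ⟨t, .inr ⟨j, r, h, ht⟩⟩
  · obtain ⟨i, w, h⟩ := hA.exists_address s hs
    obtain ⟨t, ht⟩ := hA.address_transfer hΓ₀ hΓ₁ hB hAB h
    exact ⟨t, .inl ⟨i, w, h, ht⟩⟩

theorem Reduced.exists_strandEquiv (hΓ₀ : Γ.NoDeadEnds) (hΓ₁ : Γ.NoRedundantEdges)
    (hA : A.Reduced) (hB : B.Reduced) (hAB : A.sem = B.sem) :
    ∃ S : A.Strand ≃ B.Strand, ∀ s t, Matches A B s t ↔ S s = t := by
  choose f hf using hA.exists_matches hΓ₀ hΓ₁ hB hAB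
  choose g hg using hB.exists_matches hΓ₀ hΓ₁ hA hAB.symm
  refine ⟨⟨f, g, fun s => ?_, fun t => ?_⟩, fun s t => ⟨fun h => ?_, ?_⟩⟩
  · exact hB.matches_unique hΓ₀ hΓ₁ hA hAB.symm (hg _) (hf s).symm
  · exact hA.matches_unique hΓ₀ hΓ₁ hB hAB (hf _) (hg t).symm
  · exact hA.matches_unique hΓ₀ hΓ₁ hB hAB (hf s) h
  · rintro rfl
    exact hf s

/-- The points `p` and `q` have the same color and the same strands, up to `S`. -/
structure PointMatches (S : A.Strand → B.Strand) (p : A.Point) (q : B.Point) : Prop where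
  pointCol : B.pointCol q = A.pointCol p
  ins : B.ins q = (A.ins p).map S
  outs : B.outs q = (A.outs p).map S

theorem Reduced.pointMatches_source (hA : A.Reduced) (hB : B.Reduced) {S : A.Strand → B.Strand}
    (hS : ∀ s t, Matches A B s t → S s = t) (i : Fin x.length) :
    PointMatches S (A.source i) (B.source i) := by
  obtain ⟨s, hs⟩ := List.length_eq_one_iff.1 (hA.source i).2
  obtain ⟨t, ht⟩ := List.length_eq_one_iff.1 (hB.source i).2
  have h1 : A.Address i [] s := (A.mem_outs _ _).1 (by simp [hs])
  have h2 : B.Address i [] t := (B.mem_outs _ _).1 (by simp [ht])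
  refine ⟨(B.source_col i).trans (A.source_col i).symm, ?_, ?_⟩
  · rw [(A.source i).2, (B.source i).2]
    rfl
  · rw [hs, ht, List.map_singleton, hS s t (.inl ⟨i, [], h1, h2⟩)]

theorem Reduced.exists_pointMatches_split (hΓ₀ : Γ.NoDeadEnds) (hΓ₁ : Γ.NoRedundantEdges)
    (hA : A.Reduced) (hB : B.Reduced) (hAB : A.sem = B.sem) {S : A.Strand → B.Strand}
    (hS : ∀ s t, Matches A B s t → S s = t) {p : A.Point} (hp : A.IsSplit p) :
    ∃ q, PointMatches S p q := by
  obtain ⟨t, ht⟩ := hA.exists_ins_eq hp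
  have ht' : A.term t = p := (A.mem_ins _ _).1 (by simp [ht])
  subst ht'
  obtain ⟨i, w, h1⟩ := hA.exists_address t fun h => hA.not_merge_split t h hp
  obtain ⟨t', h1'⟩ := hA.address_transfer hΓ₀ hΓ₁ hB hAB h1
  have hp' := hA.isSplit_transfer hΓ₀ hΓ₁ hB hAB h1 h1' hp
  have hcol : B.pointCol (B.term t') = A.pointCol (A.term t) := by
    rw [← (A.split_col _ hp).2 t ((A.mem_ins _ _).2 rfl),
      ← (B.split_col _ hp').2 t' ((B.mem_ins _ _).2 rfl)]
    exact (h1'.isRevPath hB).eq_end (h1.isRevPath hA)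
  refine ⟨B.term t', hcol, ?_, ?_⟩
  · obtain ⟨t₀, ht₀⟩ := hB.exists_ins_eq hp'
    have := (B.mem_ins _ t').2 rfl
    rw [ht₀, List.mem_singleton] at this
    rw [ht, ht₀, List.map_singleton, hS t t' (.inl ⟨i, w, h1, h1'⟩), this]
  · refine (map_eq_of_zip ((A.fits_outs _).length_eq hp.2)
      (((B.fits_outs _).length_eq hp'.2).trans (by rw [hcol])) fun s s' e he he' => ?_).symm
    exact hS _ _ (.inl ⟨i, e :: w, ⟨t, h1, hp, he⟩, ⟨t', h1', hp', by rwa [hcol]⟩⟩)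

theorem Reduced.exists_pointMatches (hΓ₀ : Γ.NoDeadEnds) (hΓ₁ : Γ.NoRedundantEdges)
    (hA : A.Reduced) (hB : B.Reduced) (hAB : A.sem = B.sem) {S : A.Strand → B.Strand}
    (hS : ∀ s t, Matches A B s t → S s = t) (p : A.Point) : ∃ q, PointMatches S p q := by
  have hS' : ∀ (s : A.Strand) (t : B.Strand), Matches A.flip B.flip s t → S s = t :=
    fun s t h => hS s t h.flip
  rcases hA.kind p with ⟨i, rfl⟩ | ⟨i, rfl⟩ | h | h
  · exact ⟨_, hA.pointMatches_source hB hS i⟩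
  · have := hA.flip.pointMatches_source hB.flip hS' i
    exact ⟨_, this.pointCol, this.outs, this.ins⟩
  · exact hA.exists_pointMatches_split hΓ₀ hΓ₁ hB hAB hS h
  · obtain ⟨q, hq⟩ := hA.flip.exists_pointMatches_split hΓ₀ hΓ₁ hB.flip (sem_flip_eq hAB) hS' h
    exact ⟨q, hq.pointCol, hq.outs, hq.ins⟩

/-- No point is isolated, and any strand at a point, together with its side, determines the point.
-/
theorem PointMatches.unique {S : A.Strand → B.Strand} {p : A.Point} {q q' : B.Point}
    (h : PointMatches S p q) (h' : PointMatches S p q') : q = q' := by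
  have hne : A.ins p ≠ [] ∨ A.outs p ≠ [] := by
    by_contra! h
    exact not_isSource_and_isSink p h.1 h.2
  rcases hne with hne | hne
  · obtain ⟨s, hs⟩ := List.exists_mem_of_ne_nil _ hne
    have hs' := List.mem_map_of_mem (f := S) hs
    exact ((B.mem_ins _ _).1 (h.ins ▸ hs')).symm.trans ((B.mem_ins _ _).1 (h'.ins ▸ hs'))
  · obtain ⟨s, hs⟩ := List.exists_mem_of_ne_nil _ hne
    have hs' := List.mem_map_of_mem (f := S) hs
    exact ((B.mem_outs _ _).1 (h.outs ▸ hs')).symm.trans ((B.mem_outs _ _).1 (h'.outs ▸ hs'))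

theorem PointMatches.symm {S : A.Strand ≃ B.Strand} {p : A.Point} {q : B.Point}
    (h : PointMatches S p q) : PointMatches S.symm q p :=
  ⟨h.pointCol.symm, by rw [h.ins, List.map_map]; simp, by rw [h.outs, List.map_map]; simp⟩

theorem Reduced.isomorphic (hΓ₀ : Γ.NoDeadEnds) (hΓ₁ : Γ.NoRedundantEdges) (hA : A.Reduced)
    (hB : B.Reduced) (hAB : A.sem = B.sem) : Isomorphic A B := by
  obtain ⟨S, hS⟩ := hA.exists_strandEquiv hΓ₀ hΓ₁ hB hAB
  have hS1 : ∀ s t, Matches A B s t → S s = t := fun s t => (hS s t).1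
  have hS2 : ∀ t s, Matches B A t s → S.symm t = s := fun t s h =>
    S.symm_apply_eq.2 ((hS s t).1 h.symm).symm
  choose f hf using hA.exists_pointMatches hΓ₀ hΓ₁ hB hAB hS1
  choose g hg using hB.exists_pointMatches hΓ₀ hΓ₁ hA hAB.symm hS2
  have hfu : ∀ {p q}, PointMatches S p q → f p = q := fun h => (hf _).unique h
  refine ⟨⟨f, g, fun p => (hg _).unique (hf p).symm, fun q => hfu (hg q).symm⟩, S, fun s => ?_,
    fun s => ?_, fun p => (hf p).pointCol, fun s => ((hS s _).2 rfl).strandCol hA hB,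
    fun p => (hf p).ins, fun p => (hf p).outs,
    fun i => (hfu (hA.pointMatches_source hB hS1 i)).symm, fun i => ?_⟩
  · refine (B.mem_outs _ _).1 ?_
    exact (hf _).outs ▸ List.mem_map_of_mem ((A.mem_outs _ s).2 rfl)
  · refine (B.mem_ins _ _).1 ?_
    exact (hf _).ins ▸ List.mem_map_of_mem ((A.mem_ins _ s).2 rfl)
  · have := hA.flip.pointMatches_source hB.flip (fun s t h => hS1 s t h.flip) i
    exact (hfu ⟨this.pointCol, this.outs, this.ins⟩).symm

/-- Strand diagrams that act in the same way on rays are equivalent. -/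
theorem equiv_of_sem_eq (hΓ₀ : Γ.NoDeadEnds) (hΓ₁ : Γ.NoRedundantEdges) (h : A.sem = B.sem) :
    setoid o x y A B := by
  obtain ⟨A', hA, hA'⟩ := A.exists_reduced
  obtain ⟨B', hB, hB'⟩ := B.exists_reduced
  have h1 : A'.sem = B'.sem := (sem_eq_of_equiv hA).symm.trans (h.trans (sem_eq_of_equiv hB))
  exact .trans _ _ _ hA (.trans _ _ _ (.rel _ _ (.inl (hA'.isomorphic hΓ₀ hΓ₁ hB' h1)))
    (.symm _ _ hB))

end StrandDiagram

/-! ### The groupoid of strand diagrams -/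

section Class

variable {o : EdgeOrder Γ} {x y z : Tuple V}

/-- The bijection of rays defined by a class of strand diagrams. -/
noncomputable def StrandClass.sem (a : StrandClass o x y) : Ray Γ x ≃ Ray Γ y :=
  Quotient.lift (s := StrandDiagram.setoid o x y) StrandDiagram.sem
    (fun _ _ h => StrandDiagram.sem_eq_of_equiv h) a

theorem StrandClass.sem_toClass (A : StrandDiagram o x y) : A.toClass.sem = A.sem := rfl

theorem StrandClass.exists_toClass (a : StrandClass o x y) : ∃ A : StrandDiagram o x y,
    A.toClass = a := Quotient.exists_rep a

theorem StrandClass.sem_injective (hΓ₀ : Γ.NoDeadEnds) (hΓ₁ : Γ.NoRedundantEdges) :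
    Function.Injective (StrandClass.sem (o := o) (x := x) (y := y)) := by
  intro a b h
  obtain ⟨A, rfl⟩ := a.exists_toClass
  obtain ⟨B, rfl⟩ := b.exists_toClass
  exact Quotient.sound (StrandDiagram.equiv_of_sem_eq hΓ₀ hΓ₁ h)

theorem StrandClass.exists_hasDepth (a : StrandClass o x y) : ∃ N, HasDepth a.sem N := by
  obtain ⟨A, rfl⟩ := a.exists_toClass
  exact A.exists_hasDepth

/-- Gluing of classes of strand diagrams. -/
noncomputable def StrandClass.comp (a : StrandClass o x y) (b : StrandClass o y z) :
    StrandClass o x z :=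
  (a.exists_toClass.choose.glue b.exists_toClass.choose).toClass

theorem StrandClass.sem_comp (a : StrandClass o x y) (b : StrandClass o y z) :
    (a.comp b).sem = a.sem.trans b.sem := by
  conv_rhs => rw [← a.exists_toClass.choose_spec, ← b.exists_toClass.choose_spec]
  exact StrandDiagram.sem_glue _ _

theorem hasDepth_refl : HasDepth (Equiv.refl (Ray Γ x)) 0 :=
  fun i w _ hw _ => ⟨i, w, hw, hw, fun _ _ _ h => h⟩

/-- Since `sem` is injective on classes and turns gluing into composition, every law, including
independence of the representatives chosen in `StrandClass.comp`, is an identity between bijections.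
Identities exist because the identity map has depth zero, inverses by turning diagrams upside down.
-/
theorem exists_strandGroupoid (hΓ₀ : Γ.NoDeadEnds) (hΓ₁ : Γ.NoRedundantEdges) (o : EdgeOrder Γ) :
    ∃ 𝒢 : StrandGroupoid o, ∀ {x y z} (a : StrandClass o x y) (b : StrandClass o y z),
      𝒢.comp a b = a.comp b := by
  have hid : ∀ x, ∃ a : StrandClass o x x, a.sem = Equiv.refl _ := fun x => by
    obtain ⟨A, hA⟩ := StrandDiagram.exists_sem_eq hΓ₀ hΓ₁ o (hasDepth_refl (Γ := Γ) (x := x))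
    exact ⟨A.toClass, hA⟩
  have hinv : ∀ {x y} (a : StrandClass o x y), ∃ b : StrandClass o y x, b.sem = a.sem.symm :=
    fun a => by
      obtain ⟨A, rfl⟩ := a.exists_toClass
      exact ⟨A.flip.toClass, rfl⟩
  choose id hid using hid
  choose inv hinv using @hinv
  have inj := fun x y => StrandClass.sem_injective (o := o) (x := x) (y := y) hΓ₀ hΓ₁
  refine ⟨⟨id, StrandClass.comp, inv, fun A B => inj _ _ ?_, fun a => inj _ _ ?_,
    fun a => inj _ _ ?_, fun a b c => inj _ _ ?_, fun a => inj _ _ ?_, fun a => inj _ _ ?_⟩,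
    fun a b => rfl⟩
  · exact (StrandClass.sem_comp _ _).trans (StrandDiagram.sem_glue _ _).symm
  · rw [StrandClass.sem_comp, hid, Equiv.refl_trans]
  · rw [StrandClass.sem_comp, hid, Equiv.trans_refl]
  · rw [StrandClass.sem_comp, StrandClass.sem_comp, StrandClass.sem_comp, StrandClass.sem_comp,
      Equiv.trans_assoc]
  · rw [StrandClass.sem_comp, hinv, hid, Equiv.symm_trans_self]
  · rw [StrandClass.sem_comp, hinv, hid, Equiv.self_trans_symm]

end Class

/-! ### Points of the edge shift as rays -/

section Shift

variable {Y : V → ℕ} {k : ℕ} (e : Fin k ≃ Copy Y)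

/-- The points of the edge shift are the rays that start from the tuple of the elements of `Y`. -/
def shiftEquiv : Shift Γ Y ≃ Ray Γ ⟨k, fun i => (e i).vertex⟩ where
  toFun z := ⟨(e.symm z.start, z.path), by
    show Γ.init (z.path 0) = (e (e.symm z.start)).vertex
    rw [e.apply_symm_apply]
    exact z.init_path, z.term_path⟩
  invFun a := ⟨e a.1.1, a.1.2, a.2.1, a.2.2⟩
  left_inv z := by simp
  right_inv a := Subtype.ext (Prod.ext (e.symm_apply_apply _) rfl)

theorem shiftEquiv_val_eq_iff {z : Shift Γ Y} {c : Copy Y} {α : Stream' E} :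
    (shiftEquiv e z).1 = (e.symm c, α) ↔ z.start = c ∧ z.path = α :=
  Prod.ext_iff.trans (and_congr_left' e.symm.injective.eq_iff)

theorem shiftEquiv_val (z : Shift Γ Y) : (shiftEquiv e z).1 = (e.symm z.start, z.path) := rfl

theorem isRevPath_reverse {a c : V} {l : List E} :
    Γ.IsRevPath a l.reverse c ↔ Γ.IsPathFrom a l ∧ Γ.pathEnd a l = c := by
  induction l generalizing a with
  | nil => exact ⟨fun h => ⟨trivial, h.symm⟩, fun h => h.2.symm⟩
  | cons e l ih =>
    rw [List.reverse_cons, isRevPath_concat, ih]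
    exact and_assoc.symm

theorem Lang.isConcat_iff {p : Lang Γ Y} {α : Stream' E} {z : Shift Γ Y} :
    p.IsConcat α z ↔ z.start = p.start ∧ z.path = revAppend p.word.reverse α := by
  rw [revAppend_eq, List.reverse_reverse]
  constructor
  · rintro ⟨⟨h1, h2⟩, h3⟩
    refine ⟨h1, Stream'.ext fun n => ?_⟩
    by_cases hn : n < p.word.length
    · rw [Stream'.get_append_left _ _ _ hn]
      exact h2 n hn
    · obtain ⟨m, rfl⟩ := Nat.exists_eq_add_of_le (not_lt.1 hn)
      rw [Stream'.get_append_right]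
      exact h3 m
  · rintro ⟨h1, h2⟩
    refine ⟨⟨h1, fun n hn => ?_⟩, fun n => ?_⟩
    · rw [h2]
      exact Stream'.get_append_left _ _ _ hn
    · rw [h2]
      exact Stream'.get_append_right _ _ _

theorem Lang.mem_cylinder_iff_exists {p : Lang Γ Y} {z : Shift Γ Y} :
    z ∈ p.cylinder ↔ ∃ α, p.IsConcat α z :=
  ⟨fun h => ⟨_, h, fun _ => rfl⟩, fun ⟨_, h⟩ => h.1⟩

theorem Lang.isRevPath (p : Lang Γ Y) :
    Γ.IsRevPath (e (e.symm p.start)).vertex p.word.reverse p.color := by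
  rw [e.apply_symm_apply]
  exact isRevPath_reverse.2 ⟨p.isPath, rfl⟩

theorem isCanonicalOn_iff_canonicalAt {φ : Shift Γ Y → Shift Γ Y}
    {f : Ray Γ ⟨k, fun i => (e i).vertex⟩ ≃ Ray Γ ⟨k, fun i => (e i).vertex⟩}
    (hf : ∀ z, shiftEquiv e (φ z) = f (shiftEquiv e z)) {p q : Lang Γ Y} :
    IsCanonicalOn φ p q ↔ CanonicalAt f (e.symm p.start) p.word.reverse (e.symm q.start)
      q.word.reverse p.color := by
  constructor
  · rintro ⟨hc, h⟩
    refine ⟨p.isRevPath e, hc ▸ q.isRevPath e, fun γ hγ a ha => ?_⟩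
    obtain ⟨z, rfl⟩ := (shiftEquiv e).surjective a
    rw [← hf]
    exact (shiftEquiv_val_eq_iff e).2 (Lang.isConcat_iff.1
      (h γ z (Lang.isConcat_iff.2 ((shiftEquiv_val_eq_iff e).1 ha))))
  · intro h
    refine ⟨h.right.eq_end (q.isRevPath e), fun α z hz => ?_⟩
    have hz' := (shiftEquiv_val_eq_iff e).2 (Lang.isConcat_iff.1 hz)
    refine Lang.isConcat_iff.2 ((shiftEquiv_val_eq_iff e).1 ?_)
    rw [hf]
    -- `IsConcat` allows an arbitrary stream `α`, but as the remainder of a point it is a ray at the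
    -- color of `p`.
    refine h.map α ((isRay_revAppend h.left).1 ?_) _ hz'
    have hr := (shiftEquiv e z).2
    rwa [hz'] at hr

/-! ### Piecewise-canonical homeomorphisms and bijections of finite depth -/

/-- A map that is canonical on some cylinder around each point is continuous. -/
theorem continuous_of_isCanonicalOn {φ : Shift Γ Y → Shift Γ Y}
    (h : ∀ z, ∃ p q, z ∈ p.cylinder ∧ IsCanonicalOn φ p q) : Continuous φ := by
  refine continuous_generateFrom_iff.2 ?_
  rintro _ ⟨q, rfl⟩
  refine isOpen_iff_forall_mem_open.2 fun z hz => ?_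
  obtain ⟨p, r, hp, hpr⟩ := h z
  have h2 := (isCanonicalOn_iff.1 hpr).2
  -- The first `|p|` letters keep a point in `C_p`, and the next `|q|` letters are copied behind
  -- `r`, which fixes at least the first `|q|` letters of the image.
  refine ⟨(z.take (p.word.length + q.word.length)).cylinder, fun z' hz' => ?_,
    .basic _ ⟨_, rfl⟩, Shift.mem_cylinder_take.2 ⟨rfl, fun _ _ => rfl⟩⟩
  rw [Shift.mem_cylinder_take] at hz'
  have hp' : z' ∈ p.cylinder :=
    (Lang.mem_cylinder_iff hp).2 ⟨hz'.1, fun i hi => hz'.2 i (by omega)⟩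
  have h3 := (Lang.mem_cylinder_iff (h2 z hp).1).1 (h2 z' hp').1
  refine (Lang.mem_cylinder_iff hz).2 ⟨h3.1, fun i hi => ?_⟩
  by_cases hir : i < r.word.length
  · exact h3.2 i hir
  · obtain ⟨n, rfl⟩ := Nat.exists_eq_add_of_le (not_lt.1 hir)
    rw [(h2 z hp).2, (h2 z' hp').2]
    exact hz'.2 _ (by omega)

theorem DirectedGraph.IsRevPath.of_append {a b c : V} {w u : List E}
    (h : Γ.IsRevPath a (u ++ w) c) (hw : Γ.IsRevPath a w b) : Γ.IsRevPath b u c := by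
  induction u generalizing c with
  | nil => exact h.eq_end hw
  | cons e u ih => exact ⟨ih h.1, h.2⟩

/-- Take the longest word of the partition of the domain as the depth. A word at least that long
extends to a point, for want of dead ends; the partition word of this point is a prefix of the given
word, so the map is canonical there by restriction. -/
theorem IsPiecewiseCanonical.exists_hasDepth (hΓ₀ : Γ.NoDeadEnds) {φ : Shift Γ Y ≃ₜ Shift Γ Y}
    (h : IsPiecewiseCanonical φ)
    {f : Ray Γ ⟨k, fun i => (e i).vertex⟩ ≃ Ray Γ ⟨k, fun i => (e i).vertex⟩}
    (hf : ∀ z, shiftEquiv e (φ z) = f (shiftEquiv e z)) : ∃ N, HasDepth f N := by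
  obtain ⟨n, p, q, hp, -, hpq⟩ := h
  refine ⟨Finset.univ.sup fun m => (p m).word.length, fun i w c hw hl => ?_⟩
  obtain ⟨γ, hγ⟩ := hΓ₀.exists_isRay c
  let a : Ray Γ ⟨k, fun i => (e i).vertex⟩ := ⟨(i, revAppend w γ), (isRay_revAppend hw).2 hγ⟩
  obtain ⟨z, hz⟩ := (shiftEquiv e).surjective a
  have hz' := (shiftEquiv_val e z).symm.trans (congrArg Subtype.val hz)
  obtain ⟨hz1, hz2⟩ := Prod.mk.inj hz'
  obtain ⟨m, hm, -⟩ := hp z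
  obtain ⟨α, hα⟩ := Lang.mem_cylinder_iff_exists.1 hm
  obtain ⟨hα1, hα2⟩ := Lang.isConcat_iff.1 hα
  have hlm : (p m).word.length ≤ w.length :=
    (Finset.le_sup (f := fun m => (p m).word.length) (Finset.mem_univ m)).trans hl
  obtain ⟨u, v, rfl, hv⟩ : ∃ u v, w = u ++ v ∧ v.length = (p m).word.reverse.length :=
    ⟨w.take (w.length - (p m).word.length), w.drop (w.length - (p m).word.length), by simp,
      by simp; omega⟩
  rw [revAppend_append, hα2] at hz2
  obtain ⟨rfl, -⟩ := eq_of_revAppend_eq hv hz2.symm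
  obtain rfl : i = e.symm (p m).start := hz1.symm.trans (by rw [hα1])
  exact ⟨_, _, ((isCanonicalOn_iff_canonicalAt e hf).1 (hpq m)).extend
    (hw.of_append ((p m).isRevPath e))⟩

theorem finite_lang_length [Finite V] [Finite E] (N : ℕ) :
    Finite {p : Lang Γ Y // p.word.length = N} := by
  have : Finite (Copy Y) := Finite.of_injective
    (fun y : Copy Y => (⟨y.vertex, y.index⟩ : Σ a, Fin (Y a)))
    (by rintro ⟨a, i⟩ ⟨b, j⟩ hij; simpa using hij)
  have : Finite {l : List E // l.length = N} := List.finite_length_eq E N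
  refine Finite.of_injective (β := Copy Y × {l : List E // l.length = N})
    (fun p => (p.1.start, ⟨p.1.word, p.2⟩)) fun p p' h => Subtype.ext (Lang.ext ?_ ?_)
  · exact (Prod.ext_iff.1 h).1
  · exact congrArg Subtype.val (Prod.ext_iff.1 h).2

theorem isCylinderPartition_length (N : ℕ) :
    IsCylinderPartition fun p : {p : Lang Γ Y // p.word.length = N} => p.1 := by
  intro z
  refine ⟨⟨z.take N, z.length_take N⟩, Shift.mem_cylinder_take.2 ⟨rfl, fun _ _ => rfl⟩, ?_⟩
  rintro ⟨p, hp⟩ hz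
  refine Subtype.ext (Lang.ext hz.1.symm ?_)
  refine List.ext_getElem (hp.trans (z.length_take N).symm) fun n h1 h2 => ?_
  rw [← hz.2 n h1]
  simp [Shift.take]

/-- The cylinders of all paths of length `N` form a finite partition, and each is carried
canonically onto a cylinder. The images form a partition because the map is bijective, and being
canonical around each point gives continuity in both directions. -/
theorem HasDepth.exists_isPiecewiseCanonical [Finite V] [Finite E]
    {f : Ray Γ ⟨k, fun i => (e i).vertex⟩ ≃ Ray Γ ⟨k, fun i => (e i).vertex⟩} {N : ℕ}
    (h : HasDepth f N) : ∃ φ : PiecewiseCanonical Γ Y,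
      ∀ z, shiftEquiv e (φ.1 z) = f (shiftEquiv e z) := by
  let ψ : Shift Γ Y ≃ Shift Γ Y := (shiftEquiv e).trans (f.trans (shiftEquiv e).symm)
  have hψ : ∀ z, shiftEquiv e (ψ z) = f (shiftEquiv e z) := fun z => by simp [ψ]
  have hψ' : ∀ z, shiftEquiv e (ψ.symm z) = f.symm (shiftEquiv e z) := fun z => by simp [ψ]
  have key : ∀ p : {p : Lang Γ Y // p.word.length = N}, ∃ q : Lang Γ Y,
      IsCanonicalOn ψ p.1 q ∧ IsCanonicalOn ψ.symm q p.1 := by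
    rintro ⟨p, hp⟩
    obtain ⟨j, r, hr⟩ := h (e.symm p.start) p.word.reverse p.color (p.isRevPath e) (by simp [hp])
    have hr' := hr.right
    rw [← r.reverse_reverse, isRevPath_reverse] at hr'
    have h1 : IsCanonicalOn ψ p ⟨e j, r.reverse, hr'.1⟩ :=
      (isCanonicalOn_iff_canonicalAt e hψ).2 (by simpa using hr)
    refine ⟨_, h1, (isCanonicalOn_iff_canonicalAt e hψ').2 ?_⟩
    rw [← h1.1]
    simpa using hr.symm
  choose q hq hq' using key
  have hw := isCylinderPartition_length (Γ := Γ) (Y := Y) N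
  have hmem : ∀ p z, ψ.symm z ∈ p.1.cylinder ↔ z ∈ (q p).cylinder := fun p z =>
    ⟨fun hz => by simpa using ((isCanonicalOn_iff.1 (hq p)).2 _ hz).1,
      fun hz => ((isCanonicalOn_iff.1 (hq' p)).2 _ hz).1⟩
  have hr : IsCylinderPartition q := fun z => by
    simpa only [hmem] using hw (ψ.symm z)
  have := finite_lang_length (Γ := Γ) (Y := Y) N
  refine ⟨⟨⟨ψ, continuous_of_isCanonicalOn fun z => ?_, continuous_of_isCanonicalOn fun z => ?_⟩,
    isPiecewiseCanonical_of_finite _ q hw hr hq⟩, hψ⟩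
  · obtain ⟨p, hp, -⟩ := hw z
    exact ⟨p.1, q p, hp, hq p⟩
  · obtain ⟨p, hp, -⟩ := hr z
    exact ⟨q p, p.1, hp, hq' p⟩

end Shift

end EdgeShift

/-! ### The isomorphism of `G(Γ|Y)` with the vertex group -/

theorem mainTheorem4 {V : Type*} {E : Type*} [Finite V] [Finite E] (Γ : EdgeShift.DirectedGraph V E)
    (hΓ₀ : Γ.NoDeadEnds) (hΓ₁ : Γ.NoRedundantEdges) (o : EdgeShift.EdgeOrder Γ)
    (Y : V → ℕ) [LinearOrder (EdgeShift.Copy Y)] (k : ℕ) (y : Fin k ≃o EdgeShift.Copy Y) :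
    ∃ 𝒢 : EdgeShift.StrandGroupoid o,
      Nonempty (EdgeShift.PiecewiseCanonical Γ Y ≃*
        (𝒢.obj ⟨k, fun i => (y i).vertex⟩ ⟶ 𝒢.obj ⟨k, fun i => (y i).vertex⟩)) := by
  obtain ⟨𝒢, h𝒢⟩ := EdgeShift.exists_strandGroupoid hΓ₀ hΓ₁ o
  refine ⟨𝒢, ?_⟩
  let T : EdgeShift.Tuple V := ⟨k, fun i => (y i).vertex⟩
  have key : ∀ a : EdgeShift.StrandClass o T T, ∃ φ : EdgeShift.PiecewiseCanonical Γ Y,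
      ∀ z, EdgeShift.shiftEquiv y.toEquiv (φ.1 z) =
        a.sem (EdgeShift.shiftEquiv y.toEquiv z) := fun a =>
    EdgeShift.HasDepth.exists_isPiecewiseCanonical y.toEquiv a.exists_hasDepth.choose_spec
  choose ψ hψ using key
  have hψ_eq : ∀ (a : EdgeShift.StrandClass o T T) (φ : EdgeShift.PiecewiseCanonical Γ Y),
      (∀ z, EdgeShift.shiftEquiv y.toEquiv (φ.1 z) =
        a.sem (EdgeShift.shiftEquiv y.toEquiv z)) → ψ a = φ := fun a φ h =>
    Subtype.ext (Homeomorph.ext fun z =>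
      (EdgeShift.shiftEquiv y.toEquiv).injective ((hψ a z).trans (h z).symm))
  -- Products on both sides are read from left to right, in the vertex group as in the group of
  -- homeomorphisms, so the map is multiplicative without passing to an opposite.
  let F : (𝒢.obj T ⟶ 𝒢.obj T) →ₙ* EdgeShift.PiecewiseCanonical Γ Y :=
    ⟨ψ, fun a b => hψ_eq _ _ fun z => by
      have h1 : EdgeShift.StrandClass.sem (𝒢.comp a b) = _ :=
        (congrArg _ (h𝒢 a b)).trans (EdgeShift.StrandClass.sem_comp a b)
      refine Eq.trans ?_ (congrArg (fun f => f (EdgeShift.shiftEquiv y.toEquiv z)) h1).symm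
      exact (hψ b _).trans (congrArg _ (hψ a z))⟩
  refine ⟨(MulEquiv.ofBijective F ⟨fun a b hab => ?_, fun φ => ?_⟩).symm⟩
  · refine EdgeShift.StrandClass.sem_injective hΓ₀ hΓ₁ (Equiv.ext fun r => ?_)
    obtain ⟨z, rfl⟩ := (EdgeShift.shiftEquiv y.toEquiv).surjective r
    have hab' : ψ a = ψ b := hab
    exact (hψ a z).symm.trans ((by rw [hab'] : _ = _).trans (hψ b z))
  -- Surjectivity: transported to rays, `φ` has finite depth, hence is the action of a diagram.
  · let f := ((EdgeShift.shiftEquiv y.toEquiv).symm.trans φ.1.toEquiv).trans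
      (EdgeShift.shiftEquiv y.toEquiv)
    have hf : ∀ z, EdgeShift.shiftEquiv y.toEquiv (φ.1 z) =
        f (EdgeShift.shiftEquiv y.toEquiv z) := fun z => by simp [f]
    obtain ⟨N, hN⟩ := φ.2.exists_hasDepth y.toEquiv hΓ₀ hf
    obtain ⟨A, hA⟩ := EdgeShift.StrandDiagram.exists_sem_eq hΓ₀ hΓ₁ o hN
    refine ⟨A.toClass, hψ_eq _ _ fun z => ?_⟩
    rw [hf, EdgeShift.StrandClass.sem_toClass, hA]
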